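/- **Setting.** Let $N\ge 2$ and let $F_N$ be the free group of rank $N$, with boundary $\partial F_N$ and double boundary $\partial^2F_N=\{(x,y): x\ne y\}$. A *geodesic current* is a Radon measure on $\partial^2F_N$ invariant under $F_N$ and under the flip $(x,y)\mapsto(y,x)$; $Curr(F_N)$ carries the weak-* topology, and $\mathbb{P}Curr(F_N)$ is the quotient of $Curr(F_N)\smallsetminus\{0\}$ by positive scaling. An automorphism acts by $(\varphi\mu)(S)=\mu(\varphi^{-1}S)$; this depends only on its outer class. For $1\ne w=g^k$, $k\ge1$, $g$ not a proper power, $\eta_w$ is $k$ times the measure counting the $F_N$-translates of $(g^{-\infty},g^{\infty})$ and $(g^{\infty},g^{-\infty})$ in a Borel set. Let $\varphi\in Out(F_N)$ be a hyperbolic (atoroidal) iwip, that is, no positive power of $\varphi$ fixes the conjugacy class of a nontrivial proper free factor or of a nontrivial element. Let $\Gamma$ be a finite connected graph without valence-one vertices, with a marking $\alpha$ that identifies $\pi_1(\Gamma)$ with $F_N$, and let $f:\Gamma\to\Gamma$ be a graph map that determines $\varphi$ through $\alpha$ and is a train track map: no edge is mapped to a vertex and $f^k(e)$ has no backtracking for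 all edges $e$ and $k\ge1$. Assume that the transition matrix satisfies $M(f)>0$ and that $f(e)$ starts with $e$ whenever $e$ is an oriented edge such that some $f^n(e)$, $n\ge1$, starts with $e$. A turn $\{a,b\}$ is legal if, for all $n\ge0$, its image under the $n$-th iterate of $Df$ is a pair of distinct edges, where $Df$ sends an oriented edge to the first edge of its $f$-image; an edge path is legal if all its turns are. Lengths $\ell_\Gamma$ are numbers of edges, and $[\rho]$ is the reduced path homotopic to $\rho$ relative to endpoints. Let $\lambda'>1$ be such that $\ell_\Gamma(f(v))\ge\lambda'\ell_\Gamma(v)$ for every legal path $v$, and let $C_f$ be a bounded cancellation constant: $\ell_\Gamma([f(\rho_1\rho_2)])\ge\ell_\Gamma([f(\rho_1)])+\ell_\Gamma([f(\rho_2)])-2C_f$ for every reduced path $\rho_1\rho_2$. The *goodness* $\gamma([w])\in[0,1]$ of the conjugacy class of $w\ne1$ is the proportion of those edges of the reduced circuit $c$ in $\Gamma$ representing $[w]$ whose distance, along $c$, to every illegal turn of $c$ is at least $C_f/(\lambda'-1)$. For a reduced edge path $v$ of positive length, let $\langle v,u\rangle$ be the number of occurrences of $v$ and of $v^{-1}$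 in an edge path $u$, and let $\langle v,\mu\rangle_\alpha$ be the $\mu$-measure of the set of pairs $(x,y)\in\partial^2F_N$ such that the geodesic from $x$ to $y$ in the universal cover $\tilde\Gamma$ runs through a fixed lift of $v$. A *stable current* of $\varphi$ is a nonzero current $\mu_+$ with $$\langle v,\mu_+\rangle_\alpha=\lim_{n\to\infty}\frac{\langle v,f^n(e)\rangle}{\ell_\Gamma(f^n(e))}\quad\text{for every such } v \text{ and every oriented edge } e.$$ **Lemma.** A stable current $\mu_+$ exists. Moreover, given $\delta>0$ and a neighborhood $U$ of $[\mu_+]$ in $\mathbb{P}Curr(F_N)$, there is an integer $M=M(\delta,U)\ge0$ such that for every $1\ne w\in F_N$ with $\gamma([w])\ge\delta$ we have $\varphi^n([\eta_w])\in U$ for all $n\ge M$. -/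

import Mathlib

open MeasureTheory Filter Topology
open scoped NNReal ENNReal CompactlySupported

noncomputable section

namespace FreeCurrents

/-! ### The boundary and the double boundary of a free group

Words over `A` are lists in `A × Bool`, the convention of `FreeGroup A`: the letter `(a, true)` is
`a` and `(a, false)` is `a⁻¹`. -/

/-- The inverse of a letter. -/
def invLetter {A : Type*} (a : A × Bool) : A × Bool := (a.1, !a.2)

/-- Infinite reduced words in the letters `A^±`. For `A` finite this is the Gromov boundary of
`FreeGroup A`. -/
def Boundary (A : Type*) : Type _ :=
  {x : ℕ → A × Bool // ∀ n, (x n).1 = (x (n + 1)).1 → (x n).2 = (x (n + 1)).2}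

/-- The boundary of `F_N` has the topology of letterwise convergence. -/
instance (N : ℕ) : TopologicalSpace (Boundary (Fin N)) :=
  inferInstanceAs (TopologicalSpace
    {x : ℕ → Fin N × Bool // ∀ n, (x n).1 = (x (n + 1)).1 → (x n).2 = (x (n + 1)).2})

/-- The word formed by the first `n` letters of a boundary point. -/
def Boundary.word {A : Type*} (x : Boundary A) (n : ℕ) : List (A × Bool) :=
  List.ofFn fun i : Fin n => x.1 i

/-- The group element represented by the first `n` letters of a boundary point. -/
def Boundary.prefix {A : Type*} (x : Boundary A) (n : ℕ) : FreeGroup A :=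
  FreeGroup.mk (x.word n)

/-- The sequence `g n` of group elements converges to the boundary point `x`: for every `k`, the
reduced word of `g n` begins with the first `k` letters of `x` when `n` is large. -/
def ConvergesTo {A : Type*} [DecidableEq A] (g : ℕ → FreeGroup A) (x : Boundary A) : Prop :=
  ∀ k : ℕ, ∀ᶠ n in atTop, x.word k <+: (g n).toWord

open Classical in
/-- The extension to the boundary of a self-map `ψ` of `F_N` (used for automorphisms and for left
translations, which all extend): `x` is sent to the limit of `ψ (x₀ ⋯ xₙ₋₁)`. -/
def bdryMap {N : ℕ} (ψ : FreeGroup (Fin N) → FreeGroup (Fin N)) (x : Boundary (Fin N)) :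
    Boundary (Fin N) :=
  if h : ∃ y, ConvergesTo (fun n => ψ (x.prefix n)) y then h.choose else x

/-- The double boundary: ordered pairs of distinct boundary points. -/
def DoubleBoundary (N : ℕ) : Type :=
  {p : Boundary (Fin N) × Boundary (Fin N) // p.1 ≠ p.2}

instance (N : ℕ) : TopologicalSpace (DoubleBoundary N) :=
  inferInstanceAs (TopologicalSpace {p : Boundary (Fin N) × Boundary (Fin N) // p.1 ≠ p.2})

instance (N : ℕ) : MeasurableSpace (DoubleBoundary N) := borel _

instance (N : ℕ) : BorelSpace (DoubleBoundary N) := ⟨rfl⟩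

/-- The flip `(x, y) ↦ (y, x)`. -/
def flipMap {N : ℕ} (p : DoubleBoundary N) : DoubleBoundary N := ⟨(p.1.2, p.1.1), p.2.symm⟩

open Classical in
/-- The diagonal action on the double boundary of the boundary extension of `ψ` (which is injective
for automorphisms and for left translations). -/
def dblMap {N : ℕ} (ψ : FreeGroup (Fin N) → FreeGroup (Fin N)) (p : DoubleBoundary N) :
    DoubleBoundary N :=
  if h : bdryMap ψ p.1.1 ≠ bdryMap ψ p.1.2 then ⟨(bdryMap ψ p.1.1, bdryMap ψ p.1.2), h⟩ else p

/-! ### Geodesic currents -/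

/-- A geodesic current: a Borel measure on the double boundary, finite on compact sets, invariant
under `F_N` and under the flip. (The double boundary is locally compact and second countable, so
finiteness on compact sets makes the measure Radon.) -/
structure IsCurrent {N : ℕ} (μ : Measure (DoubleBoundary N)) : Prop where
  finite_on_compacts : ∀ K : Set (DoubleBoundary N), IsCompact K → μ K < ∞
  invariant : ∀ h : FreeGroup (Fin N), μ.map (dblMap fun g => h * g) = μ
  flip_invariant : μ.map flipMap = μ

/-- The nonzero geodesic currents on `F_N`. -/
def NonzeroCurrent (N : ℕ) : Type := {μ : Measure (DoubleBoundary N) // IsCurrent μ ∧ μ ≠ 0}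

/-- The weak-* topology, tested on compactly supported continuous functions. -/
instance (N : ℕ) : TopologicalSpace (NonzeroCurrent N) :=
  TopologicalSpace.induced (fun μ (u : C_c(DoubleBoundary N, ℝ)) => ∫ p, u p ∂μ.1) inferInstance

/-- Two nonzero currents are projectively equivalent if they differ by a positive factor. -/
instance projSetoid (N : ℕ) : Setoid (NonzeroCurrent N) where
  r μ ν := ∃ r : ℝ≥0, 0 < r ∧ μ.1 = r • ν.1
  iseqv :=
    { refl := fun μ => ⟨1, one_pos, (one_smul _ _).symm⟩
      symm := by
        rintro μ ν ⟨r, hr, h⟩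
        exact ⟨r⁻¹, inv_pos.2 hr, by rw [h, smul_smul, inv_mul_cancel₀ hr.ne', one_smul]⟩
      trans := by
        rintro μ ν ρ ⟨r, hr, h⟩ ⟨s, hs, h'⟩
        exact ⟨r * s, mul_pos hr hs, by rw [h, h', smul_smul]⟩ }

/-- The space of projectivized geodesic currents, with the quotient topology. -/
def PCurr (N : ℕ) : Type := Quotient (projSetoid N)

instance (N : ℕ) : TopologicalSpace (PCurr N) :=
  inferInstanceAs (TopologicalSpace (Quotient (projSetoid N)))

/-- The projective class of a nonzero current. -/
def PCurr.mk {N : ℕ} (μ : NonzeroCurrent N) : PCurr N := Quotient.mk (projSetoid N) μ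

/-- The measure `ν` is a nonzero geodesic current and its projective class lies in `U`. -/
def ClassMem {N : ℕ} (ν : Measure (DoubleBoundary N)) (U : Set (PCurr N)) : Prop :=
  ∃ h : IsCurrent ν ∧ ν ≠ 0, PCurr.mk ⟨ν, h⟩ ∈ U

/-- The image `Φ μ` of a current: `(Φ μ)(S) = μ (Φ⁻¹ S)`. -/
def autMap {N : ℕ} (Φ : MulAut (FreeGroup (Fin N))) (μ : Measure (DoubleBoundary N)) :
    Measure (DoubleBoundary N) :=
  μ.map (dblMap Φ)

/-- The set of all `F_N`-translates of `(g^{-∞}, g^{∞})` and of `(g^{∞}, g^{-∞})`, where the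
translate by `h` of `g^{±∞}` is the limit of `h * g^{±n}`. -/
def axisOrbit {N : ℕ} (g : FreeGroup (Fin N)) : Set (DoubleBoundary N) :=
  {p | ∃ h : FreeGroup (Fin N),
    (ConvergesTo (fun n => h * g⁻¹ ^ n) p.1.1 ∧ ConvergesTo (fun n => h * g ^ n) p.1.2) ∨
    (ConvergesTo (fun n => h * g ^ n) p.1.1 ∧ ConvergesTo (fun n => h * g⁻¹ ^ n) p.1.2)}

/-- The largest `k` such that `w` is a `k`-th power. For `w ≠ 1` in a free group this is the `k` for
which `w = g ^ k` with `g` not a proper power. -/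
def exponent {N : ℕ} (w : FreeGroup (Fin N)) : ℕ := sSup {k : ℕ | ∃ g, g ^ k = w}

/-- The counting current `η_w` of `w ≠ 1`: if `w = g ^ k` with `k ≥ 1` and `g` not a proper power,
it is `k` times the measure that counts the translates of `(g^{∓∞}, g^{±∞})` in a Borel set. (The
elements `w` and `g` have the same axis.) -/
def countingCurrent {N : ℕ} (w : FreeGroup (Fin N)) : Measure (DoubleBoundary N) :=
  (exponent w : ℝ≥0∞) • Measure.count.restrict (axisOrbit w)

/-! ### Automorphisms -/

/-- `H` is a free factor of `G`: `G` is the internal free product of `H` and some subgroup `K`. -/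
def IsFreeFactor {G : Type*} [Group G] (H : Subgroup G) : Prop :=
  ∃ K : Subgroup G, Function.Bijective (Monoid.Coprod.lift H.subtype K.subtype)

/-- The outer class of `Φ` is an iwip: no positive power of it fixes the conjugacy class of a
proper (and nontrivial) free factor. -/
def IsIwip {N : ℕ} (Φ : MulAut (FreeGroup (Fin N))) : Prop :=
  ∀ n : ℕ, 1 ≤ n → ∀ H : Subgroup (FreeGroup (Fin N)), IsFreeFactor H → H ≠ ⊥ → H ≠ ⊤ →
    ¬ ∃ g : FreeGroup (Fin N), H.map (Φ ^ n).toMonoidHom = H.map (MulAut.conj g).toMonoidHom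

/-- The outer class of `Φ` is atoroidal (hyperbolic): it has no nontrivial periodic conjugacy
class. -/
def IsAtoroidal {N : ℕ} (Φ : MulAut (FreeGroup (Fin N))) : Prop :=
  ∀ n : ℕ, 1 ≤ n → ∀ w : FreeGroup (Fin N), w ≠ 1 → ¬ IsConj ((Φ ^ n) w) w

/-! ### Graphs, edge paths and markings -/

/-- A graph with vertex set `V` and set of positively oriented edges `E`. The oriented edges are the
elements of `E × Bool`; `(e, false)` is `e` with the opposite orientation. -/
structure OrGraph (V E : Type*) where
  src : E → V
  tgt : E → V

namespace OrGraph

variable {V E : Type*}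

/-- The initial vertex of an oriented edge. -/
def o (Γ : OrGraph V E) (a : E × Bool) : V := if a.2 then Γ.src a.1 else Γ.tgt a.1

/-- The terminal vertex of an oriented edge. -/
def t (Γ : OrGraph V E) (a : E × Bool) : V := if a.2 then Γ.tgt a.1 else Γ.src a.1

/-- The list of oriented edges is an edge path from `u` to `v`. -/
def IsPath (Γ : OrGraph V E) : V → List (E × Bool) → V → Prop
  | u, [], v => u = v
  | u, a :: l, v => Γ.o a = u ∧ Γ.IsPath (Γ.t a) l v

/-- The list of oriented edges is an edge path. -/
def IsEdgePath (Γ : OrGraph V E) (l : List (E × Bool)) : Prop := ∃ u v, Γ.IsPath u l v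

/-- The graph is connected. -/
def IsConnected (Γ : OrGraph V E) : Prop := ∀ u v, ∃ l, Γ.IsPath u l v

/-- No vertex has valence one. -/
def NoValenceOne (Γ : OrGraph V E) : Prop := ∀ v, {a : E × Bool | Γ.o a = v}.ncard ≠ 1

end OrGraph

/-- A marking of the graph `Γ` by `F_N`, given by its action on fundamental groups: a base vertex
`p` and an isomorphism of `F_N` onto `π₁(Γ, p)`. Here `π₁(Γ, p)` consists of the reduced closed edge
paths at `p`, with concatenation followed by reduction as product; it is a subgroup of the free
group on the positive edges. Every such isomorphism is induced by a homotopy equivalence of the rose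
with `Γ`, unique up to homotopy relative to the base point. -/
structure Marking {V E : Type*} [DecidableEq E] (Γ : OrGraph V E) (N : ℕ) where
  p : V
  hom : FreeGroup (Fin N) →* FreeGroup E
  injective : Function.Injective hom
  mem_range_iff : ∀ g : FreeGroup E, g ∈ hom.range ↔ Γ.IsPath p g.toWord p

/-! ### Graph maps and train tracks -/

/-- A graph map: vertices go to vertices and edges to edge paths. -/
structure GraphMap {V E : Type*} (Γ : OrGraph V E) where
  onV : V → V
  onE : E → List (E × Bool)
  isPath : ∀ e, Γ.IsPath (onV (Γ.src e)) (onE e) (onV (Γ.tgt e))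

namespace GraphMap

variable {V E : Type*} {Γ : OrGraph V E}

/-- The image of an oriented edge. -/
def edge (f : GraphMap Γ) (a : E × Bool) : List (E × Bool) :=
  if a.2 then f.onE a.1 else FreeGroup.invRev (f.onE a.1)

/-- The image `f(l)` of an edge path, without reduction. -/
def map (f : GraphMap Γ) (l : List (E × Bool)) : List (E × Bool) := l.flatMap f.edge

/-- The homomorphism of free groups on the positive edges that is induced by `f`; on (homotopy
classes of) edge paths it is the map `γ ↦ [f(γ)]`. -/
def hom (f : GraphMap Γ) : FreeGroup E →* FreeGroup E :=
  FreeGroup.lift fun e => FreeGroup.mk (f.onE e)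

/-- `f` determines the outer class of `Φ` through the marking `α`: up to the change of base point
along some path `ρ` from `p` to `f(p)`, the map `f` acts on `π₁(Γ, p)` as `Φ`. -/
def Determines [DecidableEq E] {N : ℕ} (f : GraphMap Γ) (α : Marking Γ N)
    (Φ : MulAut (FreeGroup (Fin N))) : Prop :=
  ∃ ρ : FreeGroup E, Γ.IsPath α.p ρ.toWord (f.onV α.p) ∧
    ∀ x, α.hom (Φ x) = ρ * f.hom (α.hom x) * ρ⁻¹

/-- `f` is a train track map: no edge is collapsed to a vertex, and `f^k(e)` has no backtracking for
every edge `e` and `k ≥ 1` (for `k = 1`: `f` is tight). -/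
def IsTrainTrack (f : GraphMap Γ) : Prop :=
  (∀ e, f.onE e ≠ []) ∧
    ∀ k : ℕ, 1 ≤ k → ∀ e : E, FreeGroup.IsReduced (f.map^[k] [(e, true)])

/-- The transition matrix: its `ij` entry is the number of occurrences of `e_i^{±1}` in
`f(e_j)`. -/
def transitionMatrix [DecidableEq E] (f : GraphMap Γ) : Matrix E E ℕ :=
  fun i j => (f.onE j).countP fun a => a.1 = i

/-- Whenever some `f^n(a)`, `n ≥ 1`, starts with the oriented edge `a`, already `f(a)` does. -/
def FixesPeriodicEdges (f : GraphMap Γ) : Prop :=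
  ∀ a : E × Bool, (∃ n : ℕ, 1 ≤ n ∧ (f.map^[n] [a]).head? = some a) → (f.edge a).head? = some a

/-- The derivative of `f` on oriented edges: the first edge of `f(a)`. -/
def D (f : GraphMap Γ) (a : E × Bool) : E × Bool := (f.edge a).headD a

/-- The turn `{a, b}` is legal: none of its images under the iterates of the derivative is
degenerate. -/
def LegalTurn (f : GraphMap Γ) (a b : E × Bool) : Prop := ∀ n : ℕ, f.D^[n] a ≠ f.D^[n] b

/-- An edge path is legal if all its turns `{a⁻¹, b}`, for consecutive edges `a`, `b`, are. -/
def LegalPath (f : GraphMap Γ) (l : List (E × Bool)) : Prop :=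
  Γ.IsEdgePath l ∧ l.IsChain fun a b => f.LegalTurn (invLetter a) b

/-- The simplicial length of every legal path grows at least by the factor `L` under `f`. -/
def ExpandsLegal (f : GraphMap Γ) (L : ℝ) : Prop :=
  ∀ l, f.LegalPath l → L * (l.length : ℝ) ≤ ((f.map l).length : ℝ)

/-- `C` is a bounded cancellation constant for `f` in the simplicial metric. -/
def IsBoundedCancellation [DecidableEq E] (f : GraphMap Γ) (C : ℝ) : Prop :=
  ∀ l₁ l₂ : List (E × Bool), Γ.IsEdgePath (l₁ ++ l₂) → FreeGroup.IsReduced (l₁ ++ l₂) →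
    ((FreeGroup.reduce (f.map l₁)).length : ℝ) + (FreeGroup.reduce (f.map l₂)).length - 2 * C ≤
      (FreeGroup.reduce (f.map (l₁ ++ l₂))).length

/-! ### Goodness -/

/-- The turn of the circuit `l` at its vertex `j`, that is between the edges number `j - 1` and `j`
(indices modulo the length of `l`), is legal. -/
def LegalAt (f : GraphMap Γ) (l : List (E × Bool)) (j : ℕ) : Prop :=
  ∀ a b, l[(j + l.length - 1) % l.length]? = some a → l[j % l.length]? = some b → f.LegalTurn (invLetter a) b

/-- The distance, in a circuit of length `L`, between its edge number `i` (which joins the vertices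
`i` and `i + 1`) and its vertex number `j`, for `i, j < L`. -/
def circuitDist (L i j : ℕ) : ℕ := min ((j + L - (i + 1)) % L) ((i + L - j) % L)

/-- The edge number `i` of the circuit `c` is at distance at least `C` from every illegal turn
of `c`. -/
def GoodEdge (f : GraphMap Γ) (C : ℝ) (c : List (E × Bool)) (i : ℕ) : Prop :=
  ∀ j < c.length, ¬ f.LegalAt c j → C ≤ circuitDist c.length i j

/-- The proportion of good edges in a circuit. -/
def circuitGoodness (f : GraphMap Γ) (C : ℝ) (c : List (E × Bool)) : ℝ :=
  ({i : ℕ | i < c.length ∧ f.GoodEdge C c i}.ncard : ℝ) / c.length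

end GraphMap

/-- The reduced circuit (up to rotation) in the marked graph that represents the conjugacy class
of `w`. -/
def Marking.circuit {V E : Type*} [DecidableEq E] {Γ : OrGraph V E} {N : ℕ} (α : Marking Γ N)
    (w : FreeGroup (Fin N)) : List (E × Bool) :=
  FreeGroup.reduceCyclically (α.hom w).toWord

/-- The goodness of the conjugacy class of `w`, where `Cf` is a bounded cancellation constant and
`L > 1` an expansion factor of legal paths: the proportion of the edges of the reduced circuit of
`w` at distance at least `Cf / (L - 1)` from its illegal turns. -/
def goodness {V E : Type*} [DecidableEq E] {Γ : OrGraph V E} {N : ℕ} (α : Marking Γ N)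
    (f : GraphMap Γ) (Cf L : ℝ) (w : FreeGroup (Fin N)) : ℝ :=
  f.circuitGoodness (Cf / (L - 1)) (α.circuit w)

/-! ### Cylinders, occurrences and the stable current

The universal cover `Γ̃` of the marked graph is modelled on edge paths starting at the base vertex
`p`: its vertices are the `g : FreeGroup E` whose reduced word is an edge path starting at `p`, there
is an edge labelled `a` from `g` to `g * a`, and the points of its boundary are infinite reduced
paths starting at `p`. -/

section Cylinders

variable {V E : Type*} [DecidableEq E] {Γ : OrGraph V E} {N : ℕ}

/-- The geodesic in the tree `Γ̃` from the vertex `a` to the vertex `b` runs (in this direction)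
through the lift of the reduced path `v` that starts at the vertex `g`. -/
def PassesThrough (g : FreeGroup E) (v : List (E × Bool)) (a b : FreeGroup E) : Prop :=
  (a⁻¹ * b).toWord = (a⁻¹ * g).toWord ++ v ++ ((g * FreeGroup.mk v)⁻¹ * b).toWord

/-- The cylinder set of the lift at `g` of the reduced path `v`: the pairs `(x, y)` such that the
bi-infinite geodesic from `α̃(x)` to `α̃(y)` runs through that lift. The boundary point `α̃(x)` is the
limit of the images of the prefixes of `x`, and the geodesic from `X` to `Y` is the increasing union
of the geodesics from the `n`-th vertex of the ray `X` to the `n`-th vertex of the ray `Y`, for `n`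
at least the length of the common prefix. -/
def Marking.cyl (α : Marking Γ N) (g : FreeGroup E) (v : List (E × Bool)) :
    Set (DoubleBoundary N) :=
  {q | ∃ X Y : Boundary E,
    ConvergesTo (fun n => α.hom (q.1.1.prefix n)) X ∧
    ConvergesTo (fun n => α.hom (q.1.2.prefix n)) Y ∧
    ∀ᶠ n in atTop, PassesThrough g v (X.prefix n) (Y.prefix n)}

/-- The number of positions of the word `w` from which the word `v ≠ []` can be read forward. -/
def occ (v w : List (E × Bool)) : ℕ := w.tails.countP fun l => v.isPrefixOf l

/-- The number of occurrences of `v` and of its inverse path in `w`. -/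
def occSymm (v w : List (E × Bool)) : ℕ := occ v w + occ (FreeGroup.invRev v) w

/-- `μ` is the stable current of `f`: for every nontrivial reduced edge path `v`, the number
`⟨v, μ⟩` (the `μ`-measure of the cylinder of any lift of `v`) is the limit `a_v` of the frequencies
`⟨v, f^n(e)⟩ / ℓ(f^n(e))`, for every oriented edge `e`. -/
def IsStableCurrent (α : Marking Γ N) (f : GraphMap Γ) (μ : NonzeroCurrent N) : Prop :=
  ∀ v : List (E × Bool), v ≠ [] → FreeGroup.IsReduced v →
    ∀ (u u' : V) (g : FreeGroup E), Γ.IsPath u v u' → Γ.IsPath α.p g.toWord u →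
      ∀ e : E × Bool,
        Tendsto (fun n : ℕ => (occSymm v (f.map^[n] [e]) : ℝ) / (f.map^[n] [e]).length) atTop
          (𝓝 (μ.1 (α.cyl g v)).toReal)

end Cylinders

end FreeCurrents

end

/-! Legal paths grow under `f` by a factor at least `L > 1`, while tightening destroys at most `C`
at each end. A legal path of length `x ≥ C / (L - 1)` therefore retains length at least `L x - C ≥ C
/ (L - 1)`. So at a vertex that far from all illegal turns no cancellation ever occurs, under any
iterate (`GoodSplit.step`, `GoodSplit.iterate`). Each good edge `e` then contributes an intact block
`f^n(e)` of length at least `L ^ n`, and a path `c` with a proportion `δ` of good edges satisfies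
`|[f^n(c)]| ≥ δ L ^ n |c|` (`le_length_tight`).

Because the transition matrix is positive, the least frequency of `v` among the paths `f^n(e)` rises
at every step by a fixed fraction of the gap between the greatest and the least one. All frequencies
thus have a common limit `a` (`exists_frequency`). Fix `m` such that every `f^m(e)` has frequency
close to `a`. The path `[f^n(c)]` is a product of at most `|c|` legal paths, whatever `n` is
(`isLegalConcat_tight`), and under `f^m` only a bounded number of edges per legal piece can suffer
cancellation. The error in the frequency count is `ε` times the length plus a constant times `|c|`
(`abs_deviation_tight_le`); the exponential lower bound absorbs the second term, uniformly in `c`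
(`exists_uniform_frequency`). Circuits are handled by unrolling them many times and dividing by the
number of turns (`card_goodEdges_ge`, `abs_cycOcc_sub_le`).

For currents, a rescaled `η_w` gives the cylinder of `v` the mass (occurrences of `v` and its
inverse in the circuit) / (length of the circuit), by counting translates of the axis through a lift
of `v`; and `φ η_w = η_{φ(w)}`. Cylinders are compact open and generate enough step functions, so
convergence on cylinders is weak-* convergence (`tendsto_integral_of_tendsto_cyl`). Uniformity over
all good classes is obtained by taking one limit over pairs (class, `n`) as `n → ∞`.

For existence, a loop with only legal turns has goodness one. Its rescaled iterates converge on all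
cylinders, and a weak limit furnished by the Riesz theorem is an invariant measure with the
prescribed values. It is nonzero because the frequencies of the single edges add up to one. -/

noncomputable section

namespace FreeCurrents

/-! ### Words and reduced products -/

section Words

open FreeGroup List

variable {A : Type*}

@[simp] lemma invLetter_invLetter (a : A × Bool) : invLetter (invLetter a) = a := by
  simp [invLetter]

lemma invLetter_ne (a : A × Bool) : invLetter a ≠ a := by
  intro h
  have := congrArg Prod.snd h
  simp [invLetter] at this

lemma invLetter_injective : Function.Injective (invLetter (A := A)) := fun a b h => by
  rw [← invLetter_invLetter a, h, invLetter_invLetter]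

lemma invRev_cons_eq (a : A × Bool) (l : List (A × Bool)) :
    invRev (a :: l) = invRev l ++ [invLetter a] := by
  simp [invRev, invLetter]

lemma invRev_singleton (a : A × Bool) : invRev [a] = [invLetter a] := by
  simp [invRev, invLetter]

lemma invRev_concat (l : List (A × Bool)) (a : A × Bool) :
    invRev (l ++ [a]) = invLetter a :: invRev l := by
  simp [invRev, invLetter]

@[simp] lemma length_invRev' (l : List (A × Bool)) : (invRev l).length = l.length := by
  simp [invRev]

lemma invRev_eq_nil_iff {l : List (A × Bool)} : invRev l = [] ↔ l = [] := by
  simp [invRev]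

lemma pair_reduced_iff {a b : A × Bool} : (a.1 = b.1 → a.2 = b.2) ↔ b ≠ invLetter a := by
  rcases a with ⟨a, s⟩
  rcases b with ⟨b, t⟩
  simp only [invLetter, ne_eq, Prod.mk.injEq, not_and]
  constructor
  · intro h hb ht
    have := h hb.symm
    subst this
    simp at ht
  · intro h hb
    have := h hb.symm
    cases s <;> cases t <;> simp_all

lemma isReduced_append_iff {u v : List (A × Bool)} :
    FreeGroup.IsReduced (u ++ v) ↔ FreeGroup.IsReduced u ∧ FreeGroup.IsReduced v ∧
      ∀ x ∈ u.getLast?, ∀ y ∈ v.head?, y ≠ invLetter x := by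
  unfold FreeGroup.IsReduced
  rw [List.isChain_append]
  simp only [pair_reduced_iff]

lemma isReduced_nil : FreeGroup.IsReduced ([] : List (A × Bool)) := List.isChain_nil

lemma isReduced_singleton (a : A × Bool) : FreeGroup.IsReduced [a] := List.isChain_singleton _

lemma isReduced_left {u v : List (A × Bool)} (h : FreeGroup.IsReduced (u ++ v)) : FreeGroup.IsReduced u :=
  (isReduced_append_iff.1 h).1

lemma isReduced_right {u v : List (A × Bool)} (h : FreeGroup.IsReduced (u ++ v)) : FreeGroup.IsReduced v :=
  (isReduced_append_iff.1 h).2.1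

lemma isReduced_invRev {u : List (A × Bool)} (h : FreeGroup.IsReduced u) : FreeGroup.IsReduced (invRev u) := by
  classical
  rw [isReduced_iff_reduce_eq] at h ⊢
  rw [reduce_invRev, h]

lemma isReduced_glue {u v w : List (A × Bool)} (h₁ : FreeGroup.IsReduced (u ++ v)) (h₂ : FreeGroup.IsReduced (v ++ w))
    (h : v ≠ [] ∨ u = []) : FreeGroup.IsReduced (u ++ (v ++ w)) := by
  rcases h with h | rfl
  · rw [← List.append_assoc]
    exact FreeGroup.IsReduced.append_overlap h₁ h₂ h
  · simpa using h₂

lemma mk_append (u v : List (A × Bool)) : mk (u ++ v) = mk u * mk v := mul_mk.symm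

variable [DecidableEq A]

lemma toWord_mk_of_isReduced {u : List (A × Bool)} (h : FreeGroup.IsReduced u) : (mk u).toWord = u := by
  rw [toWord_mk, h.reduce_eq]

/-- The product of two reduced words cancels in exactly one block. -/
lemma exists_reduced_product (u v : List (A × Bool)) (hu : FreeGroup.IsReduced u) (hv : FreeGroup.IsReduced v) :
    ∃ p k q, u = p ++ k ∧ v = invRev k ++ q ∧ FreeGroup.IsReduced (p ++ q) ∧ reduce (u ++ v) = p ++ q := by
  suffices H : ∃ p k q, u = p ++ k ∧ v = invRev k ++ q ∧ FreeGroup.IsReduced (p ++ q) by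
    obtain ⟨p, k, q, h1, h2, h3⟩ := H
    refine ⟨p, k, q, h1, h2, h3, ?_⟩
    rw [← h3.reduce_eq]
    apply reduce.sound
    rw [h1, h2, mk_append, mk_append, mk_append, mk_append, ← inv_mk]
    group
  -- The last letter of `u` either cancels the first letter of `v`, and the argument recurs inside,
  -- or it blocks all cancellation.
  induction u using List.reverseRecOn generalizing v with
  | nil => exact ⟨[], [], v, by simp, by simp, by simpa using hv⟩
  | append_singleton u a ih =>
    cases v with
    | nil => exact ⟨u ++ [a], [], [], by simp, by simp, by simpa using hu⟩
    | cons b v =>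
      by_cases hab : b = invLetter a
      · obtain ⟨p, k, q, h1, h2, h3⟩ := ih v (isReduced_left hu)
          (isReduced_right (u := [b]) (by simpa using hv))
        refine ⟨p, k ++ [a], q, by simp [h1], ?_, h3⟩
        rw [invRev_concat, hab, h2]
        rfl
      · refine ⟨u ++ [a], [], b :: v, by simp, by simp, ?_⟩
        rw [isReduced_append_iff]
        refine ⟨hu, hv, ?_⟩
        simpa using hab

lemma exists_mul_decomp (g h : FreeGroup A) :
    ∃ p k q, g.toWord = p ++ k ∧ h.toWord = invRev k ++ q ∧ (g * h).toWord = p ++ q := by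
  obtain ⟨p, k, q, h1, h2, -, h4⟩ :=
    exists_reduced_product g.toWord h.toWord isReduced_toWord isReduced_toWord
  exact ⟨p, k, q, h1, h2, by rw [toWord_mul, h4]⟩

lemma toWord_mul_of_isReduced {g h : FreeGroup A} (hr : FreeGroup.IsReduced (g.toWord ++ h.toWord)) :
    (g * h).toWord = g.toWord ++ h.toWord := by
  rw [toWord_mul, hr.reduce_eq]

/-- The common prefix of two elements, and the distance between them. -/
lemma exists_common_prefix (g h : FreeGroup A) :
    ∃ p s t, g.toWord = p ++ s ∧ h.toWord = p ++ t ∧ (g⁻¹ * h).toWord = invRev s ++ t := by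
  obtain ⟨p, k, q, h1, h2, h3⟩ := exists_mul_decomp g⁻¹ h
  refine ⟨invRev k, invRev p, q, ?_, h2, by rw [h3, invRev_invRev]⟩
  rw [toWord_inv] at h1
  rw [← invRev_append, ← h1, invRev_invRev]

lemma length_toWord_mul_le (g h : FreeGroup A) :
    (g * h).toWord.length ≤ g.toWord.length + h.toWord.length := norm_mul_le g h

lemma length_toWord_inv (g : FreeGroup A) : (g⁻¹).toWord.length = g.toWord.length := by
  rw [toWord_inv, length_invRev']

end Words

/-! ### Edge paths -/

section Paths

open FreeGroup

variable {V E : Type*} {Γ : OrGraph V E}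

namespace OrGraph

@[simp] lemma o_invLetter (a : E × Bool) : Γ.o (invLetter a) = Γ.t a := by
  rcases a with ⟨a, _ | _⟩ <;> simp [OrGraph.o, OrGraph.t, invLetter]

@[simp] lemma t_invLetter (a : E × Bool) : Γ.t (invLetter a) = Γ.o a := by
  rcases a with ⟨a, _ | _⟩ <;> simp [OrGraph.o, OrGraph.t, invLetter]

lemma isPath_nil {u v : V} : Γ.IsPath u [] v ↔ u = v := Iff.rfl

lemma isPath_cons {u v : V} {a : E × Bool} {l : List (E × Bool)} :
    Γ.IsPath u (a :: l) v ↔ Γ.o a = u ∧ Γ.IsPath (Γ.t a) l v := Iff.rfl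

lemma isPath_singleton {u v : V} {a : E × Bool} : Γ.IsPath u [a] v ↔ Γ.o a = u ∧ Γ.t a = v := by
  simp [isPath_cons, isPath_nil]

lemma isPath_append {u w : V} {l l' : List (E × Bool)} :
    Γ.IsPath u (l ++ l') w ↔ ∃ v, Γ.IsPath u l v ∧ Γ.IsPath v l' w := by
  induction l generalizing u with
  | nil => simp [isPath_nil]
  | cons a l ih => simp [isPath_cons, ih, and_assoc]

lemma IsPath.append {u v w : V} {l l' : List (E × Bool)} (h : Γ.IsPath u l v)
    (h' : Γ.IsPath v l' w) : Γ.IsPath u (l ++ l') w := isPath_append.2 ⟨v, h, h'⟩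

lemma IsPath.end_unique {u v w : V} {l : List (E × Bool)} (h : Γ.IsPath u l v)
    (h' : Γ.IsPath u l w) : v = w := by
  induction l generalizing u with
  | nil => exact h.symm.trans h'
  | cons a l ih => exact ih h.2 h'.2

lemma IsPath.invRev {u v : V} {l : List (E × Bool)} (h : Γ.IsPath u l v) :
    Γ.IsPath v (invRev l) u := by
  induction l generalizing u with
  | nil => exact h.symm
  | cons a l ih =>
    rw [invRev_cons_eq]
    exact (ih h.2).append (by simp [isPath_singleton, h.1])

/-- A cancelled pair is an edge followed at once by its inverse, a detour that returns to its
starting vertex. -/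
lemma IsPath.reduce [DecidableEq E] {u v : V} {l : List (E × Bool)} (h : Γ.IsPath u l v) :
    Γ.IsPath u (reduce l) v := by
  induction l generalizing u with
  | nil => exact h
  | cons a l ih =>
    have h2 := ih h.2
    rw [← reduce_cons_reduce]
    have hr : FreeGroup.IsReduced (FreeGroup.reduce l) := by
      rw [isReduced_iff_reduce_eq, reduce.idem]
    obtain ⟨p, k, q, h3, h4, h5, h6⟩ :=
      exists_reduced_product [a] (FreeGroup.reduce l) (isReduced_singleton a) hr
    rw [List.singleton_append] at h6
    rw [h6]
    rcases List.append_eq_singleton_iff.1 h3.symm with ⟨rfl, rfl⟩ | ⟨rfl, rfl⟩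
    · rw [h4, invRev_singleton] at h2
      have := h2.2
      rw [t_invLetter, h.1] at this
      simpa using this
    · rw [h4] at h2
      exact ⟨h.1, by simpa using h2⟩

lemma IsPath.toWord_mk [DecidableEq E] {u v : V} {l : List (E × Bool)} (h : Γ.IsPath u l v) :
    Γ.IsPath u (FreeGroup.mk l).toWord v := by
  rw [FreeGroup.toWord_mk]
  exact h.reduce

lemma IsPath.mul [DecidableEq E] {u v w : V} {g h : FreeGroup E} (hg : Γ.IsPath u g.toWord v)
    (hh : Γ.IsPath v h.toWord w) : Γ.IsPath u (g * h).toWord w := by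
  rw [toWord_mul]
  exact (hg.append hh).reduce

lemma IsPath.inv [DecidableEq E] {u v : V} {g : FreeGroup E} (hg : Γ.IsPath u g.toWord v) :
    Γ.IsPath v (g⁻¹).toWord u := by
  rw [toWord_inv]
  exact hg.invRev

lemma IsEdgePath.left {l l' : List (E × Bool)} (h : Γ.IsEdgePath (l ++ l')) :
    Γ.IsEdgePath l := by
  obtain ⟨u, v, h⟩ := h
  obtain ⟨w, h1, h2⟩ := isPath_append.1 h
  exact ⟨u, w, h1⟩

lemma IsEdgePath.right {l l' : List (E × Bool)} (h : Γ.IsEdgePath (l ++ l')) :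
    Γ.IsEdgePath l' := by
  obtain ⟨u, v, h⟩ := h
  obtain ⟨w, h1, h2⟩ := isPath_append.1 h
  exact ⟨w, v, h2⟩

end OrGraph

namespace GraphMap

variable (f : GraphMap Γ)

lemma edge_invLetter (a : E × Bool) : f.edge (invLetter a) = invRev (f.edge a) := by
  rcases a with ⟨a, _ | _⟩ <;> simp [edge, invLetter]

@[simp] lemma map_nil : f.map [] = [] := rfl

lemma map_append (l l' : List (E × Bool)) : f.map (l ++ l') = f.map l ++ f.map l' := by
  simp [map]

lemma map_singleton (a : E × Bool) : f.map [a] = f.edge a := by simp [map]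

lemma map_invRev (l : List (E × Bool)) : f.map (invRev l) = invRev (f.map l) := by
  induction l with
  | nil => rfl
  | cons a l ih =>
    rw [invRev_cons_eq, map_append, ih, map_singleton, edge_invLetter, ← invRev_append,
      ← map_singleton, ← map_append, List.singleton_append]

lemma iterate_map_append (n : ℕ) (l l' : List (E × Bool)) :
    f.map^[n] (l ++ l') = f.map^[n] l ++ f.map^[n] l' := by
  induction n generalizing l l' with
  | zero => rfl
  | succ n ih => rw [Function.iterate_succ_apply, map_append, ih]; rfl

lemma iterate_map_nil (n : ℕ) : f.map^[n] [] = [] := by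
  induction n with
  | zero => rfl
  | succ n ih => rw [Function.iterate_succ_apply, map_nil, ih]

lemma iterate_map_invRev (n : ℕ) (l : List (E × Bool)) :
    f.map^[n] (invRev l) = invRev (f.map^[n] l) := by
  induction n generalizing l with
  | zero => rfl
  | succ n ih => rw [Function.iterate_succ_apply, map_invRev, ih]; rfl

lemma isPath_edge (a : E × Bool) : Γ.IsPath (f.onV (Γ.o a)) (f.edge a) (f.onV (Γ.t a)) := by
  rcases a with ⟨a, _ | _⟩
  · exact (f.isPath a).invRev
  · exact f.isPath a

lemma isPath_map {u v : V} {l : List (E × Bool)} (h : Γ.IsPath u l v) :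
    Γ.IsPath (f.onV u) (f.map l) (f.onV v) := by
  induction l generalizing u with
  | nil => exact congrArg f.onV h
  | cons a l ih =>
    rw [← List.singleton_append, map_append, map_singleton, ← h.1]
    exact (f.isPath_edge a).append (ih h.2)

lemma isEdgePath_map {l : List (E × Bool)} (h : Γ.IsEdgePath l) : Γ.IsEdgePath (f.map l) := by
  obtain ⟨u, v, h⟩ := h
  exact ⟨_, _, f.isPath_map h⟩

lemma hom_mk (l : List (E × Bool)) : f.hom (FreeGroup.mk l) = FreeGroup.mk (f.map l) := by
  induction l with
  | nil => simp [← one_eq_mk]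
  | cons a l ih =>
    rw [← List.singleton_append, mk_append, _root_.map_mul, ih, map_append, mk_append,
      map_singleton]
    congr 1
    rcases a with ⟨a, _ | _⟩
    · simp [hom, edge, ← inv_mk]
    · simp [hom, edge]

lemma iterate_hom_mk (n : ℕ) (l : List (E × Bool)) : f.hom^[n] (FreeGroup.mk l) = FreeGroup.mk (f.map^[n] l) := by
  induction n generalizing l with
  | zero => rfl
  | succ n ih => rw [Function.iterate_succ_apply, hom_mk, ih]; rfl

variable [DecidableEq E]

/-- The reduced path `[f^n(l)]`. -/
def tight (n : ℕ) (l : List (E × Bool)) : List (E × Bool) := reduce (f.map^[n] l)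

lemma tight_eq (n : ℕ) (l : List (E × Bool)) : f.tight n l = (f.hom^[n] (FreeGroup.mk l)).toWord := by
  rw [tight, iterate_hom_mk, toWord_mk]

lemma isReduced_tight (n : ℕ) (l : List (E × Bool)) : FreeGroup.IsReduced (f.tight n l) := by
  rw [tight_eq]; exact isReduced_toWord

lemma tight_nil (n : ℕ) : f.tight n [] = [] := by
  rw [tight, iterate_map_nil]; rfl

lemma tight_append (n : ℕ) (l l' : List (E × Bool)) :
    f.tight n (l ++ l') = reduce (f.tight n l ++ f.tight n l') := by
  rw [tight, iterate_map_append, tight, tight, reduce_append_reduce_reduce]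

/-- Intermediate reductions do not matter, since `f` acts on reduced paths as a homomorphism of the
free group on the edges. -/
lemma tight_add (m n : ℕ) (l : List (E × Bool)) : f.tight (m + n) l = f.tight m (f.tight n l) := by
  rw [tight_eq, tight_eq, tight_eq, mk_toWord, Function.iterate_add_apply]

lemma isEdgePath_tight (n : ℕ) {l : List (E × Bool)} (h : Γ.IsEdgePath l) :
    Γ.IsEdgePath (f.tight n l) := by
  have : Γ.IsEdgePath (f.map^[n] l) := by
    induction n generalizing l with
    | zero => exact h
    | succ n ih => exact ih (f.isEdgePath_map h)
  obtain ⟨u, v, h⟩ := this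
  exact ⟨u, v, h.reduce⟩

end GraphMap

end Paths

/-! ### Legal paths -/

section Legal

open FreeGroup

variable {V E : Type*} {Γ : OrGraph V E}

namespace GraphMap

variable (f : GraphMap Γ)

lemma edge_ne_nil (h : ∀ e, f.onE e ≠ []) (a : E × Bool) : f.edge a ≠ [] := by
  rcases a with ⟨a, _ | _⟩
  · simpa [edge, invRev_eq_nil_iff] using h a
  · simpa [edge] using h a

lemma head_edge (h : ∀ e, f.onE e ≠ []) (a : E × Bool) : (f.edge a).head? = some (f.D a) := by
  have := f.edge_ne_nil h a
  unfold D
  cases hh : f.edge a with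
  | nil => exact absurd hh this
  | cons b l => simp

lemma head_iterate_map (h : ∀ e, f.onE e ≠ []) (n : ℕ) (a : E × Bool) (l : List (E × Bool)) :
    (f.map^[n] (a :: l)).head? = some (f.D^[n] a) := by
  induction n generalizing a l with
  | zero => rfl
  | succ n ih =>
    rw [Function.iterate_succ_apply, Function.iterate_succ_apply, ← List.singleton_append,
      map_append, map_singleton]
    have h1 := f.head_edge h a
    cases hh : f.edge a with
    | nil => exact absurd hh (f.edge_ne_nil h a)
    | cons b l' =>
      rw [hh] at h1
      simp only [List.head?_cons, Option.some.injEq] at h1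
      rw [← h1, List.cons_append]
      exact ih _ _

lemma getLast_iterate_map (h : ∀ e, f.onE e ≠ []) (n : ℕ) (a : E × Bool) (l : List (E × Bool)) :
    (f.map^[n] (l ++ [a])).getLast? = some (invLetter (f.D^[n] (invLetter a))) := by
  have h1 := f.head_iterate_map h n (invLetter a) (invRev l)
  rw [← invRev_concat, iterate_map_invRev] at h1
  simp only [invRev, List.head?_reverse, List.getLast?_map] at h1
  cases hh : (f.map^[n] (l ++ [a])).getLast? with
  | none => rw [hh] at h1; simp at h1
  | some b =>
    rw [hh] at h1
    simp only [Option.map_some, Option.some.injEq] at h1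
    rw [← h1]
    congr 1
    simp [invLetter]

lemma legalTurn_D {a b : E × Bool} (h : f.LegalTurn a b) : f.LegalTurn (f.D a) (f.D b) := fun n =>
  by simpa using h (n + 1)

lemma LegalTurn.ne {f : GraphMap Γ} {a b : E × Bool} (h : f.LegalTurn a b) : a ≠ b := h 0

lemma LegalPath.isReduced {f : GraphMap Γ} {l : List (E × Bool)} (h : f.LegalPath l) :
    FreeGroup.IsReduced l := by
  refine List.IsChain.imp ?_ h.2
  intro a b hab
  rw [pair_reduced_iff]
  exact hab.ne.symm

lemma LegalPath.left {f : GraphMap Γ} {l l' : List (E × Bool)} (h : f.LegalPath (l ++ l')) :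
    f.LegalPath l := ⟨h.1.left, (List.isChain_append.1 h.2).1⟩

lemma LegalPath.right {f : GraphMap Γ} {l l' : List (E × Bool)} (h : f.LegalPath (l ++ l')) :
    f.LegalPath l' := ⟨h.1.right, (List.isChain_append.1 h.2).2.1⟩

lemma legalPath_nil [Nonempty V] : f.LegalPath [] :=
  ⟨⟨Classical.arbitrary V, Classical.arbitrary V, rfl⟩, List.isChain_nil⟩

lemma isEdgePath_singleton (a : E × Bool) : Γ.IsEdgePath [a] :=
  ⟨Γ.o a, Γ.t a, rfl, rfl⟩

lemma legalPath_singleton (a : E × Bool) : f.LegalPath [a] :=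
  ⟨isEdgePath_singleton a, List.isChain_singleton _⟩

variable {f}

lemma IsTrainTrack.isReduced_iterate (htt : f.IsTrainTrack) (n : ℕ) (a : E × Bool) :
    FreeGroup.IsReduced (f.map^[n] [a]) := by
  rcases Nat.eq_zero_or_pos n with rfl | hn
  · exact isReduced_singleton a
  rcases a with ⟨a, _ | _⟩
  · have : [(a, false)] = invRev [(a, true)] := by simp [invRev]
    rw [this, iterate_map_invRev]
    exact isReduced_invRev (htt.2 n hn a)
  · exact htt.2 n hn a

lemma isEdgePath_iterate (n : ℕ) {l : List (E × Bool)} (h : Γ.IsEdgePath l) :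
    Γ.IsEdgePath (f.map^[n] l) := by
  induction n generalizing l with
  | zero => exact h
  | succ n ih => exact ih (f.isEdgePath_map h)

/-- If the turn between consecutive letters `x`, `y` of `f^n(a)` degenerated after `k` steps, then
`f^(k+n)(a)` would backtrack between the images of `x` and `y`. -/
lemma IsTrainTrack.legalPath_iterate (htt : f.IsTrainTrack) (n : ℕ) (a : E × Bool) :
    f.LegalPath (f.map^[n] [a]) := by
  refine ⟨isEdgePath_iterate n (isEdgePath_singleton a), ?_⟩
  rw [List.isChain_iff_forall_rel_of_append_cons_cons]
  intro x y l₁ l₂ hl k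
  have h1 := htt.isReduced_iterate (k + n) a
  rw [Function.iterate_add_apply, hl,
    show l₁ ++ x :: y :: l₂ = (l₁ ++ [x]) ++ ([y] ++ l₂) by simp, iterate_map_append,
    isReduced_append_iff] at h1
  have h2 := h1.2.2 _ (f.getLast_iterate_map htt.1 k x l₁) _ (f.head_iterate_map htt.1 k y l₂)
  rw [invLetter_invLetter] at h2
  exact h2.symm

/-- Turns inside the image of an edge are legal by the train track property; a turn between two such
images is the image under `f.D` of a legal turn. -/
lemma isChain_map (htt : f.IsTrainTrack) {l : List (E × Bool)}
    (h : l.IsChain fun a b => f.LegalTurn (invLetter a) b) :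
    (f.map l).IsChain fun a b => f.LegalTurn (invLetter a) b := by
  induction l with
  | nil => exact List.isChain_nil
  | cons a l ih =>
    rw [← List.singleton_append, map_append]
    rw [List.isChain_append]
    refine ⟨(htt.legalPath_iterate 1 a).2, ih (List.IsChain.tail h), ?_⟩
    intro x hx y hy
    have h1 := f.getLast_iterate_map htt.1 1 a []
    simp only [Function.iterate_one, List.nil_append] at h1
    rw [h1, Option.mem_some_iff] at hx
    cases l with
    | nil => simp at hy
    | cons b l =>
      have h2 := f.head_iterate_map htt.1 1 b l
      simp only [Function.iterate_one] at h2
      rw [h2, Option.mem_some_iff] at hy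
      rw [← hx, ← hy, invLetter_invLetter]
      rw [List.isChain_cons_cons] at h
      exact f.legalTurn_D h.1

lemma LegalPath.map (htt : f.IsTrainTrack) {l : List (E × Bool)} (h : f.LegalPath l) :
    f.LegalPath (f.map l) := ⟨f.isEdgePath_map h.1, isChain_map htt h.2⟩

lemma LegalPath.iterate (htt : f.IsTrainTrack) (n : ℕ) {l : List (E × Bool)} (h : f.LegalPath l) :
    f.LegalPath (f.map^[n] l) := by
  induction n generalizing l with
  | zero => exact h
  | succ n ih => exact ih (h.map htt)

lemma LegalPath.length_iterate (htt : f.IsTrainTrack) {L : ℝ} (hL : 1 < L) (hexp : f.ExpandsLegal L)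
    (n : ℕ) {l : List (E × Bool)} (h : f.LegalPath l) :
    L ^ n * (l.length : ℝ) ≤ ((f.map^[n] l).length : ℝ) := by
  induction n generalizing l with
  | zero => simp
  | succ n ih =>
    rw [Function.iterate_succ_apply]
    refine le_trans ?_ (ih (h.map htt))
    rw [pow_succ, mul_assoc]
    exact mul_le_mul_of_nonneg_left (hexp l h) (by positivity)

lemma LegalPath.tight_eq_map [DecidableEq E] (htt : f.IsTrainTrack) (n : ℕ) {l : List (E × Bool)}
    (h : f.LegalPath l) : f.tight n l = f.map^[n] l :=
  (h.iterate htt n).isReduced.reduce_eq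

/-! ### Splittings at vertices far from illegal turns -/

variable (f) in
/-- The common vertex of the paths `A` and `B` is at distance at least `K` from every illegal turn
of `A ++ B`. -/
def GoodSplit (K : ℕ) (A B : List (E × Bool)) : Prop :=
  ∃ A₁ p r B₁, A = A₁ ++ p ∧ B = r ++ B₁ ∧ f.LegalPath (p ++ r) ∧
    (A₁ = [] ∨ K ≤ p.length) ∧ (B₁ = [] ∨ K ≤ r.length)

/-- Truncation removes no part of the legal stretch except beyond the new end, and a stretch that
reaches the end of the path is subject to no length condition. -/
lemma GoodSplit.left {K : ℕ} {A B B' : List (E × Bool)} (h : f.GoodSplit K A (B ++ B')) :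
    f.GoodSplit K A B := by
  obtain ⟨A₁, p, r, B₁, rfl, hB, hl, h1, h2⟩ := h
  rcases List.append_eq_append_iff.1 hB with ⟨t, ht1, ht2⟩ | ⟨t, ht1, ht2⟩
  · refine ⟨A₁, p, B, [], rfl, by simp, ?_, h1, Or.inl rfl⟩
    rw [ht1, ← List.append_assoc] at hl
    exact hl.left
  · refine ⟨A₁, p, r, t, rfl, ht1, hl, h1, ?_⟩
    rcases h2 with h2 | h2
    · left
      rw [h2] at ht2
      exact (List.append_eq_nil_iff.1 ht2.symm).1
    · exact Or.inr h2

lemma IsBoundedCancellation.nonneg [DecidableEq E] [Nonempty V] {C : ℝ}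
    (h : f.IsBoundedCancellation C) : 0 ≤ C := by
  have := h [] [] ⟨Classical.arbitrary V, Classical.arbitrary V, rfl⟩ isReduced_nil
  simp at this
  linarith

/-- Bounded cancellation: the block cancelled in `[f(l₁)][f(l₂)]` has length at most `C`. -/
lemma IsBoundedCancellation.cancel [DecidableEq E] {C : ℝ} (h : f.IsBoundedCancellation C)
    {l₁ l₂ : List (E × Bool)} (hp : Γ.IsEdgePath (l₁ ++ l₂)) (hr : FreeGroup.IsReduced (l₁ ++ l₂)) :
    ∃ p k q, f.tight 1 l₁ = p ++ k ∧ f.tight 1 l₂ = invRev k ++ q ∧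
      FreeGroup.IsReduced (p ++ q) ∧ f.tight 1 (l₁ ++ l₂) = p ++ q ∧ (k.length : ℝ) ≤ C := by
  obtain ⟨p, k, q, h1, h2, h3, h4⟩ :=
    exists_reduced_product _ _ (f.isReduced_tight 1 l₁) (f.isReduced_tight 1 l₂)
  rw [← tight_append] at h4
  refine ⟨p, k, q, h1, h2, h3, h4, ?_⟩
  have h5 := h l₁ l₂ hp hr
  change (((f.tight 1 l₁).length : ℝ)) + ((f.tight 1 l₂).length) - 2 * C
    ≤ ((f.tight 1 (l₁ ++ l₂)).length) at h5
  rw [h1, h2, h4] at h5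
  simp only [List.length_append, length_invRev', Nat.cast_add] at h5
  linarith

/-- The legal stretch around the cut maps to a legal path, so nothing cancels at the cut itself.
Cancellation can only eat into the stretch from its two far ends, by at most `C` each, and the
threshold is chosen so that expansion makes up for this loss. -/
lemma GoodSplit.step [DecidableEq E] [Nonempty V] (htt : f.IsTrainTrack) {L C : ℝ} (hL : 1 < L)
    (hexp : f.ExpandsLegal L) (hC : f.IsBoundedCancellation C)
    {A B : List (E × Bool)} (hp : Γ.IsEdgePath (A ++ B)) (hr : FreeGroup.IsReduced (A ++ B))
    (h : f.GoodSplit ⌈C / (L - 1)⌉₊ A B) :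
    f.tight 1 (A ++ B) = f.tight 1 A ++ f.tight 1 B ∧
      f.GoodSplit ⌈C / (L - 1)⌉₊ (f.tight 1 A) (f.tight 1 B) := by
  have hC0 := hC.nonneg
  have hL0 : 0 < L - 1 := by linarith
  rcases hC0.eq_or_lt with h0 | h0
  -- For `C = 0` there is no cancellation at all and the threshold is zero, so empty stretches are
  -- witnesses. The case is separate because the gluing below needs nonempty stretches.
  · subst h0
    obtain ⟨p, k, q, h1, h2, -, h4, h5⟩ := hC.cancel hp hr
    have hk : k = [] := by
      rw [← List.length_eq_zero_iff]
      exact_mod_cast le_antisymm h5 (by positivity)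
    subst hk
    simp only [List.append_nil, invRev_empty, List.nil_append] at h1 h2
    refine ⟨by rw [h4, h1, h2], _, [], [], _, (List.append_nil _).symm, rfl, f.legalPath_nil,
      Or.inr (by simp), Or.inr (by simp)⟩
  have hK : 0 < ⌈C / (L - 1)⌉₊ := Nat.ceil_pos.2 (by positivity)
  set K := ⌈C / (L - 1)⌉₊ with hKdef
  have hKC : C / (L - 1) ≤ K := Nat.le_ceil _
  -- The fixed point of `x ↦ L x - C` is `C / (L - 1)`: above it, expansion followed by the loss of
  -- `m ≤ C` letters stays above it. The integer `z` then exceeds the ceiling too.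
  have key : ∀ (l : List (E × Bool)) (m z : ℕ), f.LegalPath l → K ≤ l.length → (m : ℝ) ≤ C →
      (f.map l).length = m + z → K ≤ z := by
    intro l m z hl hx hm hz
    apply Nat.ceil_le.2
    rw [div_le_iff₀ hL0]
    have h1 := hexp l hl
    rw [hz] at h1
    push_cast at h1
    have h2 : C / (L - 1) ≤ l.length := hKC.trans (by exact_mod_cast hx)
    rw [div_le_iff₀ hL0] at h2
    have h3 : L * C ≤ L * ((l.length : ℝ) * (L - 1)) := by gcongr
    have h4 : (L - 1) * (L * l.length) ≤ (L - 1) * (m + z) := by gcongr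
    have h5 : (L - 1) * m ≤ (L - 1) * C := by gcongr
    nlinarith
  obtain ⟨A₁, p, r, B₁, rfl, rfl, hl, hA, hB⟩ := h
  -- `p'` is what survives of the image of the left stretch `p` after cancellation with the image of
  -- `A₁`.
  obtain ⟨u, p', k, h1, h2, h3⟩ : ∃ u p' k, f.tight 1 (A₁ ++ p) = u ++ p' ∧ f.map p = k ++ p' ∧
      (u = [] ∨ K ≤ p'.length) := by
    rcases eq_or_ne A₁ [] with rfl | hA1
    · exact ⟨[], f.map p, [], by simpa using hl.left.tight_eq_map htt 1, by simp, Or.inl rfl⟩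
    · obtain ⟨u, k, q, h1, h2, -, h4, h5⟩ := hC.cancel hp.left (isReduced_left hr)
      rw [hl.left.tight_eq_map htt 1, Function.iterate_one] at h2
      refine ⟨u, q, _, h4, h2, Or.inr (key p k.length _ hl.left (hA.resolve_left hA1) h5 ?_)⟩
      rw [h2]
      simp
  obtain ⟨r', w, k', h1', h2', h3'⟩ : ∃ r' w k', f.tight 1 (r ++ B₁) = r' ++ w ∧
      f.map r = r' ++ k' ∧ (w = [] ∨ K ≤ r'.length) := by
    rcases eq_or_ne B₁ [] with rfl | hB1
    · exact ⟨f.map r, [], [], by simpa using hl.right.tight_eq_map htt 1, by simp, Or.inl rfl⟩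
    · obtain ⟨q, k, w, h1, h2, -, h4, h5⟩ := hC.cancel hp.right (isReduced_right hr)
      rw [hl.right.tight_eq_map htt 1, Function.iterate_one] at h1
      refine ⟨q, w, _, h4, h1, Or.inr (key r k.length _ hl.right (hB.resolve_left hB1) h5 ?_)⟩
      rw [h1]
      simp [add_comm]
  have hleg : f.LegalPath (p' ++ r') := by
    have := hl.map htt
    rw [map_append, h2, h2', List.append_assoc] at this
    have := this.right
    rw [← List.append_assoc] at this
    exact this.left
  -- The three reduced words `u p'`, `p' r'` and `r' w` overlap in nonempty words, unless an outer
  -- part is missing, so their union is reduced.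
  have hred : FreeGroup.IsReduced (f.tight 1 (A₁ ++ p) ++ f.tight 1 (r ++ B₁)) := by
    rw [h1, h1', List.append_assoc]
    have e1 : FreeGroup.IsReduced (u ++ p') := h1 ▸ f.isReduced_tight 1 _
    have e2 : FreeGroup.IsReduced (r' ++ w) := h1' ▸ f.isReduced_tight 1 _
    have nonnil : ∀ l : List (E × Bool), K ≤ l.length → l ≠ [] := by
      rintro l hl rfl
      simp at hl
      omega
    have e3 : FreeGroup.IsReduced (p' ++ (r' ++ w)) := by
      rcases h3' with rfl | h3'
      · simpa using hleg.isReduced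
      · exact isReduced_glue hleg.isReduced e2 (Or.inl (nonnil _ h3'))
    rcases h3 with rfl | h3
    · simpa using e3
    · exact isReduced_glue e1 e3 (Or.inl (nonnil _ h3))
  refine ⟨by rw [tight_append, hred.reduce_eq], u, p', r', w, h1, h1', hleg, h3, h3'⟩

lemma GoodSplit.iterate [DecidableEq E] [Nonempty V] (htt : f.IsTrainTrack) {L C : ℝ} (hL : 1 < L)
    (hexp : f.ExpandsLegal L) (hC : f.IsBoundedCancellation C) (n : ℕ)
    {A B : List (E × Bool)} (hp : Γ.IsEdgePath (A ++ B)) (hr : FreeGroup.IsReduced (A ++ B))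
    (h : f.GoodSplit ⌈C / (L - 1)⌉₊ A B) :
    f.tight n (A ++ B) = f.tight n A ++ f.tight n B ∧
      f.GoodSplit ⌈C / (L - 1)⌉₊ (f.tight n A) (f.tight n B) := by
  induction n with
  | zero =>
    have h1 : ∀ l : List (E × Bool), FreeGroup.IsReduced l → f.tight 0 l = l :=
      fun l hl => hl.reduce_eq
    rw [h1 _ hr, h1 _ (isReduced_left hr), h1 _ (isReduced_right hr)]
    exact ⟨rfl, h⟩
  | succ n ih =>
    have h1 := GoodSplit.step htt hL hexp hC (ih.1 ▸ f.isEdgePath_tight n hp)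
      (ih.1 ▸ f.isReduced_tight n _) ih.2
    rw [← ih.1, ← tight_add, ← tight_add, ← tight_add, add_comm 1 n] at h1
    exact h1

end GraphMap

end Legal

/-! ### Counting occurrences -/

section Occurrences

open FreeGroup

variable {E : Type*} [DecidableEq E]

lemma occ_cons (v : List (E × Bool)) (a : E × Bool) (u : List (E × Bool)) :
    occ v (a :: u) = occ v u + if v.isPrefixOf (a :: u) then 1 else 0 := by
  simp [occ, List.countP_cons]

lemma occ_nil {v : List (E × Bool)} (hv : v ≠ []) : occ v [] = 0 := by
  cases v with
  | nil => exact absurd rfl hv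
  | cons a v => simp [occ]

lemma occ_le_length {v : List (E × Bool)} (hv : v ≠ []) (u : List (E × Bool)) :
    occ v u ≤ u.length := by
  induction u with
  | nil => simp [occ_nil hv]
  | cons a u ih =>
    rw [occ_cons, List.length_cons]
    split <;> omega

lemma occ_append_ge {v : List (E × Bool)} (hv : v ≠ []) (u w : List (E × Bool)) :
    occ v u + occ v w ≤ occ v (u ++ w) := by
  induction u with
  | nil => simp [occ_nil hv]
  | cons a u ih =>
    rw [List.cons_append, occ_cons, occ_cons]
    have : (if v.isPrefixOf (a :: u) then 1 else 0) ≤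
        (if v.isPrefixOf (a :: (u ++ w)) then 1 else 0) := by
      split_ifs with h1 h2
      · rfl
      · refine absurd ?_ h2
        rw [List.isPrefixOf_iff_prefix] at h1 ⊢
        exact h1.trans (by rw [← List.cons_append]; exact List.prefix_append _ _)
      all_goals simp
    omega

/-- The additional occurrences straddle the junction, so they start at one of the last `v.length`
letters of `u`. -/
lemma occ_append_le (v u w : List (E × Bool)) :
    occ v (u ++ w) ≤ occ v u + occ v w + min u.length v.length := by
  induction u with
  | nil => simp
  | cons a u ih =>
    rw [List.cons_append, occ_cons, occ_cons, List.length_cons]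
    by_cases h : v.length ≤ u.length
    · have : (if v.isPrefixOf (a :: (u ++ w)) then 1 else 0) ≤
          (if v.isPrefixOf (a :: u) then 1 else 0) := by
        split_ifs with h1 h2
        · rfl
        · refine absurd ?_ h2
          rw [List.isPrefixOf_iff_prefix] at h1 ⊢
          rw [← List.cons_append] at h1
          exact List.prefix_of_prefix_length_le h1 (List.prefix_append _ _) (by simp; omega)
        all_goals simp
      have : min u.length v.length ≤ min (u.length + 1) v.length := by omega
      omega
    · have : (if v.isPrefixOf (a :: (u ++ w)) then 1 else 0) ≤ 1 := by split <;> simp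
      have : min (u.length + 1) v.length = min u.length v.length + 1 := by omega
      omega

lemma occSymm_nil {v : List (E × Bool)} (hv : v ≠ []) : occSymm v [] = 0 := by
  simp [occSymm, occ_nil hv, occ_nil (mt invRev_eq_nil_iff.1 hv)]

lemma occSymm_le {v : List (E × Bool)} (hv : v ≠ []) (u : List (E × Bool)) :
    occSymm v u ≤ 2 * u.length := by
  have h1 := occ_le_length hv u
  have h2 := occ_le_length (mt invRev_eq_nil_iff.1 hv) u
  unfold occSymm
  omega

lemma occSymm_append_ge {v : List (E × Bool)} (hv : v ≠ []) (u w : List (E × Bool)) :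
    occSymm v u + occSymm v w ≤ occSymm v (u ++ w) := by
  have h1 := occ_append_ge hv u w
  have h2 := occ_append_ge (mt invRev_eq_nil_iff.1 hv) u w
  unfold occSymm
  omega

lemma occSymm_append_le (v u w : List (E × Bool)) :
    occSymm v (u ++ w) ≤ occSymm v u + occSymm v w + 2 * v.length := by
  have h1 := occ_append_le v u w
  have h2 := occ_append_le (invRev v) u w
  rw [length_invRev'] at h2
  unfold occSymm
  omega

/-- The deviation of the number of occurrences of `v` from the frequency `a`. -/
def deviation (v : List (E × Bool)) (a : ℝ) (u : List (E × Bool)) : ℝ := occSymm v u - a * u.length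

lemma deviation_nil {v : List (E × Bool)} (hv : v ≠ []) (a : ℝ) : deviation v a [] = 0 := by
  simp [deviation, occSymm_nil hv]

lemma abs_deviation_append_sub {v : List (E × Bool)} (hv : v ≠ []) (a : ℝ)
    (u w : List (E × Bool)) :
    |deviation v a (u ++ w) - deviation v a u - deviation v a w| ≤ 2 * v.length := by
  have h1 : ((occSymm v u : ℝ)) + occSymm v w ≤ occSymm v (u ++ w) := by
    exact_mod_cast occSymm_append_ge hv u w
  have h2 : (occSymm v (u ++ w) : ℝ) ≤ occSymm v u + occSymm v w + 2 * v.length := by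
    exact_mod_cast occSymm_append_le v u w
  unfold deviation
  rw [List.length_append, Nat.cast_add, abs_le]
  constructor <;> nlinarith

lemma abs_deviation_le {v : List (E × Bool)} (hv : v ≠ []) {a : ℝ} (ha : 0 ≤ a)
    (u : List (E × Bool)) : |deviation v a u| ≤ (2 + a) * u.length := by
  have h1 : (occSymm v u : ℝ) ≤ 2 * u.length := by exact_mod_cast occSymm_le hv u
  have h2 : (0 : ℝ) ≤ occSymm v u := by positivity
  have h3 : 0 ≤ a * (u.length : ℝ) := by positivity
  unfold deviation
  rw [abs_le]
  constructor <;> nlinarith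

end Occurrences

/-! ### Frequencies in iterated images -/

section Frequencies

open FreeGroup

variable {V E : Type*} {Γ : OrGraph V E}

namespace GraphMap

variable (f : GraphMap Γ)

/-- The word is a concatenation of `k` (possibly trivial) legal paths. -/
def IsLegalConcat : ℕ → List (E × Bool) → Prop
  | 0, u => u = []
  | k + 1, u => ∃ a b, u = a ++ b ∧ IsLegalConcat k a ∧ f.LegalPath b

variable {f}

lemma isLegalConcat_nil [Nonempty V] (k : ℕ) : f.IsLegalConcat k [] := by
  induction k with
  | zero => rfl
  | succ k ih => exact ⟨[], [], rfl, ih, f.legalPath_nil⟩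

lemma IsLegalConcat.left [Nonempty V] {k : ℕ} {u v : List (E × Bool)}
    (h : f.IsLegalConcat k (u ++ v)) : f.IsLegalConcat k u := by
  induction k generalizing u v with
  | zero => exact (List.append_eq_nil_iff.1 h).1
  | succ k ih =>
    obtain ⟨a, b, h1, h2, h3⟩ := h
    rcases List.append_eq_append_iff.1 h1 with ⟨t, ht1, ht2⟩ | ⟨t, ht1, ht2⟩
    · rw [ht1] at h2
      exact ⟨u, [], by simp, ih h2, f.legalPath_nil⟩
    · rw [ht2] at h3
      exact ⟨a, t, ht1, h2, h3.left⟩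

/-- Appending one edge to `l` cancels some of what is there and appends a suffix of the legal path
`f^n(e)`, hence at most one more legal piece. The bound on the number of pieces is independent of
`n`, which is what makes the later estimates uniform. -/
lemma isLegalConcat_tight [DecidableEq E] [Nonempty V] (htt : f.IsTrainTrack) (n : ℕ)
    (l : List (E × Bool)) : f.IsLegalConcat l.length (f.tight n l) := by
  induction l using List.reverseRecOn with
  | nil => simpa [tight_nil] using isLegalConcat_nil 0
  | append_singleton l e ih =>
    obtain ⟨p, k, q, h1, h2, -, h4⟩ :=
      exists_reduced_product _ _ (f.isReduced_tight n l) (f.isReduced_tight n [e])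
    rw [tight_append, h4, List.length_append, List.length_singleton]
    refine ⟨p, q, rfl, IsLegalConcat.left (h1 ▸ ih), ?_⟩
    rw [(f.legalPath_singleton e).tight_eq_map htt] at h2
    exact (h2 ▸ htt.legalPath_iterate n e : f.LegalPath (invRev k ++ q)).right

section Growth

variable [DecidableEq E] [Nonempty V]

open Classical in
variable (f) in
/-- The edges of `l` whose end points are both at distance at least `K` from all illegal turns. -/
def goodEdges (K : ℕ) (l : List (E × Bool)) : Finset ℕ :=
  (Finset.range l.length).filter fun i =>
    f.GoodSplit K (l.take i) (l.drop i) ∧ f.GoodSplit K (l.take (i + 1)) (l.drop (i + 1))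

-- Both end points of a good edge are vertices where no iterate cancels. The image of that edge is
-- therefore a full, legal block of `[f^n(l)]`, and the blocks of different good edges are disjoint.
open Classical in
lemma le_length_tight (htt : f.IsTrainTrack) {L C : ℝ} (hL : 1 < L) (hexp : f.ExpandsLegal L)
    (hC : f.IsBoundedCancellation C) (n : ℕ) {l : List (E × Bool)} (hp : Γ.IsEdgePath l)
    (hr : FreeGroup.IsReduced l) :
    L ^ n * ((f.goodEdges ⌈C / (L - 1)⌉₊ l).card : ℝ) ≤ (f.tight n l).length := by
  set K := ⌈C / (L - 1)⌉₊ with hK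
  set G : ℕ → Prop := fun i => f.GoodSplit K (l.take i) (l.drop i) with hG
  -- A good cut of `l` remains good in each initial segment that contains it.
  have hsplit : ∀ i j, i ≤ j → G i →
      f.tight n (l.take j) = f.tight n (l.take i) ++ f.tight n ((l.drop i).take (j - i)) := by
    intro i j hij hi
    have h1 : l.take j = l.take i ++ (l.drop i).take (j - i) := by
      obtain ⟨t, rfl⟩ := Nat.exists_eq_add_of_le hij
      rw [List.take_add]
      simp
    have h3 : l = l.take j ++ l.drop j := (List.take_append_drop j l).symm
    rw [h3] at hp hr
    rw [h1]
    refine (GoodSplit.iterate htt hL hexp hC n (h1 ▸ hp.left) (h1 ▸ isReduced_left hr) ?_).1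
    refine GoodSplit.left (B' := (l.drop i).drop (j - i)) ?_
    rw [List.take_append_drop]
    exact hi
  have hmono : ∀ i j, i ≤ j → G i →
      ((f.tight n (l.take i)).length : ℝ) ≤ (f.tight n (l.take j)).length := by
    intro i j hij hi
    rw [hsplit i j hij hi, List.length_append]
    push_cast
    linarith [Nat.cast_nonneg (α := ℝ) (f.tight n ((l.drop i).take (j - i))).length]
  have hstep : ∀ i, i < l.length → G i →
      ((f.tight n (l.take i)).length : ℝ) + L ^ n ≤ (f.tight n (l.take (i + 1))).length := by
    intro i hil hi
    rw [hsplit i (i + 1) (by omega) hi, List.length_append, Nat.cast_add]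
    have h1 : (l.drop i).take (i + 1 - i) = [l[i]] := by
      rw [List.drop_eq_getElem_cons hil, Nat.add_sub_cancel_left, List.take_succ_cons, List.take_zero]
    rw [h1, (f.legalPath_singleton _).tight_eq_map htt]
    have := (f.legalPath_singleton l[i]).length_iterate htt hL hexp n
    simp only [List.length_singleton, Nat.cast_one, mul_one] at this
    linarith
  -- Initial segments are compared only at good cuts, since elsewhere the tightened length may drop.
  -- The witness `s` is the end of the last good edge seen so far.
  have key : ∀ j ≤ l.length, ((Finset.range j).filter fun i => G i ∧ G (i + 1)).card = 0 ∨
      ∃ s ≤ j, G s ∧ L ^ n * (((Finset.range j).filter fun i => G i ∧ G (i + 1)).card : ℝ) ≤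
        (f.tight n (l.take s)).length := by
    intro j hj
    induction j with
    | zero => left; simp
    | succ j ih =>
      rw [Finset.range_add_one, Finset.filter_insert]
      by_cases h : G j ∧ G (j + 1)
      · right
        refine ⟨j + 1, le_rfl, h.2, ?_⟩
        rw [if_pos h, Finset.card_insert_of_notMem (by simp)]
        have h1 := hstep j hj h.1
        rcases ih (by omega) with h2 | ⟨s, hs, hGs, h2⟩
        · rw [h2]
          push_cast
          linarith [Nat.cast_nonneg (α := ℝ) (f.tight n (l.take j)).length]
        · have := hmono s j hs hGs
          push_cast
          linarith
      · rw [if_neg h]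
        rcases ih (by omega) with h2 | ⟨s, hs, hGs, h2⟩
        · exact Or.inl h2
        · exact Or.inr ⟨s, by omega, hGs, h2⟩
  have hcard : f.goodEdges K l = (Finset.range l.length).filter fun i => G i ∧ G (i + 1) := rfl
  rw [hcard]
  rcases key l.length le_rfl with h | ⟨s, hs, hGs, h⟩
  · rw [h]
    simp
  · refine h.trans ((hmono s l.length hs hGs).trans ?_)
    rw [List.take_length]

/-- If `v` has frequency about `a` in the long paths `f^n(e)`, then it has frequency about `a` in
`[f^n(l)]` up to an error proportional to the number of legal pieces of `l`. -/
lemma abs_deviation_tight_le (htt : f.IsTrainTrack) {L C : ℝ} (hL : 1 < L)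
    (hexp : f.ExpandsLegal L) (hC : f.IsBoundedCancellation C) {v : List (E × Bool)} (hv : v ≠ [])
    {a ε B : ℝ} (ha : 0 ≤ a) (hε : 0 ≤ ε) (hB0 : 0 ≤ B) (n : ℕ)
    (hB : ∀ e, ((f.map^[n] [e]).length : ℝ) ≤ B)
    (hn : ∀ e, |deviation v a (f.map^[n] [e])| + 2 * v.length ≤ ε * (f.map^[n] [e]).length)
    (k : ℕ) {l : List (E × Bool)} (hl : f.IsLegalConcat k l) (hp : Γ.IsEdgePath l)
    (hr : FreeGroup.IsReduced l) :
    |deviation v a (f.tight n l)| ≤ ε * (f.tight n l).length +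
      ((2 * (2 + a) + ε) * B + 4 * v.length) * ⌈C / (L - 1)⌉₊ * k := by
  set K := ⌈C / (L - 1)⌉₊ with hK
  set c : ℝ := (2 * (2 + a) + ε) * B + 4 * v.length with hc
  have hc0 : 0 ≤ c := by positivity
  -- At a good cut the whole block `f^n(e)` is appended, and by `hn` its deviation together with the
  -- junction error is paid for by `ε` times its length.
  have hgood : ∀ (l : List (E × Bool)) (e : E × Bool), Γ.IsEdgePath (l ++ [e]) →
      FreeGroup.IsReduced (l ++ [e]) → f.GoodSplit K l [e] →
      |deviation v a (f.tight n (l ++ [e]))| - ε * (f.tight n (l ++ [e])).length ≤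
        |deviation v a (f.tight n l)| - ε * (f.tight n l).length := by
    intro l e hp hr hs
    rw [(GoodSplit.iterate htt hL hexp hC n hp hr hs).1,
      (f.legalPath_singleton e).tight_eq_map htt, List.length_append]
    have h1 := abs_deviation_append_sub hv a (f.tight n l) (f.map^[n] [e])
    have h2 := hn e
    push_cast
    rw [abs_le] at h1
    have h3 : |deviation v a (f.tight n l ++ f.map^[n] [e])| ≤
        |deviation v a (f.tight n l)| + |deviation v a (f.map^[n] [e])| + 2 * v.length := by
      rw [abs_le]
      constructor
      · linarith [neg_abs_le (deviation v a (f.tight n l)),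
          neg_abs_le (deviation v a (f.map^[n] [e]))]
      · linarith [le_abs_self (deviation v a (f.tight n l)),
          le_abs_self (deviation v a (f.map^[n] [e]))]
    linarith
  -- At any other cut a block `k` is lost and a block `q` is gained, both of length at most `B`. The
  -- constant `c` collects their deviations, two junction errors, and the `ε`-allowance of the lost
  -- letters.
  have hbad : ∀ (l : List (E × Bool)) (e : E × Bool),
      |deviation v a (f.tight n (l ++ [e]))| - ε * (f.tight n (l ++ [e])).length ≤
        |deviation v a (f.tight n l)| - ε * (f.tight n l).length + c := by
    intro l e
    obtain ⟨p, k, q, h1, h2, -, h4⟩ :=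
      exists_reduced_product _ _ (f.isReduced_tight n l) (f.isReduced_tight n [e])
    rw [tight_append, h4, h1]
    rw [(f.legalPath_singleton e).tight_eq_map htt] at h2
    have h5 := hB e
    rw [h2] at h5
    simp only [List.length_append, length_invRev', Nat.cast_add] at h5 ⊢
    have h6 := abs_deviation_append_sub hv a p q
    have h7 := abs_deviation_append_sub hv a p k
    have h8 := abs_deviation_le hv ha q
    have h9 := abs_deviation_le hv ha k
    have hk0 : (0 : ℝ) ≤ k.length := by positivity
    have hq0 : (0 : ℝ) ≤ q.length := by positivity
    have h10 : (2 + a) * (q.length : ℝ) ≤ (2 + a) * B := by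
      apply mul_le_mul_of_nonneg_left <;> linarith
    have h11 : (2 + a) * (k.length : ℝ) ≤ (2 + a) * B := by
      apply mul_le_mul_of_nonneg_left <;> linarith
    have h12 : ε * (k.length : ℝ) ≤ ε * B := by
      apply mul_le_mul_of_nonneg_left <;> linarith
    have h13 : 0 ≤ ε * (q.length : ℝ) := by positivity
    have h14 : |deviation v a (p ++ q)| ≤ |deviation v a (p ++ k)| + 2 * ((2 + a) * B)
        + 4 * v.length := by
      rw [abs_le] at h6 h7 h8 h9
      rw [abs_le]
      constructor
      · linarith [neg_abs_le (deviation v a (p ++ k))]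
      · linarith [le_abs_self (deviation v a (p ++ k))]
    rw [hc]
    linarith
  -- Along a legal piece only the first `K` edges can be costly: afterwards at least `K` legal edges
  -- precede the cut and the path ends right after it.
  have hblock : ∀ (A p : List (E × Bool)), Γ.IsEdgePath (A ++ p) → FreeGroup.IsReduced (A ++ p) →
      f.LegalPath p →
      |deviation v a (f.tight n (A ++ p))| - ε * (f.tight n (A ++ p)).length ≤
        |deviation v a (f.tight n A)| - ε * (f.tight n A).length +
          c * (min K p.length : ℕ) := by
    intro A p
    induction p using List.reverseRecOn with
    | nil => intros; simp
    | append_singleton p e ih =>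
      intro hp hr hl
      rw [← List.append_assoc] at hp hr ⊢
      have h1 := ih hp.left (isReduced_left hr) hl.left
      rw [List.length_append, List.length_singleton]
      by_cases h : K ≤ p.length
      · have h2 := hgood (A ++ p) e hp hr ⟨A, p, [e], [], rfl, rfl, hl, Or.inr h, Or.inl rfl⟩
        rw [min_eq_left h] at h1
        rw [min_eq_left (by omega)]
        linarith
      · have h2 := hbad (A ++ p) e
        rw [min_eq_right (by omega)] at h1 ⊢
        push_cast
        linarith
  have hall : |deviation v a (f.tight n l)| - ε * (f.tight n l).length ≤ c * K * k := by
    induction k generalizing l with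
    | zero =>
      have : l = [] := hl
      subst this
      simp [tight_nil, deviation_nil hv]
    | succ k ih =>
      obtain ⟨A, p, rfl, hA, hpl⟩ := hl
      have h1 := ih hA hp.left (isReduced_left hr)
      have h2 := hblock A p hp hr hpl
      have h3 : c * (min K p.length : ℕ) ≤ c * K := by
        apply mul_le_mul_of_nonneg_left _ hc0
        exact_mod_cast min_le_left _ _
      push_cast
      linarith
  linarith

/-- Uniform convergence of frequencies for paths with a definite proportion of good edges. -/
theorem exists_uniform_frequency [Finite E] (htt : f.IsTrainTrack) {L C : ℝ} (hL : 1 < L)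
    (hexp : f.ExpandsLegal L) (hC : f.IsBoundedCancellation C) {v : List (E × Bool)} (hv : v ≠ [])
    {a : ℝ} (ha : 0 ≤ a)
    (hfreq : ∀ e : E × Bool, Tendsto (fun n : ℕ =>
      (occSymm v (f.map^[n] [e]) : ℝ) / (f.map^[n] [e]).length) atTop (𝓝 a))
    {δ ε : ℝ} (hδ : 0 < δ) (hε : 0 < ε) :
    ∃ M : ℕ, ∀ l : List (E × Bool), Γ.IsEdgePath l → FreeGroup.IsReduced l →
      δ * l.length ≤ (f.goodEdges ⌈C / (L - 1)⌉₊ l).card → ∀ n, M ≤ n →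
        |deviation v a (f.tight n l)| ≤ ε * (f.tight n l).length := by
  have hpow : Tendsto (fun n : ℕ => L ^ n) atTop atTop := tendsto_pow_atTop_atTop_of_one_lt hL
  have hlen : ∀ (n : ℕ) (e : E × Bool), L ^ n ≤ (f.map^[n] [e]).length := fun n e => by
    simpa using (f.legalPath_singleton e).length_iterate htt hL hexp n
  -- The time `m` is chosen once, for the finitely many edges. Half of `ε/2` covers the deviation
  -- from the limit, the other half the junction error, which is negligible against `L ^ m`.
  obtain ⟨m, hm⟩ : ∃ m : ℕ, ∀ e : E × Bool,
      |deviation v a (f.map^[m] [e])| + 2 * v.length ≤ ε / 2 * (f.map^[m] [e]).length := by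
    have h1 : ∀ᶠ m : ℕ in atTop, ∀ e : E × Bool,
        |(occSymm v (f.map^[m] [e]) : ℝ) / (f.map^[m] [e]).length - a| < ε / 4 := by
      rw [eventually_all]
      intro e
      exact (hfreq e).eventually (Metric.ball_mem_nhds a (by positivity : 0 < ε / 4))
    have h2 := hpow.eventually_ge_atTop (2 * v.length / (ε / 4))
    obtain ⟨m, h1, h2⟩ := (h1.and h2).exists
    refine ⟨m, fun e => ?_⟩
    have h3 := h1 e
    have h4 := hlen m e
    have h5 : (0 : ℝ) < (f.map^[m] [e]).length := lt_of_lt_of_le (by positivity) h4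
    have h6 : deviation v a (f.map^[m] [e]) =
        ((occSymm v (f.map^[m] [e]) : ℝ) / (f.map^[m] [e]).length - a) *
          (f.map^[m] [e]).length := by
      unfold deviation
      field_simp
    rw [h6, abs_mul, abs_of_pos h5]
    have h7 : |(occSymm v (f.map^[m] [e]) : ℝ) / (f.map^[m] [e]).length - a| *
        (f.map^[m] [e]).length ≤ ε / 4 * (f.map^[m] [e]).length := by gcongr
    have h8 : 2 * (v.length : ℝ) ≤ ε / 4 * (f.map^[m] [e]).length := by
      rw [div_le_iff₀ (by positivity)] at h2
      have := h2.trans (mul_le_mul_of_nonneg_right h4 (by positivity))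
      linarith
    linarith
  obtain ⟨B, hB⟩ : ∃ B : ℕ, ∀ e : E × Bool, (f.map^[m] [e]).length ≤ B := by
    cases nonempty_fintype E
    exact ⟨Finset.univ.sup fun e : E × Bool => (f.map^[m] [e]).length, fun e =>
      Finset.le_sup (f := fun e : E × Bool => (f.map^[m] [e]).length) (Finset.mem_univ e)⟩
  set c : ℝ := ((2 * (2 + a) + ε / 2) * B + 4 * v.length) * ⌈C / (L - 1)⌉₊ with hc
  have hc0 : 0 ≤ c := by positivity
  -- From here on `L ^ n δ (ε / 2)` dominates `c`, the price per edge of the original path.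
  obtain ⟨M, hM⟩ := eventually_atTop.1 (hpow.eventually_ge_atTop (c / (δ * (ε / 2))))
  refine ⟨M + m, fun l hp hr hgood n hn => ?_⟩
  obtain ⟨n', rfl⟩ : ∃ n', n = m + n' := ⟨n - m, by omega⟩
  -- The last `m` of the `n` iterations produce the right frequencies; the first `n'` make the path
  -- long while keeping at most `l.length` legal pieces.
  have h1 := abs_deviation_tight_le htt hL hexp hC hv ha (by positivity : (0 : ℝ) ≤ ε / 2)
    (Nat.cast_nonneg B) m (fun e => by exact_mod_cast hB e) hm l.length
    (isLegalConcat_tight htt n' l) (f.isEdgePath_tight n' hp) (f.isReduced_tight n' l)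
  rw [← tight_add] at h1
  have h2 := le_length_tight htt hL hexp hC (m + n') hp hr
  have h3 := hM (m + n') (by omega)
  rw [div_le_iff₀ (by positivity)] at h3
  have h4 : L ^ (m + n') * (δ * l.length) ≤ (f.tight (m + n') l).length :=
    (mul_le_mul_of_nonneg_left hgood (by positivity)).trans h2
  have h5 : c * l.length ≤ ε / 2 * (f.tight (m + n') l).length := by
    calc c * l.length ≤ L ^ (m + n') * (δ * (ε / 2)) * l.length := by gcongr
      _ = ε / 2 * (L ^ (m + n') * (δ * l.length)) := by ring
      _ ≤ _ := by gcongr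
  rw [← hc] at h1
  linarith

end Growth

end GraphMap

end Frequencies

/-! ### Convergence of the frequencies -/

section Reverse

open FreeGroup

variable {E : Type*}

lemma invRev_suffix_iff {v w : List (E × Bool)} : invRev v <:+ invRev w ↔ v <+: w := by
  constructor
  · rintro ⟨t, ht⟩
    refine ⟨invRev t, ?_⟩
    rw [← invRev_invRev (L₁ := w), ← ht, invRev_append, invRev_invRev]
  · rintro ⟨t, rfl⟩
    exact ⟨invRev t, invRev_append.symm⟩

variable [DecidableEq E]

/-- The count is defined by peeling letters off the front; the recursion from the other end is what
shows its symmetry under path reversal. -/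
lemma occ_concat {v : List (E × Bool)} (hv : v ≠ []) (w : List (E × Bool)) (a : E × Bool) :
    occ v (w ++ [a]) = occ v w + if v <:+ w ++ [a] then 1 else 0 := by
  induction w with
  | nil =>
    rw [List.nil_append, occ_cons, occ_nil hv]
    congr 1
    refine if_congr ?_ rfl rfl
    rw [List.isPrefixOf_iff_prefix, List.prefix_cons_iff, List.suffix_cons_iff]
    simp only [hv, false_or, List.prefix_nil, List.suffix_nil, or_false]
    constructor
    · rintro ⟨t, rfl, rfl⟩
      rfl
    · intro h
      exact ⟨[], h, rfl⟩
  | cons b w ih =>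
    rw [List.cons_append, occ_cons, ih, occ_cons, add_assoc, add_assoc]
    congr 1
    simp only [List.isPrefixOf_iff_prefix]
    -- A short `v` cannot notice the opposite end of the word. If `v` has the full length, being a
    -- prefix, a suffix and the whole word are the same; a longer `v` never occurs.
    rcases lt_trichotomy v.length (w.length + 2) with h | h | h
    · have h1 : v <+: b :: (w ++ [a]) ↔ v <+: b :: w := by
        rw [← List.cons_append]
        refine ⟨fun h' => ?_, fun h' => h'.trans (List.prefix_append _ _)⟩
        exact List.prefix_of_prefix_length_le h' (List.prefix_append _ _) (by simp; omega)
      have h2 : v <:+ b :: (w ++ [a]) ↔ v <:+ w ++ [a] := by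
        refine ⟨fun h' => ?_, fun h' => h'.trans (List.suffix_cons _ _)⟩
        exact List.suffix_of_suffix_length_le h' (List.suffix_cons _ _) (by simp; omega)
      rw [if_congr h1 rfl rfl, if_congr h2 rfl rfl, add_comm]
    · have h1 : ¬ v <:+ w ++ [a] := fun h' => by
        have := h'.length_le
        simp at this
        omega
      have h2 : ¬ v <+: b :: w := fun h' => by
        have := h'.length_le
        simp at this
        omega
      have h3 : v <+: b :: (w ++ [a]) ↔ v <:+ b :: (w ++ [a]) :=
        ⟨fun h' => (h'.eq_of_length (by simpa using h)) ▸ List.suffix_rfl,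
          fun h' => (h'.eq_of_length (by simpa using h)) ▸ List.prefix_rfl⟩
      rw [if_neg h1, if_neg h2, if_congr h3 rfl rfl]
    · have h1 : ∀ l : List (E × Bool), l.length ≤ w.length + 2 → ¬ v <+: l ∧ ¬ v <:+ l := by
        intro l hl
        constructor <;> intro h' <;> have := h'.length_le <;> omega
      rw [if_neg (h1 _ (by simp)).2, if_neg (h1 _ (by simp)).1, if_neg (h1 _ (by simp)).1,
        if_neg (h1 _ (by simp)).2]

lemma occ_invRev {v : List (E × Bool)} (hv : v ≠ []) (w : List (E × Bool)) :
    occ (invRev v) (invRev w) = occ v w := by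
  have hv' := mt invRev_eq_nil_iff.1 hv
  induction w with
  | nil => simp [occ_nil hv, occ_nil hv']
  | cons a w ih =>
    rw [invRev_cons_eq, occ_concat hv', ih, occ_cons, ← invRev_cons_eq]
    simp only [invRev_suffix_iff, List.isPrefixOf_iff_prefix]

lemma occSymm_invRev {v : List (E × Bool)} (hv : v ≠ []) (w : List (E × Bool)) :
    occSymm v (invRev w) = occSymm v w := by
  have h1 := occ_invRev hv w
  have h2 := occ_invRev (mt invRev_eq_nil_iff.1 hv) w
  rw [invRev_invRev] at h2
  rw [occSymm, occSymm, h1, h2, add_comm]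

end Reverse

section PerronFrobenius

open FreeGroup

variable {V E : Type*} {Γ : OrGraph V E}

namespace GraphMap

variable {f : GraphMap Γ}

lemma length_iterate_eq_sum (n : ℕ) (w : List (E × Bool)) :
    (f.map^[n] w).length = (w.map fun a => (f.map^[n] [a]).length).sum := by
  induction w with
  | nil => simp [iterate_map_nil]
  | cons a w ih =>
    rw [← List.singleton_append, iterate_map_append, List.length_append, ih]
    simp

lemma iterate_singleton_of_fst_eq (n : ℕ) {a b : E × Bool} (h : a.1 = b.1) :
    f.map^[n] [a] = f.map^[n] [b] ∨ f.map^[n] [a] = invRev (f.map^[n] [b]) := by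
  rcases a with ⟨a, s⟩
  rcases b with ⟨b, t⟩
  obtain rfl : a = b := h
  rw [← iterate_map_invRev, invRev_singleton]
  cases s <;> cases t <;> simp [invLetter]

variable [DecidableEq E]

lemma sum_le_occSymm_iterate {v : List (E × Bool)} (hv : v ≠ []) (n : ℕ) (w : List (E × Bool)) :
    (w.map fun a => occSymm v (f.map^[n] [a])).sum ≤ occSymm v (f.map^[n] w) := by
  induction w with
  | nil => simp
  | cons a w ih =>
    rw [← List.singleton_append, iterate_map_append]
    refine le_trans ?_ (occSymm_append_ge hv _ _)
    simpa using ih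

lemma exists_mem_edge (hM : ∀ i j : E, 0 < f.transitionMatrix i j) (e : E × Bool) (i : E) :
    ∃ a ∈ f.edge e, a.1 = i := by
  obtain ⟨a, ha, hai⟩ := List.countP_pos_iff.1 (hM i e.1)
  rcases e with ⟨e, _ | _⟩
  · refine ⟨invLetter a, ?_, by simpa [invLetter] using hai⟩
    simp only [edge, Bool.false_eq_true, if_false, invRev, List.mem_reverse, List.mem_map]
    exact ⟨a, ha, rfl⟩
  · exact ⟨a, by simpa [edge] using ha, by simpa using hai⟩

/-- All edges have comparable lengths under iteration. -/
lemma exists_length_comparison [Finite E]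
    (hM : ∀ i j : E, 0 < f.transitionMatrix i j) :
    ∃ B : ℕ, ∀ n (e e' : E × Bool),
      (f.map^[n + 1] [e]).length ≤ B * (f.map^[n] [e']).length := by
  cases nonempty_fintype E
  set B₁ := Finset.univ.sup fun e : E × Bool => (f.map^[1] [e]).length
  set B₂ := Finset.univ.sup fun e : E × Bool => (f.map^[2] [e]).length
  have hB₁ : ∀ e, (f.map^[1] [e]).length ≤ B₁ := fun e =>
    Finset.le_sup (f := fun e : E × Bool => (f.map^[1] [e]).length) (Finset.mem_univ e)
  have hB₂ : ∀ e, (f.map^[2] [e]).length ≤ B₂ := fun e =>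
    Finset.le_sup (f := fun e : E × Bool => (f.map^[2] [e]).length) (Finset.mem_univ e)
  refine ⟨max B₁ B₂, fun n e e' => ?_⟩
  cases n with
  | zero =>
    simpa using Or.inl (hB₁ e)
  | succ n =>
    -- `f^(n+2)(e)` is a product of boundedly many paths `f^n(a)` with `a` in `f^2(e)`. By
    -- positivity of the matrix `f(e')` crosses `a`, so `f^(n+1)(e')` contains `f^n(a)` up to
    -- orientation.
    rw [show n + 1 + 1 = n + 2 by ring, Function.iterate_add_apply f.map n 2,
      length_iterate_eq_sum n (f.map^[2] [e])]
    have h1 : ∀ x ∈ ((f.map^[2] [e]).map fun a => (f.map^[n] [a]).length),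
        x ≤ (f.map^[n + 1] [e']).length := by
      intro x hx
      obtain ⟨a, -, rfl⟩ := List.mem_map.1 hx
      obtain ⟨b, hb, hba⟩ := exists_mem_edge hM e' a.1
      rw [Function.iterate_succ_apply, map_singleton, length_iterate_eq_sum n (f.edge e')]
      have h2 : (f.map^[n] [a]).length = (f.map^[n] [b]).length := by
        rcases iterate_singleton_of_fst_eq (f := f) n hba.symm with h | h
        · rw [h]
        · rw [h, length_invRev']
      rw [h2]
      exact List.single_le_sum (by simp) _ (List.mem_map_of_mem hb)
    refine (List.sum_le_card_nsmul _ _ h1).trans ?_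
    rw [smul_eq_mul, List.length_map]
    exact Nat.mul_le_mul_right _ ((hB₂ e).trans (le_max_right _ _))

/-- The frequency of `v` in `f^n(e)` converges, and the limit does not depend on `e`. -/
theorem exists_frequency [Finite E] [Nonempty E] (htt : f.IsTrainTrack)
    (hM : ∀ i j : E, 0 < f.transitionMatrix i j) {v : List (E × Bool)} (hv : v ≠ []) :
    ∃ a : ℝ, 0 ≤ a ∧ ∀ e : E × Bool, Tendsto (fun n : ℕ =>
      (occSymm v (f.map^[n] [e]) : ℝ) / (f.map^[n] [e]).length) atTop (𝓝 a) := by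
  obtain ⟨B, hB⟩ := exists_length_comparison hM
  set u : ℕ → E × Bool → ℝ := fun n e => (f.map^[n] [e]).length with hu
  set x : ℕ → E × Bool → ℝ := fun n e => occSymm v (f.map^[n] [e]) with hx
  set r : ℕ → E × Bool → ℝ := fun n e => x n e / u n e with hr
  have hu0 : ∀ n e, 0 < u n e := by
    intro n e
    have h1 := f.head_iterate_map htt.1 n e []
    simp only [hu, Nat.cast_pos, List.length_pos_iff]
    intro h
    rw [h] at h1
    simp at h1
  have hru : ∀ n e, r n e * u n e = x n e := fun n e => div_mul_cancel₀ _ (hu0 n e).ne'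
  have hr0 : ∀ n e, 0 ≤ r n e := fun n e => by
    simp only [hr, hx]
    have := hu0 n e
    positivity
  have hr2 : ∀ n e, r n e ≤ 2 := fun n e => by
    rw [hr]
    simp only
    rw [div_le_iff₀ (hu0 n e)]
    simp only [hx, hu]
    exact_mod_cast occSymm_le hv _
  -- Only the minimum is shown to be monotone: occurrences across junctions can raise frequencies
  -- but never lower them, so the maximum is controlled through the gap.
  set lo : ℕ → ℝ := fun n => ⨅ e, r n e with hlo
  set hi : ℕ → ℝ := fun n => ⨆ e, r n e with hhi
  have hlor : ∀ n e, lo n ≤ r n e := fun n e => ciInf_le (Set.finite_range _).bddBelow e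
  have hrhi : ∀ n e, r n e ≤ hi n := fun n e => le_ciSup (Set.finite_range _).bddAbove e
  have hB0 : (0 : ℝ) < B := by
    obtain ⟨e⟩ : Nonempty (E × Bool) := inferInstance
    have h1 : u 1 e ≤ B * u 0 e := by
      simp only [hu]
      exact_mod_cast hB 0 e e
    have h2 := hu0 1 e
    have h3 := hu0 0 e
    by_contra h
    nlinarith
  -- The path `f(e)` crosses the edge `e₁` of maximal frequency, and the block of that edge makes up
  -- at least the fraction `1 / B` of `f^(n+1)(e)`. All other blocks have frequency at least `lo n`.
  have step : ∀ n, lo n + (hi n - lo n) / B ≤ lo (n + 1) := by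
    intro n
    refine le_ciInf fun e => ?_
    obtain ⟨e₁, he₁⟩ : ∃ e₁, r n e₁ = hi n := exists_eq_ciSup_of_finite
    obtain ⟨b, hb, hb1⟩ := exists_mem_edge hM e e₁.1
    have hub : u n b = u n e₁ := by
      rcases iterate_singleton_of_fst_eq (f := f) n hb1 with h | h
      · simp only [hu, h]
      · simp only [hu, h, length_invRev']
    have hxb : x n b = x n e₁ := by
      rcases iterate_singleton_of_fst_eq (f := f) n hb1 with h | h
      · simp only [hx, h]
      · simp only [hx, h, occSymm_invRev hv]
    have h1 : u (n + 1) e = ((f.edge e).map (u n)).sum := by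
      simp only [hu]
      rw [Function.iterate_succ_apply, map_singleton, length_iterate_eq_sum n (f.edge e),
        Nat.cast_list_sum, List.map_map]
      rfl
    have h2 : ((f.edge e).map (x n)).sum ≤ x (n + 1) e := by
      have := sum_le_occSymm_iterate (f := f) hv n (f.edge e)
      simp only [hx]
      rw [Function.iterate_succ_apply, map_singleton]
      refine le_trans (le_of_eq ?_) (Nat.cast_le.2 this)
      rw [Nat.cast_list_sum, List.map_map]
      rfl
    have h3 : ((f.edge e).map (x n)).sum - lo n * ((f.edge e).map (u n)).sum =
        ((f.edge e).map fun a => x n a - lo n * u n a).sum := by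
      induction f.edge e with
      | nil => simp
      | cons a l ih =>
        simp only [List.map_cons, List.sum_cons]
        rw [← ih]
        ring
    have h4 : x n b - lo n * u n b ≤ ((f.edge e).map fun a => x n a - lo n * u n a).sum := by
      apply List.single_le_sum
      · intro y hy
        obtain ⟨a, -, rfl⟩ := List.mem_map.1 hy
        rw [← hru n a]
        have := mul_le_mul_of_nonneg_right (hlor n a) (hu0 n a).le
        linarith
      · exact List.mem_map_of_mem (f := fun a => x n a - lo n * u n a) hb
    have h5 : x n b - lo n * u n b = (hi n - lo n) * u n e₁ := by
      rw [hxb, hub, ← hru n e₁, he₁]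
      ring
    have h6 : u (n + 1) e ≤ B * u n e₁ := by
      simp only [hu]
      exact_mod_cast hB n e e₁
    have h7 : 0 ≤ hi n - lo n := by linarith [hlor n e₁, hrhi n e₁]
    have h8 : (hi n - lo n) / B * u (n + 1) e ≤ (hi n - lo n) * u n e₁ := by
      rw [div_mul_eq_mul_div, div_le_iff₀ hB0]
      have := mul_le_mul_of_nonneg_left h6 h7
      linarith
    simp only [hr]
    rw [le_div_iff₀ (hu0 _ _)]
    rw [← h1] at h3
    linarith
  have hgap : ∀ n, 0 ≤ hi n - lo n := fun n => by
    obtain ⟨e⟩ : Nonempty (E × Bool) := inferInstance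
    linarith [hlor n e, hrhi n e]
  have hmono : Monotone lo := monotone_nat_of_le_succ fun n => by
    have h1 := step n
    have h2 := div_nonneg (hgap n) hB0.le
    linarith
  have hbdd : BddAbove (Set.range lo) := by
    refine ⟨2, ?_⟩
    rintro _ ⟨n, rfl⟩
    obtain ⟨e⟩ : Nonempty (E × Bool) := inferInstance
    exact (hlor n e).trans (hr2 n e)
  have hlim := tendsto_atTop_ciSup hmono hbdd
  set a := ⨆ n, lo n
  -- By `step` the gap is at most `B` times the increment of the convergent sequence `lo`, so it
  -- closes.
  have hdiff : Tendsto (fun n => B * (lo (n + 1) - lo n)) atTop (𝓝 0) := by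
    have := ((hlim.comp (tendsto_add_atTop_nat 1)).sub hlim).const_mul (B : ℝ)
    simpa using this
  refine ⟨a, ?_, fun e => ?_⟩
  · refine ge_of_tendsto' hlim fun n => le_ciInf (hr0 n)
  · have hup : Tendsto (fun n => lo n + B * (lo (n + 1) - lo n)) atTop (𝓝 a) := by
      simpa using hlim.add hdiff
    refine tendsto_of_tendsto_of_tendsto_of_le_of_le hlim hup (fun n => hlor n e) fun n => ?_
    refine (hrhi n e).trans ?_
    have := step n
    have h1 : (hi n - lo n) / B ≤ lo (n + 1) - lo n := by linarith
    rw [div_le_iff₀ hB0] at h1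
    linarith

end GraphMap

end PerronFrobenius

/-! ### Periodic words -/

section Periodic

open FreeGroup

variable {E : Type*} {L : ℕ}

/-- The segment of length `n`, starting at `i`, of the periodic bi-infinite word `b`. -/
def seg (b : ZMod L → E × Bool) : ZMod L → ℕ → List (E × Bool)
  | _, 0 => []
  | i, n + 1 => b i :: seg b (i + 1) n

variable (b : ZMod L → E × Bool)

@[simp] lemma length_seg (i : ZMod L) (n : ℕ) : (seg b i n).length = n := by
  induction n generalizing i with
  | zero => rfl
  | succ n ih => simp [seg, ih]

lemma seg_add (i : ZMod L) (m n : ℕ) : seg b i (m + n) = seg b i m ++ seg b (i + m) n := by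
  induction m generalizing i with
  | zero => simp [seg]
  | succ m ih =>
    rw [show m + 1 + n = (m + n) + 1 by ring, seg, seg, ih, List.cons_append]
    congr 3
    push_cast
    ring

lemma getElem?_seg (i : ZMod L) (n k : ℕ) (h : k < n) : (seg b i n)[k]? = some (b (i + k)) := by
  obtain ⟨t, rfl⟩ := Nat.exists_eq_add_of_lt h
  rw [show k + t + 1 = k + (t + 1) by ring, seg_add, List.getElem?_append_right (by simp)]
  simp [seg]

lemma seg_mul (m : ℕ) : seg b 0 (m * L) = (List.replicate m (seg b 0 L)).flatten := by
  induction m with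
  | zero => simp [seg]
  | succ m ih =>
    rw [Nat.succ_mul, Nat.add_comm, seg_add, List.replicate_succ, List.flatten_cons, ← ih]
    simp

/-- Every nonempty word is a period of a periodic word. -/
lemma exists_seg_eq {w : List (E × Bool)} (hw : w ≠ []) :
    ∃ b : ZMod w.length → E × Bool, seg b 0 w.length = w := by
  have : NeZero w.length := ⟨by simpa using hw⟩
  refine ⟨fun i => w[i.val]'(ZMod.val_lt i), ?_⟩
  apply List.ext_getElem?
  intro k
  by_cases hk : k < w.length
  · rw [getElem?_seg _ _ _ _ hk, List.getElem?_eq_getElem hk]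
    simp [ZMod.val_natCast, Nat.mod_eq_of_lt hk]
  · rw [List.getElem?_eq_none (by simpa using hk), List.getElem?_eq_none (by simpa using hk)]

lemma sum_range_eq_sum_zmod [NeZero L] (g : ZMod L → ℕ) (i : ZMod L) :
    ∑ k ∈ Finset.range L, g (i + k) = ∑ z, g z := by
  rw [← Equiv.sum_comp (Equiv.addLeft i) g]
  refine Finset.sum_nbij (fun k => (k : ZMod L)) (by simp) ?_ ?_ (by simp)
  · intro x hx y hy hxy
    simp only [Finset.coe_range, Set.mem_Iio] at hx hy
    have := (ZMod.natCast_eq_natCast_iff' x y L).1 hxy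
    rwa [Nat.mod_eq_of_lt hx, Nat.mod_eq_of_lt hy] at this
  · intro z _
    exact ⟨z.val, by simpa using ZMod.val_lt z, by simp⟩

lemma sum_range_mul [NeZero L] (g : ZMod L → ℕ) (m : ℕ) (i : ZMod L) :
    ∑ k ∈ Finset.range (m * L), g (i + k) = m * ∑ z, g z := by
  induction m with
  | zero => simp
  | succ m ih =>
    rw [Nat.succ_mul, Finset.sum_range_add, ih, Nat.succ_mul]
    congr 1
    rw [← sum_range_eq_sum_zmod g (i + (m * L : ℕ))]
    simp

lemma prefix_seg_iff (v : List (E × Bool)) (i : ZMod L) (n : ℕ) :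
    v <+: seg b i n ↔ v.length ≤ n ∧ seg b i v.length = v := by
  constructor
  · intro h
    have h1 : v.length ≤ n := by simpa using h.length_le
    refine ⟨h1, ?_⟩
    obtain ⟨t, rfl⟩ := Nat.exists_eq_add_of_le h1
    rw [seg_add] at h
    exact ((List.prefix_of_prefix_length_le h (List.prefix_append _ _)
      (by simp)).eq_of_length (by simp)).symm
  · rintro ⟨h1, h2⟩
    obtain ⟨t, rfl⟩ := Nat.exists_eq_add_of_le h1
    rw [seg_add]
    nth_rewrite 1 [← h2]
    exact List.prefix_append _ _

variable [DecidableEq E]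

/-- The positions in the periodic word `b` (modulo the period) from which `v` is read. -/
def cycPositions [NeZero L] (v : List (E × Bool)) : Finset (ZMod L) :=
  Finset.univ.filter fun i => seg b i v.length = v

lemma occ_seg_le (v : List (E × Bool)) (hv : v ≠ []) (i : ZMod L) (n : ℕ) :
    occ v (seg b i n) ≤
      ∑ k ∈ Finset.range n, if seg b (i + k) v.length = v then 1 else 0 := by
  induction n generalizing i with
  | zero => simp [seg, occ_nil hv]
  | succ n ih =>
    rw [Finset.sum_range_succ', seg, occ_cons]
    refine add_le_add ?_ ?_
    · refine (ih (i + 1)).trans (le_of_eq (Finset.sum_congr rfl fun k _ => ?_))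
      push_cast
      rw [add_assoc, add_comm 1 (k : ZMod L)]
    · simp only [List.isPrefixOf_iff_prefix]
      have := prefix_seg_iff b v i (n + 1)
      rw [seg] at this
      simp only [Nat.cast_zero, add_zero]
      split_ifs with h1 h2
      · rfl
      · exact absurd (this.1 h1).2 h2
      all_goals simp

/-- Only occurrences that run past the end of the segment are missed, and these start within its
last `v.length` positions. -/
lemma le_occ_seg (v : List (E × Bool)) (i : ZMod L) (n : ℕ) :
    (∑ k ∈ Finset.range n, if seg b (i + k) v.length = v then 1 else 0) ≤
      occ v (seg b i n) + min n v.length := by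
  induction n generalizing i with
  | zero => simp
  | succ n ih =>
    rw [Finset.sum_range_succ', seg, occ_cons]
    have h0 := ih (i + 1)
    have h1 : (∑ k ∈ Finset.range n, if seg b (i + (k + 1 : ℕ)) v.length = v then 1 else 0) =
        ∑ k ∈ Finset.range n, if seg b (i + 1 + k) v.length = v then 1 else 0 := by
      refine Finset.sum_congr rfl fun k _ => ?_
      push_cast
      rw [add_assoc, add_comm 1 (k : ZMod L)]
    rw [h1]
    simp only [List.isPrefixOf_iff_prefix]
    have h2 := prefix_seg_iff b v i (n + 1)
    rw [seg] at h2
    simp only [Nat.cast_zero, add_zero]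
    by_cases h3 : v.length ≤ n
    · have h4 : min n v.length ≤ min (n + 1) v.length := by omega
      have h5 : (if seg b i v.length = v then 1 else 0) ≤
          if v <+: b i :: seg b (i + 1) n then 1 else 0 := by
        split_ifs with h1 h2'
        · rfl
        · exact absurd (h2.2 ⟨by omega, h1⟩) h2'
        all_goals simp
      omega
    · have h4 : min (n + 1) v.length = min n v.length + 1 := by omega
      have h5 : (if seg b i v.length = v then 1 else 0) ≤ 1 := by split_ifs <;> simp
      omega

lemma occ_seg_mul [NeZero L] {v : List (E × Bool)} (hv : v ≠ []) (m : ℕ) :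
    occ v (seg b 0 (m * L)) ≤ m * (cycPositions b v).card ∧
      m * (cycPositions b v).card ≤ occ v (seg b 0 (m * L)) + v.length := by
  have h := sum_range_mul (fun i => if seg b i v.length = v then 1 else 0) m (0 : ZMod L)
  have h1 : ∑ z, (if seg b z v.length = v then 1 else 0) = (cycPositions b v).card := by
    rw [cycPositions, Finset.card_filter]
  rw [h1] at h
  constructor
  · rw [← h]
    exact occ_seg_le b v hv 0 (m * L)
  · rw [← h]
    refine (le_occ_seg b v 0 (m * L)).trans ?_
    gcongr
    exact min_le_right _ _

/-- The number of occurrences of `v` and of its inverse in one period. -/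
def cycOcc [NeZero L] (v : List (E × Bool)) : ℕ :=
  (cycPositions b v).card + (cycPositions b (invRev v)).card

lemma abs_deviation_seg_mul_sub [NeZero L] {v : List (E × Bool)} (hv : v ≠ []) (a : ℝ) (m : ℕ) :
    |deviation v a (seg b 0 (m * L)) - m * (cycOcc b v - a * L)| ≤ 2 * v.length := by
  obtain ⟨h1, h2⟩ := occ_seg_mul b hv m
  obtain ⟨h3, h4⟩ := occ_seg_mul b (mt invRev_eq_nil_iff.1 hv) m
  rw [length_invRev'] at h4
  have h5 : (m : ℝ) * (cycPositions b v).card ≤ occ v (seg b 0 (m * L)) + v.length := by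
    exact_mod_cast h2
  have h6 : (m : ℝ) * (cycPositions b (invRev v)).card ≤
      occ (invRev v) (seg b 0 (m * L)) + v.length := by exact_mod_cast h4
  have h7 : (occ v (seg b 0 (m * L)) : ℝ) ≤ m * (cycPositions b v).card := by exact_mod_cast h1
  have h8 : (occ (invRev v) (seg b 0 (m * L)) : ℝ) ≤ m * (cycPositions b (invRev v)).card := by
    exact_mod_cast h3
  have h9 : (0 : ℝ) ≤ v.length := by positivity
  rw [deviation, occSymm, cycOcc, length_seg]
  push_cast
  rw [abs_le]
  constructor <;> nlinarith

/-- Multiplication replaces the cancelled block `k` by the block `p`, both no longer than `g`, and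
creates two junctions. Hence a fixed conjugation changes the deviation of all powers by a bounded
amount. -/
lemma abs_deviation_mul_left_sub {v : List (E × Bool)} (hv : v ≠ []) {a : ℝ} (ha : 0 ≤ a)
    (g h : FreeGroup E) :
    |deviation v a (g * h).toWord - deviation v a h.toWord| ≤
      2 * (2 + a) * g.toWord.length + 4 * v.length := by
  obtain ⟨p, k, q, h1, h2, h3⟩ := exists_mul_decomp g h
  rw [h1, h2, h3]
  have e1 := abs_deviation_append_sub hv a p q
  have e2 := abs_deviation_append_sub hv a (invRev k) q
  have e3 := abs_deviation_le hv ha p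
  have e4 := abs_deviation_le hv ha (invRev k)
  rw [length_invRev'] at e4
  rw [List.length_append]
  push_cast
  have e5 : 0 ≤ (2 + a) * (p.length : ℝ) := by positivity
  have e6 : 0 ≤ (2 + a) * (k.length : ℝ) := by positivity
  rw [abs_le] at *
  constructor <;> linarith

lemma abs_deviation_mul_right_sub {v : List (E × Bool)} (hv : v ≠ []) {a : ℝ} (ha : 0 ≤ a)
    (g h : FreeGroup E) :
    |deviation v a (h * g).toWord - deviation v a h.toWord| ≤
      2 * (2 + a) * g.toWord.length + 4 * v.length := by
  have h1 := abs_deviation_mul_left_sub hv ha g⁻¹ h⁻¹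
  have h2 : ∀ x : FreeGroup E, deviation v a x⁻¹.toWord = deviation v a x.toWord := fun x => by
    rw [toWord_inv, deviation, occSymm_invRev hv, length_invRev', deviation]
  rw [← mul_inv_rev, h2, h2, length_toWord_inv] at h1
  exact h1

/-- If all powers of a conjugate of the cyclically reduced word `c` have almost the right frequency
of `v`, then so does the circuit `c`. -/
lemma abs_cycOcc_sub_le [NeZero L] {v : List (E × Bool)} (hv : v ≠ []) {a ε : ℝ} (ha : 0 ≤ a)
    (hε : 0 ≤ ε) (hb : ∀ m, FreeGroup.IsReduced (seg b 0 (m * L))) (g : FreeGroup E)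
    (h : ∀ m : ℕ, |deviation v a ((g * mk (seg b 0 L) * g⁻¹) ^ m).toWord| ≤
      ε * ((g * mk (seg b 0 L) * g⁻¹) ^ m).toWord.length) :
    |(cycOcc b v : ℝ) - a * L| ≤ ε * L := by
  set D : ℝ := 2 * (2 * (2 + a) * g.toWord.length + 4 * v.length) + 2 * v.length +
    ε * (2 * g.toWord.length) with hD
  -- The deviation of the `m`-th power is `m` times that of the circuit, up to the conjugation and
  -- junction errors collected in `D`. A linear function of `m` bounded by `D` has slope at most
  -- zero.
  have key : ∀ m : ℕ, (m : ℝ) * (|(cycOcc b v : ℝ) - a * L| - ε * L) ≤ D := by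
    intro m
    have h1 := h m
    have hpow : mk (seg b 0 L) ^ m = mk (seg b 0 (m * L)) := by
      rw [pow_mk, seg_mul]
    rw [conj_pow, hpow] at h1
    set x := mk (seg b 0 (m * L)) with hx
    have hxw : x.toWord = seg b 0 (m * L) := toWord_mk_of_isReduced (hb m)
    have h2 := abs_deviation_mul_right_sub hv ha g⁻¹ (g * x)
    have h3 := abs_deviation_mul_left_sub hv ha g x
    have h4 := abs_deviation_seg_mul_sub b hv a m
    rw [hxw] at h3
    rw [length_toWord_inv] at h2
    have h5 : ((g * x * g⁻¹).toWord.length : ℝ) ≤ 2 * g.toWord.length + m * L := by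
      have e1 := length_toWord_mul_le (g * x) g⁻¹
      have e2 := length_toWord_mul_le g x
      rw [length_toWord_inv] at e1
      rw [hxw, length_seg] at e2
      have : (g * x * g⁻¹).toWord.length ≤ 2 * g.toWord.length + m * L := by omega
      exact_mod_cast this
    have h6 : |(m : ℝ) * (cycOcc b v - a * L)| = m * |(cycOcc b v : ℝ) - a * L| := by
      rw [abs_mul, Nat.abs_cast]
    have h7 := mul_le_mul_of_nonneg_left h5 hε
    have h8 : |(m : ℝ) * (cycOcc b v - a * L)| ≤ |deviation v a (g * x * g⁻¹).toWord| +
        2 * (2 * (2 + a) * g.toWord.length + 4 * v.length) + 2 * v.length := by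
      rw [abs_le] at h2 h3 h4 ⊢
      constructor
      · linarith [neg_abs_le (deviation v a (g * x * g⁻¹).toWord)]
      · linarith [le_abs_self (deviation v a (g * x * g⁻¹).toWord)]
    rw [h6] at h8
    rw [hD]
    linarith
  by_contra hcon
  push Not at hcon
  obtain ⟨m, hm⟩ := exists_nat_gt (D / (|(cycOcc b v : ℝ) - a * L| - ε * L))
  rw [div_lt_iff₀ (by linarith)] at hm
  linarith [key m]

end Periodic

/-! ### Goodness of circuits -/

section Goodness

open FreeGroup

variable {V E : Type*} {Γ : OrGraph V E}

namespace GraphMap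

variable {f : GraphMap Γ}

/-- The turn between the edges `s` and `s + 1` sits at vertex `s + 1`, and the two inequalities
place that vertex at distance less than `K` from vertex `s₀`. The legal stretch is the
`K`-neighbourhood of `s₀`, truncated at the ends of `l`. -/
lemma goodSplit_of_legalTurns {K s₀ : ℕ} {l : List (E × Bool)} (hp : Γ.IsEdgePath l)
    (hl : s₀ ≤ l.length) (h : ∀ s a b, s₀ < s + 1 + K → s + 1 < s₀ + K → l[s]? = some a → l[s + 1]? = some b →
      f.LegalTurn (invLetter a) b) :
    f.GoodSplit K (l.take s₀) (l.drop s₀) := by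
  refine ⟨l.take (s₀ - K), (l.take s₀).drop (s₀ - K), (l.drop s₀).take K, (l.drop s₀).drop K,
    ?_, (List.take_append_drop _ _).symm, ?_, ?_, ?_⟩
  · have := (List.take_append_drop (s₀ - K) (l.take s₀)).symm
    rwa [List.take_take, min_eq_left (by omega)] at this
  · have h1 : (l.take s₀).drop (s₀ - K) ++ (l.drop s₀).take K =
        (l.drop (s₀ - K)).take (s₀ - (s₀ - K) + K) := by
      rw [List.take_add, List.drop_take, List.drop_drop]
      congr 3
      omega
    rw [h1]
    constructor
    · have h2 : l = l.take (s₀ - K) ++ ((l.drop (s₀ - K)).take (s₀ - (s₀ - K) + K) ++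
          (l.drop (s₀ - K)).drop (s₀ - (s₀ - K) + K)) := by
        rw [List.take_append_drop, List.take_append_drop]
      rw [h2] at hp
      exact hp.right.left
    · rw [List.isChain_iff_getElem]
      intro i hi
      simp only [List.length_take, List.length_drop] at hi
      rw [List.getElem_take, List.getElem_take, List.getElem_drop, List.getElem_drop]
      refine h (s₀ - K + i) _ _ (by omega) (by omega) (List.getElem?_eq_getElem _) ?_
      exact List.getElem?_eq_getElem _
  · by_cases hK : K ≤ s₀
    · right
      simp only [List.length_drop, List.length_take]
      omega
    · left
      rw [Nat.sub_eq_zero_of_le (by omega), List.take_zero]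
  · by_cases hK : K ≤ l.length - s₀
    · right
      simp only [List.length_drop, List.length_take]
      omega
    · left
      rw [List.drop_eq_nil_iff]
      simp only [List.length_drop]
      omega

/-- Each of the `m` copies of a good edge of the circuit is good in the unrolled path. The two ends
cost nothing, since a legal stretch may stop there. Distances are integers, so the threshold may be
rounded up. -/
lemma card_goodEdges_ge [DecidableEq E] {C : ℝ} {L : ℕ} [NeZero L] (b : ZMod L → E × Bool) (m : ℕ)
    (hp : Γ.IsEdgePath (seg b 0 (m * L))) :
    m * {i : ℕ | i < L ∧ f.GoodEdge C (seg b 0 L) i}.ncard ≤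
      (f.goodEdges ⌈C⌉₊ (seg b 0 (m * L))).card := by
  set K := ⌈C⌉₊ with hK
  set G := {i : ℕ | i < L ∧ f.GoodEdge C (seg b 0 L) i} with hG
  have hGfin : G.Finite := (Set.finite_lt_nat L).subset fun i hi => hi.1
  rw [Set.ncard_eq_toFinset_card G hGfin]
  have hL : 0 < L := Nat.pos_of_neZero L
  -- The inequalities put vertex `s + 1` at distance less than `K` from the edge between the
  -- vertices `i + t L` and `i + t L + 1`.
  have hgood : ∀ i ∈ G, ∀ t, ∀ s, i + t * L < s + 1 + K → s + 1 < i + t * L + 1 + K →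
      f.LegalTurn (invLetter (b s)) (b (s + 1 : ℕ)) := by
    intro i hi t s h1 h2
    by_contra hcon
    have h3 : ¬ f.LegalAt (seg b 0 L) ((s + 1) % L) := by
      intro hleg
      refine hcon (hleg _ _ ?_ ?_)
      · rw [length_seg, getElem?_seg _ _ _ _ (Nat.mod_lt _ hL)]
        congr 2
        rw [zero_add, ZMod.natCast_mod, Nat.add_sub_assoc (by omega), Nat.cast_add,
          ZMod.natCast_mod, Nat.cast_sub (by omega)]
        push_cast
        simp
      · rw [length_seg, getElem?_seg _ _ _ _ (Nat.mod_lt _ hL)]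
        congr 2
        rw [zero_add, ZMod.natCast_mod, ZMod.natCast_mod]
    have h4 := hi.2 _ (by rw [length_seg]; exact Nat.mod_lt _ hL) h3
    rw [length_seg] at h4
    have h5 : K ≤ circuitDist L i ((s + 1) % L) := Nat.ceil_le.2 h4
    have hiL := hi.1
    have hsL := Nat.mod_lt (s + 1) hL
    unfold circuitDist at h5
    -- The vertex lies before or after the edge; its distance along the line, reduced modulo `L`, is
    -- one of the two terms in `circuitDist`, and reduction only makes it smaller.
    rcases le_or_gt (s + 1) (i + t * L) with h6 | h6
    · have h7 : (i + L - (s + 1) % L) % L = (i + t * L - (s + 1)) % L := by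
        change _ ≡ _ [MOD L]
        apply Nat.ModEq.add_right_cancel (Nat.mod_modEq (s + 1) L)
        rw [Nat.sub_add_cancel (by omega), Nat.sub_add_cancel h6]
        simp [Nat.ModEq]
      have h8 := Nat.mod_le (i + t * L - (s + 1)) L
      omega
    · have h7 : ((s + 1) % L + L - (i + 1)) % L = (s + 1 - (i + t * L + 1)) % L := by
        change _ ≡ _ [MOD L]
        apply Nat.ModEq.add_right_cancel (show i + 1 ≡ i + t * L + 1 [MOD L] by
          rw [add_right_comm]; simp [Nat.ModEq])
        rw [Nat.sub_add_cancel (by omega), Nat.sub_add_cancel h6]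
        simp [Nat.ModEq]
      have h8 := Nat.mod_le (s + 1 - (i + t * L + 1)) L
      omega
  calc m * hGfin.toFinset.card = (hGfin.toFinset ×ˢ Finset.range m).card := by
        rw [Finset.card_product, Finset.card_range, mul_comm]
    _ ≤ _ := by
      refine Finset.card_le_card_of_injOn (fun x => x.1 + x.2 * L) ?_ ?_
      · rintro ⟨i, t⟩ hit
        simp only [Finset.coe_product, Set.mem_prod, Finset.mem_coe, Set.Finite.mem_toFinset,
          Finset.mem_range] at hit
        obtain ⟨hi, ht⟩ := hit
        have hlt : i + t * L < m * L := by
          have : (t + 1) * L ≤ m * L := Nat.mul_le_mul_right _ ht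
          have := hi.1
          nlinarith
        simp only [goodEdges, Finset.coe_filter, Finset.mem_range, length_seg, Set.mem_ofPred_eq]
        refine ⟨hlt, ?_, ?_⟩ <;> refine goodSplit_of_legalTurns hp (by rw [length_seg]; omega) fun s x y h1 h2 hx hy => ?_
        all_goals
          have hs : s + 1 < m * L := by
            by_contra hcon
            rw [List.getElem?_eq_none (by simpa using hcon)] at hy
            simp at hy
          rw [getElem?_seg _ _ _ _ (by omega)] at hx
          rw [getElem?_seg _ _ _ _ hs] at hy
          simp only [zero_add, Option.some.injEq] at hx hy
          rw [← hx, ← hy]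
          exact hgood i hi t s (by omega) (by omega)
      · rintro ⟨i, t⟩ hit ⟨i', t'⟩ hit' h
        simp only [Finset.coe_product, Set.mem_prod, Finset.mem_coe, Set.Finite.mem_toFinset] at hit hit'
        have h1 := hit.1.1
        have h2 := hit'.1.1
        simp only at h
        have h3 := congrArg (· % L) h
        simp only [Nat.add_mul_mod_self_right, Nat.mod_eq_of_lt h1, Nat.mod_eq_of_lt h2] at h3
        subst h3
        simp only [Prod.mk.injEq, true_and]
        exact Nat.eq_of_mul_eq_mul_right hL (by omega)

end GraphMap

end Goodness

/-! ### Boundary points -/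

section BoundaryPoints

open FreeGroup

variable {A : Type*}

namespace Boundary

@[simp] lemma length_word (x : Boundary A) (n : ℕ) : (x.word n).length = n := by simp [word]

lemma word_succ (x : Boundary A) (n : ℕ) : x.word (n + 1) = x.word n ++ [x.1 n] := by
  rw [word, List.ofFn_succ', List.concat_eq_append]
  rfl

lemma word_one (x : Boundary A) : x.word 1 = [x.1 0] := by
  rw [word_succ]; rfl

lemma getElem?_word (x : Boundary A) {n k : ℕ} (h : k < n) : (x.word n)[k]? = some (x.1 k) := by
  simp [word, h]

lemma word_eq_iff {x y : Boundary A} {n : ℕ} : x.word n = y.word n ↔ ∀ i < n, x.1 i = y.1 i := by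
  constructor
  · intro h i hi
    have := congrArg (·[i]?) h
    simpa [getElem?_word _ hi] using this
  · intro h
    unfold word
    congr 1
    funext i
    exact h i i.2

lemma word_eq_of_le {x y : Boundary A} {m n : ℕ} (hmn : m ≤ n) (h : x.word n = y.word n) :
    x.word m = y.word m :=
  word_eq_iff.2 fun i hi => word_eq_iff.1 h i (hi.trans_le hmn)

lemma ext_word {x y : Boundary A} (h : ∀ n, x.word n = y.word n) : x = y :=
  Subtype.ext (funext fun i => word_eq_iff.1 (h (i + 1)) i i.lt_succ_self)

lemma isReduced_word (x : Boundary A) (n : ℕ) : FreeGroup.IsReduced (x.word n) := by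
  unfold FreeGroup.IsReduced
  rw [List.isChain_iff_getElem]
  intro i hi
  simp only [word, List.getElem_ofFn]
  exact x.2 i

lemma word_isPrefix (x : Boundary A) {m n : ℕ} (h : m ≤ n) : x.word m <+: x.word n := by
  obtain ⟨t, rfl⟩ := Nat.exists_eq_add_of_le h
  clear h
  induction t with
  | zero => exact List.prefix_rfl
  | succ t ih =>
    rw [← add_assoc, word_succ]
    exact ih.trans (List.prefix_append _ _)

lemma exists_of_words (w : ℕ → List (A × Bool)) (hlen : ∀ n, (w n).length = n)
    (hred : ∀ n, FreeGroup.IsReduced (w n)) (hpre : ∀ n, w n <+: w (n + 1)) :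
    ∃ x : Boundary A, ∀ n, x.word n = w n := by
  have hlast : ∀ n, ∃ a, w (n + 1) = w n ++ [a] := fun n => by
    obtain ⟨t, ht⟩ := hpre n
    have h1 := congrArg List.length ht
    rw [List.length_append, hlen, hlen] at h1
    obtain ⟨a, rfl⟩ := List.length_eq_one_iff.1 (show t.length = 1 by omega)
    exact ⟨a, ht.symm⟩
  choose a ha using hlast
  have hx : ∀ n, (a n).1 = (a (n + 1)).1 → (a n).2 = (a (n + 1)).2 := by
    intro n
    have h1 := hred (n + 2)
    rw [ha, ha, List.append_assoc] at h1
    have h2 := isReduced_right h1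
    unfold FreeGroup.IsReduced at h2
    simpa using h2
  let x : Boundary A := ⟨a, hx⟩
  refine ⟨x, fun n => ?_⟩
  induction n with
  | zero => exact (List.length_eq_zero_iff.1 (hlen 0)).symm
  | succ n ih => rw [x.word_succ, ih, ha]

variable [DecidableEq A]

@[simp] lemma toWord_prefix (x : Boundary A) (n : ℕ) : (x.prefix n).toWord = x.word n :=
  toWord_mk_of_isReduced (x.isReduced_word n)

end Boundary

variable [DecidableEq A]

lemma convergesTo_prefix (x : Boundary A) : ConvergesTo x.prefix x := fun k =>
  eventually_atTop.2 ⟨k, fun n hn => by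
    rw [Boundary.toWord_prefix]
    exact x.word_isPrefix hn⟩

lemma ConvergesTo.unique {g : ℕ → FreeGroup A} {x y : Boundary A} (hx : ConvergesTo g x)
    (hy : ConvergesTo g y) : x = y := by
  refine Boundary.ext_word fun k => ?_
  obtain ⟨n, h1, h2⟩ := ((hx k).and (hy k)).exists
  exact (List.prefix_of_prefix_length_le h1 h2 (by simp)).eq_of_length (by simp)

/-- The reduced words of `g` and `h` have a common prefix of length `R`. -/
def Agree (R : ℕ) (g h : FreeGroup A) : Prop :=
  ∃ l : List (A × Bool), l.length = R ∧ l <+: g.toWord ∧ l <+: h.toWord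

lemma Agree.symm {R : ℕ} {g h : FreeGroup A} (H : Agree R g h) : Agree R h g := by
  obtain ⟨l, h1, h2, h3⟩ := H
  exact ⟨l, h1, h3, h2⟩

lemma Agree.prefix_right {R : ℕ} {g h : FreeGroup A} (H : Agree R g h) {l : List (A × Bool)}
    (hl : l.length = R) (hg : l <+: g.toWord) : l <+: h.toWord := by
  obtain ⟨l', h1, h2, h3⟩ := H
  obtain rfl := (List.prefix_of_prefix_length_le hg h2 (by omega)).eq_of_length (by omega)
  exact h3

lemma Agree.trans {R : ℕ} {g h k : FreeGroup A} (H : Agree R g h) (H' : Agree R h k) :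
    Agree R g k := by
  obtain ⟨l, h1, h2, h3⟩ := H
  exact ⟨l, h1, h2, H'.prefix_right h1 h3⟩

lemma agree_self {R : ℕ} {g : FreeGroup A} (h : R ≤ g.toWord.length) : Agree R g g :=
  ⟨g.toWord.take R, by simpa using h, List.take_prefix _ _, List.take_prefix _ _⟩

/-- In the Cayley tree, a path of length at most `K` starting at depth at least `R + K` never rises
above depth `R`, so its ends share their first `R` letters. -/
lemma agree_of_dist {R K : ℕ} {g h : FreeGroup A} (hg : R + K ≤ g.toWord.length)
    (hd : (g⁻¹ * h).toWord.length ≤ K) : Agree R g h := by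
  obtain ⟨p, s, t, h1, h2, h3⟩ := exists_common_prefix g h
  rw [h3] at hd
  rw [h1] at hg
  simp only [List.length_append, length_invRev'] at hd hg
  refine ⟨p.take R, by rw [List.length_take]; omega, ?_, ?_⟩
  · rw [h1]
    exact (List.take_prefix _ _).trans (List.prefix_append _ _)
  · rw [h2]
    exact (List.take_prefix _ _).trans (List.prefix_append _ _)

variable {B : Type*} [DecidableEq B]

/-- Elements of `S` with long common prefixes have images with long common prefixes. -/
def TameOn (S : Set (FreeGroup A)) (ψ : FreeGroup A → FreeGroup B) : Prop :=
  ∀ R, ∃ R', ∀ g ∈ S, ∀ h ∈ S, Agree R' g h → Agree R (ψ g) (ψ h)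

/-- A proper map that is Lipschitz along the edges of a subtree is tame. -/
lemma tameOn_of_lipschitz {S : Set (FreeGroup A)} {ψ : FreeGroup A → FreeGroup B}
    (hS : ∀ g ∈ S, ∀ l, l <+: g.toWord → mk l ∈ S) {K : ℕ}
    (hK : ∀ g ∈ S, ∀ a, g * mk [a] ∈ S → ((ψ g)⁻¹ * ψ (g * mk [a])).toWord.length ≤ K)
    (hprop : ∀ R, ∃ R', ∀ g ∈ S, R' ≤ g.toWord.length → R ≤ (ψ g).toWord.length) :
    TameOn S ψ := by
  intro R
  obtain ⟨R', hR'⟩ := hprop (R + K)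
  -- Beyond depth `R'` all images have depth at least `R + K`, and each further letter moves the
  -- image by at most `K`, so the first `R` letters of the image are frozen.
  have key : ∀ g ∈ S, ∀ l t, l.length = R' → l ++ t <+: g.toWord →
      Agree R (ψ (mk l)) (ψ (mk (l ++ t))) := by
    intro g hg l t hl
    have hlong : ∀ t, l ++ t <+: g.toWord → R + K ≤ (ψ (mk (l ++ t))).toWord.length := by
      intro t ht
      refine hR' _ (hS g hg _ ht) ?_
      obtain ⟨s, hs⟩ := ht
      rw [toWord_mk_of_isReduced (isReduced_left (hs ▸ isReduced_toWord)), List.length_append]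
      omega
    induction t using List.reverseRecOn with
    | nil =>
      intro ht
      rw [List.append_nil]
      exact agree_self ((Nat.le_add_right _ _).trans (by simpa using hlong [] ht))
    | append_singleton t a ih =>
      intro ht
      rw [← List.append_assoc] at ht ⊢
      have ht' : l ++ t <+: g.toWord := (List.prefix_append _ _).trans ht
      refine (ih ht').trans (agree_of_dist (hlong t ht') ?_)
      rw [mk_append (l ++ t)]
      refine hK _ (hS g hg _ ht') a ?_
      rw [← mk_append]
      exact hS g hg _ ht
  refine ⟨R', fun g hg h hh hgh => ?_⟩
  obtain ⟨l, hl, ⟨s, hs⟩, ⟨t, ht⟩⟩ := hgh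
  have h1 := key g hg l s hl (hs ▸ List.prefix_rfl)
  have h2 := key h hh l t hl (ht ▸ List.prefix_rfl)
  rw [hs, mk_toWord] at h1
  rw [ht, mk_toWord] at h2
  exact h1.symm.trans h2

section Tame

variable {S : Set (FreeGroup A)} {ψ : FreeGroup A → FreeGroup B}

/-- A uniform modulus of continuity for the boundary extension, stated for arbitrary approximating
sequences in `S` so that it also serves maps defined on a subtree only. -/
lemma TameOn.exists_modulus (hψ : TameOn S ψ) : ∀ k, ∃ k', ∀ (g g' : ℕ → FreeGroup A) (x x' : Boundary A)
    (y y' : Boundary B), (∀ n, g n ∈ S) → (∀ n, g' n ∈ S) → ConvergesTo g x → ConvergesTo g' x' →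
    ConvergesTo (fun n => ψ (g n)) y → ConvergesTo (fun n => ψ (g' n)) y' →
    x.word k' = x'.word k' → y.word k = y'.word k := by
  intro k
  obtain ⟨k', hk'⟩ := hψ k
  refine ⟨k', fun g g' x x' y y' hgS hgS' hg hg' hy hy' hxx => ?_⟩
  obtain ⟨n, ⟨h1, h2⟩, h3, h4⟩ := (((hg k').and (hg' k')).and ((hy k).and (hy' k))).exists
  rw [← hxx] at h2
  have h5 := (hk' _ (hgS n) _ (hgS' n) ⟨_, by simp, h1, h2⟩).prefix_right (by simp) h3
  exact (List.prefix_of_prefix_length_le h5 h4 (by simp)).eq_of_length (by simp)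

lemma TameOn.convergesTo (hψ : TameOn S ψ) {g g' : ℕ → FreeGroup A} {x : Boundary A} {y : Boundary B}
    (hgS : ∀ n, g n ∈ S) (hgS' : ∀ n, g' n ∈ S) (hg : ConvergesTo g x) (hg' : ConvergesTo g' x)
    (hy : ConvergesTo (fun n => ψ (g n)) y) : ConvergesTo (fun n => ψ (g' n)) y := by
  intro k
  obtain ⟨k', hk'⟩ := hψ k
  filter_upwards [hg k', hg' k', hy k] with n h1 h2 h3
  exact (hk' _ (hgS n) _ (hgS' n) ⟨_, by simp, h1, h2⟩).prefix_right (by simp) h3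

/-- Tameness makes the image sequence Cauchy: its first `k` letters are constant from some index `N
k` on, and these stable prefixes fit together to an infinite word. -/
lemma TameOn.exists_convergesTo (hψ : TameOn S ψ) {g : ℕ → FreeGroup A} {x : Boundary A} (hgS : ∀ n, g n ∈ S)
    (hg : ConvergesTo g x) : ∃ y, ConvergesTo (fun n => ψ (g n)) y := by
  have h1 : ∀ k, ∃ n, ∀ m, n ≤ m → Agree k (ψ (g n)) (ψ (g m)) := by
    intro k
    obtain ⟨k', hk'⟩ := hψ k
    obtain ⟨n, hn⟩ := eventually_atTop.1 (hg k')
    exact ⟨n, fun m hm => hk' _ (hgS n) _ (hgS m) ⟨_, by simp, hn n le_rfl, hn m hm⟩⟩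
  choose N hN using h1
  have hlen : ∀ k, k ≤ (ψ (g (N k))).toWord.length := fun k => by
    obtain ⟨l, hl, h2, -⟩ := hN k _ le_rfl
    exact hl ▸ h2.length_le
  have hpre : ∀ k m, N k ≤ m → (ψ (g (N k))).toWord.take k <+: (ψ (g m)).toWord := fun k m hm =>
    (hN k m hm).prefix_right (by simpa using hlen k) (List.take_prefix _ _)
  obtain ⟨y, hy⟩ := Boundary.exists_of_words (fun k => (ψ (g (N k))).toWord.take k)
    (fun k => by simpa using hlen k)
    (fun k => by
      refine isReduced_left (v := (ψ (g (N k))).toWord.drop k) ?_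
      rw [List.take_append_drop]
      exact isReduced_toWord)
    (fun k => by
      refine List.prefix_of_prefix_length_le (hpre k (max (N k) (N (k + 1))) (le_max_left _ _))
        (hpre (k + 1) (max (N k) (N (k + 1))) (le_max_right _ _)) ?_
      have h2 := hlen k
      have h3 := hlen (k + 1)
      rw [List.length_take, List.length_take]
      omega)
  refine ⟨y, fun k => eventually_atTop.2 ⟨N k, fun m hm => ?_⟩⟩
  rw [hy]
  exact hpre k m hm

end Tame

lemma tameOn_mul_left (g : FreeGroup A) : TameOn Set.univ fun h => g * h := by
  refine tameOn_of_lipschitz (K := 1) (by simp) ?_ ?_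
  · intro h _ a _
    have : (g * h)⁻¹ * (g * (h * mk [a])) = mk [a] := by group
    rw [this]
    exact norm_mk_le
  · intro R
    refine ⟨R + g.toWord.length, fun h _ hh => ?_⟩
    have h1 := length_toWord_mul_le g⁻¹ (g * h)
    rw [inv_mul_cancel_left, length_toWord_inv] at h1
    omega

/-- Over a finite alphabet there are only finitely many short words, so an injective map is proper.
-/
lemma exists_length_le_of_injective [Finite B] {ψ : FreeGroup A → FreeGroup B}
    (hψ : Function.Injective ψ) (R : ℕ) :
    ∃ R', ∀ g, R' ≤ g.toWord.length → R ≤ (ψ g).toWord.length := by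
  have h1 : {g : FreeGroup A | (ψ g).toWord.length < R}.Finite :=
    (List.finite_length_lt (B × Bool) R).preimage (f := fun g => (ψ g).toWord)
      (fun g _ h _ hgh => hψ (toWord_injective hgh))
  obtain ⟨R', hR'⟩ := (h1.image fun g => g.toWord.length).bddAbove
  refine ⟨R' + 1, fun g hg => ?_⟩
  by_contra hcon
  have := hR' ⟨g, not_le.1 hcon, rfl⟩
  simp only at this
  omega

lemma tameOn_hom [Finite A] [Finite B] {ψ : FreeGroup A →* FreeGroup B}
    (hψ : Function.Injective ψ) : TameOn Set.univ ψ := by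
  cases nonempty_fintype A
  refine tameOn_of_lipschitz
    (K := Finset.univ.sup fun a : A × Bool => (ψ (mk [a])).toWord.length) (by simp) ?_ ?_
  · intro g _ a _
    rw [_root_.map_mul, inv_mul_cancel_left]
    exact Finset.le_sup (f := fun a : A × Bool => (ψ (mk [a])).toWord.length) (Finset.mem_univ a)
  · intro R
    obtain ⟨R', h⟩ := exists_length_le_of_injective hψ R
    exact ⟨R', fun g _ => h g⟩

/-! ### Left translation of boundary points -/

/-- The action of the free group on its boundary. -/
def lmul (g : FreeGroup A) (x : Boundary A) : Boundary A :=
  ((tameOn_mul_left g).exists_convergesTo (fun _ => Set.mem_univ _) (convergesTo_prefix x)).choose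

lemma convergesTo_lmul (g : FreeGroup A) {x : Boundary A} {h : ℕ → FreeGroup A}
    (hh : ConvergesTo h x) : ConvergesTo (fun n => g * h n) (lmul g x) :=
  (tameOn_mul_left g).convergesTo (fun _ => Set.mem_univ _) (fun _ => Set.mem_univ _)
    (convergesTo_prefix x) hh
    ((tameOn_mul_left g).exists_convergesTo (fun _ => Set.mem_univ _)
      (convergesTo_prefix x)).choose_spec

@[simp] lemma lmul_one (x : Boundary A) : lmul 1 x = x := by
  have h := convergesTo_lmul 1 (convergesTo_prefix x)
  simp only [one_mul] at h
  exact h.unique (convergesTo_prefix x)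

lemma lmul_mul (g h : FreeGroup A) (x : Boundary A) : lmul (g * h) x = lmul g (lmul h x) := by
  have h1 := convergesTo_lmul (g * h) (convergesTo_prefix x)
  have h2 := convergesTo_lmul g (convergesTo_lmul h (convergesTo_prefix x))
  simp only [mul_assoc] at h1
  exact h1.unique h2

lemma lmul_injective (g : FreeGroup A) : Function.Injective (lmul g) := fun x y h => by
  rw [← lmul_one x, ← lmul_one y, ← inv_mul_cancel g, lmul_mul, lmul_mul, h]

lemma lmul_modulus (g : FreeGroup A) (k : ℕ) :
    ∃ k', ∀ x y : Boundary A, x.word k' = y.word k' → (lmul g x).word k = (lmul g y).word k := by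
  obtain ⟨k', hk'⟩ := (tameOn_mul_left g).exists_modulus k
  exact ⟨k', fun x y h => hk' _ _ x y _ _ (fun _ => Set.mem_univ _) (fun _ => Set.mem_univ _)
    (convergesTo_prefix x) (convergesTo_prefix y) (convergesTo_lmul g (convergesTo_prefix x))
    (convergesTo_lmul g (convergesTo_prefix y)) h⟩

/-- Without cancellation, translation by `g` prepends the word of `g`. -/
lemma word_lmul {g : FreeGroup A} {x : Boundary A} (h : ∀ a ∈ g.toWord.getLast?, x.1 0 ≠ invLetter a)
    (n : ℕ) : (lmul g x).word (g.toWord.length + n) = g.toWord ++ x.word n := by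
  have h1 : ∀ m, (g * x.prefix m).toWord = g.toWord ++ x.word m := by
    intro m
    rw [toWord_mul_of_isReduced, Boundary.toWord_prefix]
    rw [Boundary.toWord_prefix, isReduced_append_iff]
    refine ⟨isReduced_toWord, x.isReduced_word m, fun a ha b hb => ?_⟩
    cases m with
    | zero => simp [Boundary.word] at hb
    | succ m =>
      rw [List.head?_eq_getElem?, Boundary.getElem?_word _ (Nat.succ_pos m),
        Option.mem_some_iff] at hb
      exact hb ▸ h a ha
  obtain ⟨m, h2, h3⟩ := (((convergesTo_lmul g (convergesTo_prefix x)) (g.toWord.length + n)).and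
    (eventually_ge_atTop n)).exists
  rw [h1] at h2
  refine (List.prefix_of_prefix_length_le h2 ?_ (by simp) : _ <+: g.toWord ++ x.word n).eq_of_length
    (by simp)
  rw [List.prefix_append_right_inj]
  exact x.word_isPrefix h3

end BoundaryPoints

/-! ### The boundary map of a marking -/

section MarkingBoundary

open FreeGroup

lemma exists_length_bound {A B : Type*} [DecidableEq A] [DecidableEq B] [Finite A]
    (ψ : FreeGroup A → FreeGroup B) (R : ℕ) :
    ∃ R', ∀ g, g.toWord.length < R → (ψ g).toWord.length < R' := by
  have h1 : {g : FreeGroup A | g.toWord.length < R}.Finite :=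
    (List.finite_length_lt (A × Bool) R).preimage toWord_injective.injOn
  obtain ⟨R', hR'⟩ := (h1.image fun g => (ψ g).toWord.length).bddAbove
  exact ⟨R' + 1, fun g hg => Nat.lt_succ_of_le (hR' ⟨g, hg, rfl⟩)⟩

variable {V E : Type*} [DecidableEq E] {Γ : OrGraph V E} {N : ℕ}

namespace Marking

variable (α : Marking Γ N)

lemma isPath_hom (x : FreeGroup (Fin N)) : Γ.IsPath α.p (α.hom x).toWord α.p :=
  (α.mem_range_iff _).1 ⟨x, rfl⟩

/-- A quasi-inverse of the marking, defined on the vertices of the universal cover. -/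
lemma exists_quasiInverse [Finite V] [Finite E] (hconn : Γ.IsConnected) :
    ∃ π : FreeGroup E → FreeGroup (Fin N), (∀ x, π (α.hom x) = x) ∧
      TameOn {g | ∃ u, Γ.IsPath α.p g.toWord u} π := by
  classical
  cases nonempty_fintype V
  -- A path back to the base point is chosen for each vertex; closing up `g` by it gives an element
  -- of `π₁`. The trivial choice at the base point makes the quasi-inverse exact on the image of the
  -- marking.
  have hτ : ∀ u, ∃ τ : FreeGroup E, Γ.IsPath u τ.toWord α.p ∧ (u = α.p → τ = 1) := by
    intro u
    by_cases h : u = α.p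
    · exact ⟨1, by simpa [OrGraph.isPath_nil] using h, fun _ => rfl⟩
    · obtain ⟨l, hl⟩ := hconn u α.p
      exact ⟨FreeGroup.mk l, hl.toWord_mk, fun h' => absurd h' h⟩
  choose τ hτp hτ1 using hτ
  have hπ : ∀ g : FreeGroup E, ∃ x, ∀ u, Γ.IsPath α.p g.toWord u → α.hom x = g * τ u := by
    intro g
    by_cases h : ∃ u, Γ.IsPath α.p g.toWord u
    · obtain ⟨u, hu⟩ := h
      obtain ⟨x, hx⟩ := (α.mem_range_iff (g * τ u)).2 (hu.mul (hτp u))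
      exact ⟨x, fun u' hu' => by rw [hx, hu.end_unique hu']⟩
    · exact ⟨1, fun u hu => absurd ⟨u, hu⟩ h⟩
  choose π hπ using hπ
  set T := Finset.univ.sup fun u => (τ u).toWord.length with hT
  have hTu : ∀ u, (τ u).toWord.length ≤ T := fun u =>
    Finset.le_sup (f := fun u => (τ u).toWord.length) (Finset.mem_univ u)
  refine ⟨π, fun x => α.injective ?_, ?_⟩
  · rw [hπ _ _ (α.isPath_hom x), hτ1 _ rfl, mul_one]
  -- Adjacent vertices yield elements of `F_N` whose quotient has marking image of length at most `2
  -- T + 1`; by properness the quotient is shorter than `K`.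
  obtain ⟨K, hK⟩ := exists_length_le_of_injective α.injective (2 * T + 2)
  refine tameOn_of_lipschitz (K := K) ?_ ?_ ?_
  · rintro g ⟨u, hu⟩ l ⟨t, ht⟩
    rw [← ht] at hu
    obtain ⟨w, hw, -⟩ := OrGraph.isPath_append.1 hu
    exact ⟨w, hw.toWord_mk⟩
  · rintro g ⟨u, hu⟩ a ⟨u', hu'⟩
    by_contra hcon
    have h1 := hK _ (not_le.1 hcon).le
    have h2 : α.hom ((π g)⁻¹ * π (g * FreeGroup.mk [a])) =
        (τ u)⁻¹ * (FreeGroup.mk [a] * τ u') := by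
      rw [_root_.map_mul, _root_.map_inv, hπ g u hu, hπ _ u' hu']
      group
    rw [h2] at h1
    have h3 := length_toWord_mul_le (τ u)⁻¹ (FreeGroup.mk [a] * τ u')
    have h4 := length_toWord_mul_le (FreeGroup.mk [a]) (τ u')
    have h5 : (FreeGroup.mk [a] : FreeGroup E).toWord.length ≤ 1 := norm_mk_le
    rw [length_toWord_inv] at h3
    have := hTu u
    have := hTu u'
    omega
  · intro R
    obtain ⟨R', hR'⟩ := exists_length_bound α.hom R
    refine ⟨R' + T, ?_⟩
    rintro g ⟨u, hu⟩ hg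
    by_contra hcon
    have h1 := hR' _ (not_le.1 hcon)
    rw [hπ g u hu] at h1
    have h2 := length_toWord_mul_le (g * τ u) (τ u)⁻¹
    rw [mul_inv_cancel_right, length_toWord_inv] at h2
    have := hTu u
    omega

variable [Finite E]

lemma tame_hom : TameOn Set.univ α.hom := tameOn_hom α.injective

/-- The map from the boundary of `F_N` to the boundary of the universal cover. -/
def bd (x : Boundary (Fin N)) : Boundary E :=
  (α.tame_hom.exists_convergesTo (fun _ => Set.mem_univ _) (convergesTo_prefix x)).choose

variable {α}

lemma convergesTo_bd {x : Boundary (Fin N)} {g : ℕ → FreeGroup (Fin N)} (hg : ConvergesTo g x) :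
    ConvergesTo (fun n => α.hom (g n)) (α.bd x) :=
  α.tame_hom.convergesTo (fun _ => Set.mem_univ _) (fun _ => Set.mem_univ _)
    (convergesTo_prefix x) hg
    (α.tame_hom.exists_convergesTo (fun _ => Set.mem_univ _) (convergesTo_prefix x)).choose_spec

variable (α)

lemma bd_modulus (k : ℕ) : ∃ k', ∀ x y : Boundary (Fin N), x.word k' = y.word k' →
    (α.bd x).word k = (α.bd y).word k := by
  obtain ⟨k', hk'⟩ := α.tame_hom.exists_modulus k
  exact ⟨k', fun x y h => hk' _ _ x y _ _ (fun _ => Set.mem_univ _) (fun _ => Set.mem_univ _)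
    (convergesTo_prefix x) (convergesTo_prefix y) (convergesTo_bd (convergesTo_prefix x))
    (convergesTo_bd (convergesTo_prefix y)) h⟩

/-- The tame quasi-inverse carries the images of the prefixes of `x` back to those prefixes, so its
modulus of continuity controls the inverse of `bd`. -/
lemma bd_modulus_inv [Finite V] (hconn : Γ.IsConnected) (k : ℕ) : ∃ k',
    ∀ x y : Boundary (Fin N), (α.bd x).word k' = (α.bd y).word k' → x.word k = y.word k := by
  obtain ⟨π, h1, h2⟩ := α.exists_quasiInverse hconn
  obtain ⟨k', hk'⟩ := h2.exists_modulus k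
  refine ⟨k', fun x y h => hk' (fun n => α.hom (x.prefix n)) (fun n => α.hom (y.prefix n)) _ _ x y
    (fun n => ⟨_, α.isPath_hom _⟩) (fun n => ⟨_, α.isPath_hom _⟩)
    (convergesTo_bd (convergesTo_prefix x)) (convergesTo_bd (convergesTo_prefix y)) ?_ ?_ h⟩
  · simpa only [h1] using convergesTo_prefix x
  · simpa only [h1] using convergesTo_prefix y

lemma bd_injective [Finite V] (hconn : Γ.IsConnected) : Function.Injective α.bd := fun x y h =>
  Boundary.ext_word fun k => by
    obtain ⟨k', hk'⟩ := α.bd_modulus_inv hconn k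
    exact hk' x y (by rw [h])

lemma exists_isPath_word_bd (x : Boundary (Fin N)) (k : ℕ) :
    ∃ u, Γ.IsPath α.p ((α.bd x).word k) u := by
  obtain ⟨n, t, ht⟩ := (convergesTo_bd (α := α) (convergesTo_prefix x) k).exists
  have h := α.isPath_hom (x.prefix n)
  rw [← ht] at h
  obtain ⟨w, hw, -⟩ := OrGraph.isPath_append.1 h
  exact ⟨w, hw⟩

end Marking

/-! ### Cylinders in boundary coordinates -/

lemma passesThrough_iff {g a b : FreeGroup E} {v : List (E × Bool)} (hv : v ≠ [])
    (hr : FreeGroup.IsReduced v) :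
    PassesThrough g v a b ↔
      v <+: (g⁻¹ * b).toWord ∧ (g⁻¹ * a).toWord.head? ≠ v.head? := by
  have e1 : a⁻¹ * b = (g⁻¹ * a)⁻¹ * (g⁻¹ * b) := by group
  have e2 : a⁻¹ * g = (g⁻¹ * a)⁻¹ := by group
  have e3 : (g * FreeGroup.mk v)⁻¹ * b = (FreeGroup.mk v)⁻¹ * (g⁻¹ * b) := by group
  rw [PassesThrough, e1, e2, e3]
  generalize g⁻¹ * a = x
  generalize g⁻¹ * b = y
  -- Seen from the vertex `g`, with `x` leading to `a` and `y` to `b`, the path runs through `v`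
  -- exactly when `y` starts with `v` and `x` leaves in another direction, which is reducedness at
  -- the junction.
  have hjunction : ∀ w, FreeGroup.IsReduced (v ++ w) →
      (FreeGroup.IsReduced (invRev x.toWord ++ (v ++ w)) ↔ x.toWord.head? ≠ v.head?) := by
    intro w hw
    obtain ⟨c, v', rfl⟩ := List.exists_cons_of_ne_nil hv
    rw [isReduced_append_iff]
    cases hx : x.toWord with
    | nil => simpa using hw
    | cons d l =>
      have hl : FreeGroup.IsReduced (invRev (d :: l)) := hx ▸ isReduced_invRev isReduced_toWord
      have : (invRev (d :: l)).getLast? = some (invLetter d) := by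
        rw [invRev_cons_eq]; simp
      have hw' : FreeGroup.IsReduced (c :: (v' ++ w)) := hw
      simp only [this, hl, hw', true_and, Option.mem_some_iff, forall_eq', List.cons_append,
        List.head?_cons, invLetter_invLetter, ne_eq, Option.some.injEq]
      exact not_congr eq_comm
  constructor
  · intro h
    set w := ((FreeGroup.mk v)⁻¹ * y).toWord with hw
    have h1 : FreeGroup.IsReduced (invRev x.toWord ++ (v ++ w)) := by
      rw [← toWord_inv, ← List.append_assoc, ← h]
      exact isReduced_toWord
    have h2 : FreeGroup.IsReduced (v ++ w) := isReduced_right h1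
    have h3 : y.toWord = v ++ w := by
      have : y = FreeGroup.mk (v ++ w) := by rw [mk_append, hw, mk_toWord]; group
      rw [this, toWord_mk_of_isReduced h2]
    exact ⟨h3 ▸ List.prefix_append _ _, (hjunction w h2).1 h1⟩
  · rintro ⟨⟨w, hw⟩, h⟩
    have h2 : FreeGroup.IsReduced (v ++ w) := hw ▸ isReduced_toWord
    have h3 : ((FreeGroup.mk v)⁻¹ * y).toWord = w := by
      have : y = FreeGroup.mk v * FreeGroup.mk w := by rw [← mk_append, hw, mk_toWord]
      rw [this, inv_mul_cancel_left, toWord_mk_of_isReduced (isReduced_right h2)]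
    rw [h3, toWord_inv, List.append_assoc, toWord_mul_of_isReduced, toWord_inv, hw]
    rw [toWord_inv, ← hw]
    exact (hjunction w h2).2 h

namespace Marking

variable [Finite E] (α : Marking Γ N)

/-- The witnesses `X`, `Y` are forced by uniqueness of limits, and for large `n` the passage
condition only involves finitely many letters of the two ends seen from `g`. -/
lemma mem_cyl_iff {g : FreeGroup E} {v : List (E × Bool)} (hv : v ≠ [])
    (hr : FreeGroup.IsReduced v) (q : DoubleBoundary N) :
    q ∈ α.cyl g v ↔ (lmul g⁻¹ (α.bd q.1.2)).word v.length = v ∧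
      some ((lmul g⁻¹ (α.bd q.1.1)).1 0) ≠ v.head? := by
  have h1 : q ∈ α.cyl g v ↔
      ∀ᶠ n in atTop, PassesThrough g v ((α.bd q.1.1).prefix n) ((α.bd q.1.2).prefix n) := by
    constructor
    · rintro ⟨X, Y, hX, hY, h⟩
      rwa [(convergesTo_bd (convergesTo_prefix q.1.1)).unique hX,
        (convergesTo_bd (convergesTo_prefix q.1.2)).unique hY]
    · intro h
      exact ⟨_, _, convergesTo_bd (convergesTo_prefix q.1.1),
        convergesTo_bd (convergesTo_prefix q.1.2), h⟩
  rw [h1]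
  set X := α.bd q.1.1
  set Y := α.bd q.1.2
  have hX := convergesTo_lmul g⁻¹ (convergesTo_prefix X) 1
  have hY := convergesTo_lmul g⁻¹ (convergesTo_prefix Y) v.length
  have h2 : ∀ᶠ n in atTop, (PassesThrough g v (X.prefix n) (Y.prefix n) ↔
      (lmul g⁻¹ Y).word v.length = v ∧ some ((lmul g⁻¹ X).1 0) ≠ v.head?) := by
    filter_upwards [hX, hY] with n h3 h4
    rw [passesThrough_iff hv hr]
    refine and_congr ⟨fun h => ?_, fun h => ?_⟩ ?_
    · exact (List.prefix_of_prefix_length_le h4 h (by simp)).eq_of_length (by simp)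
    · rwa [h] at h4
    · rw [Boundary.word_one] at h3
      obtain ⟨t, ht⟩ := h3
      rw [← ht]
      simp
  constructor
  · intro h
    obtain ⟨n, h3, h4⟩ := (h.and h2).exists
    exact h4.1 h3
  · intro h
    filter_upwards [h2] with n hn
    exact hn.2 h

end Marking

/-- The tail of a boundary point. -/
def Boundary.shift {A : Type*} (x : Boundary A) (k : ℕ) : Boundary A :=
  ⟨fun n => x.1 (k + n), fun n => x.2 (k + n)⟩

lemma Boundary.ne_invLetter {A : Type*} (x : Boundary A) (n : ℕ) :
    x.1 (n + 1) ≠ invLetter (x.1 n) := pair_reduced_iff.1 (x.2 n)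

lemma Boundary.getLast?_word_succ {A : Type*} (x : Boundary A) (n : ℕ) :
    (x.word (n + 1)).getLast? = some (x.1 n) := by
  rw [word_succ]
  simp

lemma lmul_prefix_shift (x : Boundary E) (k : ℕ) : lmul (x.prefix k) (x.shift k) = x := by
  have h0 : ∀ n, x.word (k + n) = x.word k ++ (x.shift k).word n := by
    intro n
    induction n with
    | zero => simp [Boundary.word]
    | succ n ih =>
      rw [← add_assoc, Boundary.word_succ, ih, Boundary.word_succ, List.append_assoc]
      rfl
  refine Boundary.ext_word fun n => ?_
  refine Boundary.word_eq_of_le (Nat.le_add_left n k) ?_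
  have h1 := word_lmul (g := x.prefix k) (x := x.shift k) ?_ n
  · rw [Boundary.toWord_prefix, Boundary.length_word] at h1
    rw [h1, h0]
  · cases k with
    | zero => simp [Boundary.word]
    | succ k =>
      rw [Boundary.toWord_prefix, Boundary.getLast?_word_succ]
      simp only [Option.mem_some_iff, forall_eq']
      exact x.ne_invLetter k

lemma lmul_inv_prefix (x : Boundary E) (k : ℕ) : lmul (x.prefix k)⁻¹ x = x.shift k := by
  nth_rewrite 2 [← lmul_prefix_shift x k]
  rw [← lmul_mul, inv_mul_cancel, lmul_one]

namespace Marking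

variable [Finite E] (α : Marking Γ N)

/-- Pairs of boundary points whose images begin with two given words of length `k`. -/
def rect (k : ℕ) (P Q : List (E × Bool)) : Set (DoubleBoundary N) :=
  {q | (α.bd q.1.1).word k = P ∧ (α.bd q.1.2).word k = Q}

/-- Pairs of boundary points whose images differ in the first `k` letters. -/
def sep (k : ℕ) : Set (DoubleBoundary N) := {q | (α.bd q.1.1).word k ≠ (α.bd q.1.2).word k}

/-- Every nonempty off-diagonal rectangle is a cylinder. -/
lemma exists_rect_eq_cyl (q : DoubleBoundary N) {k : ℕ} (hq : q ∈ α.sep k) :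
    ∃ (g : FreeGroup E) (v : List (E × Bool)) (u u' : V), v ≠ [] ∧ FreeGroup.IsReduced v ∧
      Γ.IsPath u v u' ∧ Γ.IsPath α.p g.toWord u ∧
      α.rect k ((α.bd q.1.1).word k) ((α.bd q.1.2).word k) = α.cyl g v := by
  set X₀ := α.bd q.1.1 with hX₀
  set Y₀ := α.bd q.1.2 with hY₀
  have hne : X₀.word k ≠ Y₀.word k := hq
  obtain ⟨u, hu⟩ := α.exists_isPath_word_bd q.1.1 k
  obtain ⟨u', hu'⟩ := α.exists_isPath_word_bd q.1.2 k
  set g := X₀.prefix k with hg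
  set h := Y₀.prefix k with hh
  have hgu : Γ.IsPath α.p g.toWord u := by rwa [hg, Boundary.toWord_prefix]
  have hhu : Γ.IsPath α.p h.toWord u' := by rwa [hh, Boundary.toWord_prefix]
  -- The path `v` joins the depth-`k` vertex on the first ray to the depth-`k` vertex on the second.
  -- Past the branch point both remainders are nonempty, having equal length and being different.
  obtain ⟨s, P, Q, h1, h2, h3⟩ := exists_common_prefix g h
  rw [hg, Boundary.toWord_prefix] at h1
  rw [hh, Boundary.toWord_prefix] at h2
  have hlen1 := congrArg List.length h1
  have hlen2 := congrArg List.length h2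
  rw [Boundary.length_word, List.length_append] at hlen1 hlen2
  obtain ⟨P', c, rfl⟩ : ∃ P' c, P = P' ++ [c] := by
    rcases List.eq_nil_or_concat P with rfl | ⟨P', c, rfl⟩
    · have : Q = [] := List.length_eq_zero_iff.1 (by simp at hlen1; omega)
      subst this
      exact absurd (h1.trans h2.symm) hne
    · exact ⟨P', c, by simp⟩
  obtain ⟨Q', d, rfl⟩ : ∃ Q' d, Q = Q' ++ [d] := by
    rcases List.eq_nil_or_concat Q with rfl | ⟨Q', d, rfl⟩
    · simp at hlen1 hlen2; omega
    · exact ⟨Q', d, by simp⟩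
  set v := (g⁻¹ * h).toWord with hv
  have hvne : v ≠ [] := by rw [h3]; simp
  have hvhead : v.head? = some (invLetter c) := by rw [h3, invRev_concat]; simp
  have hvlast : v.getLast? = some d := by rw [h3]; simp
  have hvr : FreeGroup.IsReduced v := isReduced_toWord
  have hglast : g.toWord.getLast? = some c := by rw [hg, Boundary.toWord_prefix, h1]; simp
  have hhlast : h.toWord.getLast? = some d := by rw [hh, Boundary.toWord_prefix, h2]; simp
  have hglen : g.toWord.length = k := by rw [hg, Boundary.toWord_prefix, Boundary.length_word]
  have hhlen : h.toWord.length = k := by rw [hh, Boundary.toWord_prefix, Boundary.length_word]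
  obtain ⟨k', rfl⟩ : ∃ k', k = k' + 1 := ⟨k - 1, by simp at hlen1; omega⟩
  have hlast : ∀ {X : Boundary E} {w : FreeGroup E} {e : E × Bool}, w.toWord.length = k' + 1 →
      w.toWord.getLast? = some e → X.word (k' + 1) = w.toWord → (X.shift (k' + 1)).1 0 ≠ invLetter e := by
    intro X w e _ he hX
    rw [← hX, Boundary.getLast?_word_succ, Option.some.injEq] at he
    rw [← he]
    exact X.ne_invLetter k'
  refine ⟨g, v, u, u', hvne, hvr, hgu.inv.mul hhu, hgu, ?_⟩
  ext r
  rw [α.mem_cyl_iff hvne hvr, hvhead]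
  set X := α.bd r.1.1
  set Y := α.bd r.1.2
  have hgw : X₀.word (k' + 1) = g.toWord := by rw [hg, Boundary.toWord_prefix]
  have hhw : Y₀.word (k' + 1) = h.toWord := by rw [hh, Boundary.toWord_prefix]
  change X.word (k' + 1) = X₀.word (k' + 1) ∧ Y.word (k' + 1) = Y₀.word (k' + 1) ↔ _
  have hpre : ∀ {Z : Boundary E} {w : FreeGroup E}, Z.word (k' + 1) = w.toWord →
      Z.prefix (k' + 1) = w := by
    intro Z w hZ
    rw [Boundary.prefix, hZ, mk_toWord]
  rw [hgw, hhw]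
  constructor
  · rintro ⟨e1, e2⟩
    have e3 : lmul g⁻¹ X = X.shift (k' + 1) := by
      rw [← hpre e1, lmul_inv_prefix]
    have e4 : lmul g⁻¹ Y = lmul (g⁻¹ * h) (Y.shift (k' + 1)) := by
      rw [lmul_mul, ← hpre e2, lmul_prefix_shift]
    constructor
    · rw [e4]
      have := word_lmul (g := g⁻¹ * h) (x := Y.shift (k' + 1)) ?_ 0
      · simpa [Boundary.word] using this
      · rw [← hv, hvlast]
        simp only [Option.mem_some_iff, forall_eq']
        exact hlast hhlen hhlast e2
    · rw [e3, ne_eq, Option.some.injEq]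
      exact hlast hglen hglast e1
  -- Conversely, `e2` excludes cancellation between `g` and the first end seen from `g`, so that end
  -- starts with the word of `g`. The second end is `h` followed by the tail after `v`, and no
  -- letter cancels there because the line is reduced.
  · rintro ⟨e1, e2⟩
    rw [ne_eq, Option.some.injEq] at e2
    constructor
    · have := word_lmul (g := g) (x := lmul g⁻¹ X) ?_ 0
      · rw [← lmul_mul, mul_inv_cancel, lmul_one, hglen] at this
        simpa [Boundary.word] using this
      · rw [hglast]
        simpa using e2
    · set Z := lmul g⁻¹ Y with hZ
      have e3 : Z.prefix v.length = g⁻¹ * h := by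
        rw [Boundary.prefix, e1, hv, mk_toWord]
      have e4 : Y = lmul h (Z.shift v.length) := by
        have : lmul (g⁻¹ * h) (Z.shift v.length) = Z := by rw [← e3, lmul_prefix_shift]
        rw [lmul_mul, hZ] at this
        exact (lmul_injective _ this).symm
      have := word_lmul (g := h) (x := Z.shift v.length) ?_ 0
      · rw [← e4, hhlen] at this
        simpa [Boundary.word] using this
      · rw [hhlast]
        simp only [Option.mem_some_iff, forall_eq']
        obtain ⟨n, hn⟩ : ∃ n, v.length = n + 1 :=
          ⟨v.length - 1, by have := List.length_pos_iff.2 hvne; omega⟩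
        rw [hn] at e1 ⊢
        have h5 := Z.getLast?_word_succ n
        rw [e1, hvlast, Option.some.injEq] at h5
        rw [h5]
        exact Z.ne_invLetter n

end Marking

end MarkingBoundary

/-! ### Topology of the double boundary -/

section BoundaryTopology

open FreeGroup

variable {N : ℕ}

instance : T2Space (Boundary (Fin N)) :=
  inferInstanceAs (T2Space
    {x : ℕ → Fin N × Bool // ∀ n, (x n).1 = (x (n + 1)).1 → (x n).2 = (x (n + 1)).2})

instance : SecondCountableTopology (Boundary (Fin N)) :=
  TopologicalSpace.Subtype.secondCountableTopology
    {x : ℕ → Fin N × Bool | ∀ n, (x n).1 = (x (n + 1)).1 → (x n).2 = (x (n + 1)).2}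

lemma continuous_letter (i : ℕ) : Continuous fun x : Boundary (Fin N) => x.1 i :=
  (continuous_apply i).comp continuous_subtype_val

instance : CompactSpace (Boundary (Fin N)) := by
  refine isCompact_iff_compactSpace.1 (IsClosed.isCompact (s := {x : ℕ → Fin N × Bool |
    ∀ n, (x n).1 = (x (n + 1)).1 → (x n).2 = (x (n + 1)).2}) ?_)
  have h : {x : ℕ → Fin N × Bool | ∀ n, (x n).1 = (x (n + 1)).1 → (x n).2 = (x (n + 1)).2} =
      ⋂ n, (fun x : ℕ → Fin N × Bool => (x n, x (n + 1))) ⁻¹'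
        {c | c.1.1 = c.2.1 → c.1.2 = c.2.2} := by
    ext x
    simp
  rw [h]
  refine isClosed_iInter fun n => IsClosed.preimage (by fun_prop) (isClosed_discrete _)

instance : T2Space (DoubleBoundary N) :=
  inferInstanceAs (T2Space {p : Boundary (Fin N) × Boundary (Fin N) // p.1 ≠ p.2})

instance : SecondCountableTopology (DoubleBoundary N) :=
  TopologicalSpace.Subtype.secondCountableTopology
    {p : Boundary (Fin N) × Boundary (Fin N) | p.1 ≠ p.2}

instance : LocallyCompactSpace (DoubleBoundary N) :=
  IsOpen.locallyCompactSpace (s := {p : Boundary (Fin N) × Boundary (Fin N) | p.1 ≠ p.2})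
    (isOpen_ne_fun continuous_fst continuous_snd)

lemma isLocallyConstant_word (k : ℕ) :
    IsLocallyConstant fun x : Boundary (Fin N) => x.word k := by
  rw [IsLocallyConstant.iff_exists_open]
  intro x
  refine ⟨⋂ i ∈ Finset.range k, {y | y.1 i = x.1 i}, ?_, by simp, ?_⟩
  · refine isOpen_biInter_finset fun i _ => ?_
    exact (isOpen_discrete {x.1 i}).preimage (continuous_letter i)
  · intro y hy
    rw [Boundary.word_eq_iff]
    simpa using hy

lemma isLocallyConstant_of_modulus {T : Type*} {F : Boundary (Fin N) → T}
    (h : ∃ k, ∀ x y, x.word k = y.word k → F x = F y) : IsLocallyConstant F := by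
  obtain ⟨k, hk⟩ := h
  rw [IsLocallyConstant.iff_exists_open]
  intro x
  obtain ⟨U, h1, h2, h3⟩ := (IsLocallyConstant.iff_exists_open _).1 (isLocallyConstant_word k) x
  exact ⟨U, h1, h2, fun y hy => hk _ _ (h3 y hy)⟩

lemma continuous_of_modulus {F : Boundary (Fin N) → Boundary (Fin N)}
    (h : ∀ k, ∃ k', ∀ x y, x.word k' = y.word k' → (F x).word k = (F y).word k) :
    Continuous F := by
  refine Continuous.subtype_mk (continuous_pi fun i => ?_) _
  refine IsLocallyConstant.continuous (isLocallyConstant_of_modulus ?_)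
  obtain ⟨k', hk'⟩ := h (i + 1)
  exact ⟨k', fun x y hxy => Boundary.word_eq_iff.1 (hk' x y hxy) i i.lt_succ_self⟩

/-- A set cut out by a locally constant condition that excludes the diagonal is compact open. -/
lemma isCompact_of_locallyConstant {T : Type*} {F : Boundary (Fin N) × Boundary (Fin N) → T}
    (hF : IsLocallyConstant F) {W : Set T} (hW : ∀ p, F p ∈ W → p.1 ≠ p.2) :
    IsCompact {q : DoubleBoundary N | F q.1 ∈ W} := by
  have hcl : IsClosed (F ⁻¹' W) := ⟨by simpa using hF Wᶜ⟩
  have : IsCompact ((Subtype.val : {p : Boundary (Fin N) × Boundary (Fin N) // p.1 ≠ p.2} → _) ''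
      {q | F q.1 ∈ W}) := by
    convert hcl.isCompact using 1
    ext p
    constructor
    · rintro ⟨q, hq, rfl⟩
      exact hq
    · intro hp
      exact ⟨⟨p, hW p hp⟩, hp, rfl⟩
  exact Subtype.isCompact_iff.2 this

lemma isInducing_doubleBoundary_val : IsInducing fun q : DoubleBoundary N => q.1 :=
  IsInducing.subtypeVal

lemma continuous_doubleBoundary_val : Continuous fun q : DoubleBoundary N => q.1 :=
  continuous_subtype_val

/-! ### Boundary extensions of maps of the free group -/

/-- For tame maps the default branch of `bdryMap` never occurs, and the limit may be computed along
any approximating sequence. -/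
lemma convergesTo_bdryMap {ψ : FreeGroup (Fin N) → FreeGroup (Fin N)} (hψ : TameOn Set.univ ψ)
    {g : ℕ → FreeGroup (Fin N)} {x : Boundary (Fin N)} (hg : ConvergesTo g x) :
    ConvergesTo (fun n => ψ (g n)) (bdryMap ψ x) := by
  have h : ∃ y, ConvergesTo (fun n => ψ (x.prefix n)) y :=
    hψ.exists_convergesTo (fun _ => Set.mem_univ _) (convergesTo_prefix x)
  refine hψ.convergesTo (fun _ => Set.mem_univ _) (fun _ => Set.mem_univ _)
    (convergesTo_prefix x) hg ?_
  rw [bdryMap, dif_pos h]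
  exact h.choose_spec

lemma bdryMap_mul_left (h : FreeGroup (Fin N)) : bdryMap (fun g => h * g) = lmul h := by
  funext x
  exact (convergesTo_bdryMap (tameOn_mul_left h) (convergesTo_prefix x)).unique
    (convergesTo_lmul h (convergesTo_prefix x))

lemma bdryMap_leftInverse {ψ χ : FreeGroup (Fin N) → FreeGroup (Fin N)} (hψ : TameOn Set.univ ψ)
    (hχ : TameOn Set.univ χ) (h : Function.LeftInverse χ ψ) :
    Function.LeftInverse (bdryMap χ) (bdryMap ψ) := by
  intro x
  have h1 := convergesTo_bdryMap hχ (convergesTo_bdryMap hψ (convergesTo_prefix x))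
  simp only [h _] at h1
  exact h1.unique (convergesTo_prefix x)

lemma continuous_bdryMap {ψ : FreeGroup (Fin N) → FreeGroup (Fin N)} (hψ : TameOn Set.univ ψ) :
    Continuous (bdryMap ψ) := by
  refine continuous_of_modulus fun k => ?_
  obtain ⟨k', hk'⟩ := hψ.exists_modulus k
  exact ⟨k', fun x y h => hk' _ _ x y _ _ (fun _ => Set.mem_univ _) (fun _ => Set.mem_univ _)
    (convergesTo_prefix x) (convergesTo_prefix y) (convergesTo_bdryMap hψ (convergesTo_prefix x))
    (convergesTo_bdryMap hψ (convergesTo_prefix y)) h⟩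

lemma dblMap_val {ψ : FreeGroup (Fin N) → FreeGroup (Fin N)} (h : Function.Injective (bdryMap ψ))
    (p : DoubleBoundary N) : (dblMap ψ p).1 = (bdryMap ψ p.1.1, bdryMap ψ p.1.2) := by
  have h1 : bdryMap ψ p.1.1 ≠ bdryMap ψ p.1.2 := fun h' => p.2 (h h')
  have h2 : dblMap ψ p = ⟨(bdryMap ψ p.1.1, bdryMap ψ p.1.2), h1⟩ := dif_pos h1
  rw [h2]

lemma continuous_dblMap {ψ : FreeGroup (Fin N) → FreeGroup (Fin N)} (hψ : TameOn Set.univ ψ)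
    (h : Function.Injective (bdryMap ψ)) : Continuous (dblMap ψ) := by
  rw [isInducing_doubleBoundary_val.continuous_iff]
  have : ((fun q : DoubleBoundary N => q.1) ∘ dblMap ψ) =
      fun p => (bdryMap ψ p.1.1, bdryMap ψ p.1.2) := funext fun p => dblMap_val h p
  rw [this]
  have hc := continuous_bdryMap hψ
  have hv := continuous_doubleBoundary_val (N := N)
  fun_prop

lemma continuous_flipMap : Continuous (flipMap (N := N)) := by
  rw [isInducing_doubleBoundary_val.continuous_iff]
  have hv := continuous_doubleBoundary_val (N := N)
  exact (hv.snd).prodMk hv.fst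

lemma bdryMap_mul_left_injective (h : FreeGroup (Fin N)) :
    Function.Injective (bdryMap fun g => h * g) := by
  rw [bdryMap_mul_left]
  exact lmul_injective h

lemma tameOn_mulAut (Φ : MulAut (FreeGroup (Fin N))) : TameOn Set.univ Φ :=
  tameOn_hom (ψ := Φ.toMonoidHom) Φ.injective

lemma bdryMap_mulAut_injective (Φ : MulAut (FreeGroup (Fin N))) :
    Function.Injective (bdryMap Φ) :=
  (bdryMap_leftInverse (tameOn_mulAut Φ) (tameOn_mulAut Φ.symm) Φ.symm_apply_apply).injective

/-! ### Topology of cylinders and rectangles -/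

namespace Marking

variable {V E : Type*} [DecidableEq E] [Finite E] {Γ : OrGraph V E} (α : Marking Γ N)

lemma isLocallyConstant_lmul_word_bd (g : FreeGroup E) (k : ℕ) :
    IsLocallyConstant fun x : Boundary (Fin N) => (lmul g (α.bd x)).word k := by
  obtain ⟨k₁, h₁⟩ := lmul_modulus g k
  obtain ⟨k₂, h₂⟩ := α.bd_modulus k₁
  exact isLocallyConstant_of_modulus ⟨k₂, fun x y h => h₁ _ _ (h₂ x y h)⟩

lemma isLocallyConstant_pair (g h : FreeGroup E) (k m : ℕ) :
    IsLocallyConstant fun p : Boundary (Fin N) × Boundary (Fin N) =>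
      ((lmul g (α.bd p.1)).word k, (lmul h (α.bd p.2)).word m) :=
  ((α.isLocallyConstant_lmul_word_bd g k).comp_continuous continuous_fst).prodMk
    ((α.isLocallyConstant_lmul_word_bd h m).comp_continuous continuous_snd)

/-- Membership becomes a condition on a locally constant function, from which openness and
compactness are read off. -/
lemma cyl_eq {g : FreeGroup E} {v : List (E × Bool)} (hv : v ≠ [])
    (hr : FreeGroup.IsReduced v) :
    α.cyl g v = {q : DoubleBoundary N |
      ((lmul g⁻¹ (α.bd q.1.1)).word 1, (lmul g⁻¹ (α.bd q.1.2)).word v.length) ∈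
        {w : List (E × Bool) × List (E × Bool) | w.1 ≠ v.take 1 ∧ w.2 = v}} := by
  ext q
  rw [α.mem_cyl_iff hv hr]
  obtain ⟨c, v', rfl⟩ := List.exists_cons_of_ne_nil hv
  rw [Set.mem_ofPred_eq, Set.mem_ofPred_eq, Boundary.word_one]
  simp [and_comm]

lemma isCompact_cyl {g : FreeGroup E} {v : List (E × Bool)} (hv : v ≠ [])
    (hr : FreeGroup.IsReduced v) : IsCompact (α.cyl g v) := by
  rw [α.cyl_eq hv hr]
  refine isCompact_of_locallyConstant (α.isLocallyConstant_pair g⁻¹ g⁻¹ 1 v.length) ?_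
  rintro ⟨x, y⟩ ⟨h1, h2⟩ (rfl : x = y)
  simp only at h1 h2
  apply h1
  rw [← h2]
  obtain ⟨c, v', rfl⟩ := List.exists_cons_of_ne_nil hv
  exact List.IsPrefix.eq_of_length (List.prefix_of_prefix_length_le
    (Boundary.word_isPrefix _ (by simp)) (List.take_prefix _ _) (by simp)) (by simp)

lemma isOpen_cyl {g : FreeGroup E} {v : List (E × Bool)} (hv : v ≠ [])
    (hr : FreeGroup.IsReduced v) : IsOpen (α.cyl g v) := by
  rw [α.cyl_eq hv hr]
  exact ((α.isLocallyConstant_pair g⁻¹ g⁻¹ 1 v.length).comp_continuous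
    continuous_doubleBoundary_val) _

lemma isOpen_rect (k : ℕ) (P Q : List (E × Bool)) : IsOpen (α.rect k P Q) := by
  have h := ((α.isLocallyConstant_pair 1 1 k k).comp_continuous
    continuous_doubleBoundary_val) {(P, Q)}
  simpa [rect, Set.preimage] using h

lemma isOpen_sep (k : ℕ) : IsOpen (α.sep k) := by
  have h := ((α.isLocallyConstant_pair 1 1 k k).comp_continuous
    continuous_doubleBoundary_val) {w | w.1 ≠ w.2}
  simpa [sep, Set.preimage] using h

lemma isCompact_sep (k : ℕ) : IsCompact (α.sep k) := by
  have h := isCompact_of_locallyConstant (α.isLocallyConstant_pair 1 1 k k) (W := {w | w.1 ≠ w.2})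
    (by rintro ⟨x, y⟩ h (rfl : x = y); exact h rfl)
  simpa [sep] using h

lemma sep_mono {k m : ℕ} (h : k ≤ m) : α.sep k ⊆ α.sep m := fun _ hq hq' =>
  hq (Boundary.word_eq_of_le h hq')

/-- Distinct boundary points have distinct images under `bd`, so the increasing open sets `α.sep k`
exhaust the double boundary. -/
lemma exists_subset_sep [Finite V] (hconn : Γ.IsConnected) {K : Set (DoubleBoundary N)}
    (hK : IsCompact K) : ∃ k, K ⊆ α.sep k := by
  refine hK.elim_directed_cover α.sep α.isOpen_sep ?_ ?_
  · intro q _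
    rw [Set.mem_iUnion]
    by_contra hcon
    push Not at hcon
    exact q.2 (α.bd_injective hconn (Boundary.ext_word fun k => not_not.1 (hcon k)))
  · exact directed_of_isDirected_le fun k m h => α.sep_mono h

lemma exists_word_subset [Finite V] (hconn : Γ.IsConnected) {U : Set (Boundary (Fin N))}
    (hU : IsOpen U) {x : Boundary (Fin N)} (hx : x ∈ U) :
    ∃ k, ∀ y, (α.bd y).word k = (α.bd x).word k → y ∈ U := by
  have H : ∃ k, Uᶜ ⊆ {y : Boundary (Fin N) | (α.bd y).word k ≠ (α.bd x).word k} := by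
    refine hU.isClosed_compl.isCompact.elim_directed_cover
      (fun k => {y : Boundary (Fin N) | (α.bd y).word k ≠ (α.bd x).word k}) (fun k => ?_) ?_ ?_
    · have h := α.isLocallyConstant_lmul_word_bd 1 k {(α.bd x).word k}ᶜ
      simpa [Set.preimage] using h
    · intro y hy
      rw [Set.mem_iUnion]
      by_contra hcon
      push Not at hcon
      have : y = x := α.bd_injective hconn (Boundary.ext_word fun k => not_not.1 (hcon k))
      exact hy (this ▸ hx)
    · exact directed_of_isDirected_le fun k m h y hy hy' => hy (Boundary.word_eq_of_le h hy')
  obtain ⟨k, hk⟩ := H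
  exact ⟨k, fun y hy => by_contra fun h => hk h hy⟩

/-- Rectangles of a fine enough level are small with respect to a continuous function. -/
lemma exists_level [Finite V] (hconn : Γ.IsConnected) {u : DoubleBoundary N → ℝ}
    (hu : Continuous u) (k₀ : ℕ) {ε : ℝ} (hε : 0 < ε) :
    ∃ k, k₀ ≤ k ∧ ∀ q ∈ α.sep k₀, ∀ r, (α.bd r.1.1).word k = (α.bd q.1.1).word k →
      (α.bd r.1.2).word k = (α.bd q.1.2).word k → |u r - u q| < ε := by
  have hnhd : ∀ q : DoubleBoundary N, ∃ k, ∀ r : DoubleBoundary N,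
      (α.bd r.1.1).word k = (α.bd q.1.1).word k → (α.bd r.1.2).word k = (α.bd q.1.2).word k →
        |u r - u q| < ε / 2 := by
    intro q
    have h1 : IsOpen {r | |u r - u q| < ε / 2} :=
      isOpen_lt (hu.sub continuous_const).abs continuous_const
    obtain ⟨O, hO, hOu⟩ := isInducing_doubleBoundary_val.isOpen_iff.1 h1
    have hqO : (q.1.1, q.1.2) ∈ O := by
      have : q ∈ {r | |u r - u q| < ε / 2} := by simpa using hε
      rwa [← hOu] at this
    obtain ⟨U₁, U₂, hU₁, hU₂, h2, h3, h4⟩ := isOpen_prod_iff.1 hO _ _ hqO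
    obtain ⟨k₁, hk₁⟩ := α.exists_word_subset hconn hU₁ h2
    obtain ⟨k₂, hk₂⟩ := α.exists_word_subset hconn hU₂ h3
    refine ⟨max k₁ k₂, fun r hr1 hr2 => ?_⟩
    have h5 : r ∈ (fun q : DoubleBoundary N => q.1) ⁻¹' O :=
      h4 ⟨hk₁ _ (Boundary.word_eq_of_le (le_max_left _ _) hr1),
        hk₂ _ (Boundary.word_eq_of_le (le_max_right _ _) hr2)⟩
    rwa [hOu] at h5
  choose κ hκ using hnhd
  -- Finitely many rectangles with oscillation below `ε / 2` about their centres cover. At a level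
  -- finer than all of them, `q` and `r` share such a rectangle and both are compared with its
  -- centre.
  obtain ⟨t, ht⟩ := (α.isCompact_sep k₀).elim_finite_subcover
    (fun q => α.rect (κ q) ((α.bd q.1.1).word (κ q)) ((α.bd q.1.2).word (κ q)))
    (fun q => α.isOpen_rect _ _ _) (fun q _ => Set.mem_iUnion.2 ⟨q, rfl, rfl⟩)
  refine ⟨max k₀ (t.sup κ), le_max_left _ _, fun q hq r h1 h2 => ?_⟩
  obtain ⟨p, hp, hqp⟩ := Set.mem_iUnion₂.1 (ht hq)
  have hle : κ p ≤ max k₀ (t.sup κ) := (Finset.le_sup hp).trans (le_max_right _ _)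
  have h3 := hκ p q hqp.1 hqp.2
  have h4 := hκ p r ((Boundary.word_eq_of_le hle h1).trans hqp.1)
    ((Boundary.word_eq_of_le hle h2).trans hqp.2)
  rw [abs_lt] at h3 h4 ⊢
  constructor <;> linarith

end Marking

end BoundaryTopology

/-! ### Weak convergence from convergence on cylinders -/

section WeakConvergence

open FreeGroup

namespace Marking

variable {N : ℕ} {V E : Type*} [DecidableEq E] [Finite E] {Γ : OrGraph V E} (α : Marking Γ N)

variable (E) in
/-- Pairs of distinct words of length `k`. -/
def wordPairs (k : ℕ) : Finset (List (E × Bool) × List (E × Bool)) :=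
  (((List.finite_length_eq (E × Bool) k).toFinset) ×ˢ
    ((List.finite_length_eq (E × Bool) k).toFinset)).filter fun w => w.1 ≠ w.2

lemma mem_wordPairs {k : ℕ} {w : List (E × Bool) × List (E × Bool)} :
    w ∈ wordPairs E k ↔ (w.1.length = k ∧ w.2.length = k) ∧ w.1 ≠ w.2 := by
  simp [wordPairs]

/-- The step function with value `c (P, Q)` on the rectangle of `P` and `Q`. -/
def stepFun (k : ℕ) (c : List (E × Bool) × List (E × Bool) → ℝ) (q : DoubleBoundary N) : ℝ :=
  ∑ w ∈ wordPairs E k, (α.rect k w.1 w.2).indicator (fun _ => c w) q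

lemma stepFun_of_mem {k : ℕ} (c : List (E × Bool) × List (E × Bool) → ℝ) {q : DoubleBoundary N}
    (hq : q ∈ α.sep k) : α.stepFun k c q = c ((α.bd q.1.1).word k, (α.bd q.1.2).word k) := by
  rw [stepFun, Finset.sum_eq_single ((α.bd q.1.1).word k, (α.bd q.1.2).word k)]
  · exact Set.indicator_of_mem (show q ∈ α.rect k _ _ from ⟨rfl, rfl⟩) _
  · rintro ⟨P, Q⟩ - hne
    refine Set.indicator_of_notMem (fun h => hne ?_) _
    exact Prod.ext h.1.symm h.2.symm
  · intro h
    refine absurd (mem_wordPairs.2 ⟨⟨?_, ?_⟩, ?_⟩) h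
    · exact Boundary.length_word _ _
    · exact Boundary.length_word _ _
    · exact hq

lemma stepFun_of_notMem {k : ℕ} (c : List (E × Bool) × List (E × Bool) → ℝ) {q : DoubleBoundary N}
    (hq : q ∉ α.sep k) : α.stepFun k c q = 0 := by
  refine Finset.sum_eq_zero fun w hw => Set.indicator_of_notMem (fun h => ?_) _
  have h1 := (mem_wordPairs.1 hw).2
  rw [← h.1, ← h.2] at h1
  exact hq h1

lemma rect_subset_sep {k : ℕ} {w : List (E × Bool) × List (E × Bool)} (hw : w ∈ wordPairs E k) :
    α.rect k w.1 w.2 ⊆ α.sep k := by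
  intro q hq
  have h1 := (mem_wordPairs.1 hw).2
  rw [← hq.1, ← hq.2] at h1
  exact h1

section Measure

variable (ν : Measure (DoubleBoundary N)) [IsFiniteMeasureOnCompacts ν]

lemma measure_rect_lt_top {k : ℕ} {w : List (E × Bool) × List (E × Bool)}
    (hw : w ∈ wordPairs E k) : ν (α.rect k w.1 w.2) < ∞ :=
  (measure_mono (α.rect_subset_sep hw)).trans_lt (α.isCompact_sep k).measure_lt_top

lemma integrable_stepFun (k : ℕ) (c : List (E × Bool) × List (E × Bool) → ℝ) :
    Integrable (α.stepFun k c) ν := by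
  refine integrable_finsetSum _ fun w hw => ?_
  rw [integrable_indicator_iff (α.isOpen_rect _ _ _).measurableSet]
  exact integrableOn_const (α.measure_rect_lt_top ν hw).ne

lemma integral_stepFun (k : ℕ) (c : List (E × Bool) × List (E × Bool) → ℝ) :
    ∫ q, α.stepFun k c q ∂ν = ∑ w ∈ wordPairs E k, (ν (α.rect k w.1 w.2)).toReal * c w := by
  unfold stepFun
  rw [integral_finsetSum]
  · refine Finset.sum_congr rfl fun w _ => ?_
    rw [integral_indicator_const _ (α.isOpen_rect _ _ _).measurableSet]
    rfl
  · intro w hw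
    rw [integrable_indicator_iff (α.isOpen_rect _ _ _).measurableSet]
    exact integrableOn_const (α.measure_rect_lt_top ν hw).ne

lemma measure_sep_eq (k : ℕ) :
    (ν (α.sep k)).toReal = ∑ w ∈ wordPairs E k, (ν (α.rect k w.1 w.2)).toReal := by
  have h1 := α.integral_stepFun ν k fun _ => 1
  have h2 : (α.stepFun k fun _ => 1) = (α.sep k).indicator fun _ => (1 : ℝ) := by
    funext q
    by_cases hq : q ∈ α.sep k
    · rw [α.stepFun_of_mem _ hq, Set.indicator_of_mem hq]
    · rw [α.stepFun_of_notMem _ hq, Set.indicator_of_notMem hq]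
  rw [h2, integral_indicator_const _ (α.isOpen_sep k).measurableSet] at h1
  simpa [Measure.real] using h1

/-- Integrals of a compactly supported function are approximated by finite combinations of measures
of rectangles, uniformly in the measure. -/
lemma exists_step_approx [Finite V] (hconn : Γ.IsConnected) {u : DoubleBoundary N → ℝ}
    (hu : Continuous u) {k₀ : ℕ} (hsupp : ∀ q ∉ α.sep k₀, u q = 0) {ε : ℝ} (hε : 0 < ε) :
    ∃ (k : ℕ) (c : List (E × Bool) × List (E × Bool) → ℝ),
      ∀ (ν : Measure (DoubleBoundary N)) [IsFiniteMeasureOnCompacts ν], Integrable u ν →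
        |∫ q, u q ∂ν - ∑ w ∈ wordPairs E k, (ν (α.rect k w.1 w.2)).toReal * c w| ≤
          ε * (ν (α.sep k₀)).toReal := by
  classical
  obtain ⟨k, hk, hlevel⟩ := α.exists_level hconn hu k₀ hε
  -- The coefficient is the value of `u` at a sample point of the rectangle inside `α.sep k₀`, and
  -- zero where there is none.
  let c : List (E × Bool) × List (E × Bool) → ℝ := fun w =>
    if h : ∃ q, q ∈ α.rect k w.1 w.2 ∩ α.sep k₀ then u h.choose else 0
  have hc : ∀ q, |u q - α.stepFun k c q| ≤ (α.sep k₀).indicator (fun _ => ε) q := by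
    intro q
    by_cases hq : q ∈ α.sep k₀
    · rw [α.stepFun_of_mem c (α.sep_mono hk hq), Set.indicator_of_mem hq]
      have h : ∃ r, r ∈ α.rect k ((α.bd q.1.1).word k) ((α.bd q.1.2).word k) ∩ α.sep k₀ :=
        ⟨q, ⟨rfl, rfl⟩, hq⟩
      simp only [c]
      rw [dif_pos h, abs_sub_comm]
      exact (hlevel q hq _ h.choose_spec.1.1 h.choose_spec.1.2).le
    · rw [Set.indicator_of_notMem hq, hsupp q hq]
      -- As `k₀ ≤ k`, a rectangle of level `k` lies in `α.sep k₀` or misses it. Here it misses it,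
      -- so the coefficient is zero, as is `u q`.
      by_cases hq' : q ∈ α.sep k
      · have h : ¬ ∃ r, r ∈ α.rect k ((α.bd q.1.1).word k) ((α.bd q.1.2).word k) ∩ α.sep k₀ := by
          rintro ⟨r, ⟨h1, h2⟩, h3⟩
          apply hq
          intro h4
          apply h3
          rw [Boundary.word_eq_of_le hk h1, Boundary.word_eq_of_le hk h2, h4]
        rw [α.stepFun_of_mem c hq']
        simp only [c]
        rw [dif_neg h]
        simp
      · rw [α.stepFun_of_notMem c hq']
        simp
  refine ⟨k, c, fun ν _ hint => ?_⟩
  rw [← α.integral_stepFun ν k c, ← integral_sub hint (α.integrable_stepFun ν k c)]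
  have hi : Integrable ((α.sep k₀).indicator fun _ => ε) ν := by
    rw [integrable_indicator_iff (α.isOpen_sep k₀).measurableSet]
    exact integrableOn_const (α.isCompact_sep k₀).measure_lt_top.ne
  have h1 := norm_integral_le_of_norm_le (f := fun q => u q - α.stepFun k c q) hi
    (Eventually.of_forall hc)
  rw [integral_indicator_const _ (α.isOpen_sep k₀).measurableSet, smul_eq_mul, mul_comm] at h1
  exact h1

end Measure

/-- Convergence of the measures of all cylinders implies weak convergence. -/
theorem tendsto_integral_of_tendsto_cyl [Finite V] (hconn : Γ.IsConnected) {ι : Type*}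
    {l : Filter ι} (ν : ι → Measure (DoubleBoundary N)) [∀ i, IsFiniteMeasureOnCompacts (ν i)]
    (μ : Measure (DoubleBoundary N)) [IsFiniteMeasureOnCompacts μ]
    (h : ∀ (g : FreeGroup E) (v : List (E × Bool)) (u u' : V), v ≠ [] → FreeGroup.IsReduced v →
      Γ.IsPath u v u' → Γ.IsPath α.p g.toWord u →
      Tendsto (fun i => (ν i (α.cyl g v)).toReal) l (𝓝 (μ (α.cyl g v)).toReal))
    (u : C_c(DoubleBoundary N, ℝ)) :
    Tendsto (fun i => ∫ q, u q ∂(ν i)) l (𝓝 (∫ q, u q ∂μ)) := by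
  have hrect : ∀ k, ∀ w ∈ wordPairs E k, Tendsto (fun i => (ν i (α.rect k w.1 w.2)).toReal) l
      (𝓝 (μ (α.rect k w.1 w.2)).toReal) := by
    rintro k ⟨P, Q⟩ hw
    rcases Set.eq_empty_or_nonempty (α.rect k P Q) with h0 | ⟨q, hq⟩
    · simp [h0, tendsto_const_nhds]
    · have hq' : q ∈ α.sep k := α.rect_subset_sep hw hq
      obtain ⟨g, v, x, x', h1, h2, h3, h4, h5⟩ := α.exists_rect_eq_cyl q hq'
      rw [hq.1, hq.2] at h5
      simp only [h5]
      exact h g v x x' h1 h2 h3 h4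
  obtain ⟨k₀, hk₀⟩ := α.exists_subset_sep hconn u.hasCompactSupport
  have hsupp : ∀ q ∉ α.sep k₀, u q = 0 := fun q hq => image_eq_zero_of_notMem_tsupport
    fun h' => hq (hk₀ h')
  have hsep : Tendsto (fun i => (ν i (α.sep k₀)).toReal) l (𝓝 (μ (α.sep k₀)).toReal) := by
    simp only [measure_sep_eq]
    exact tendsto_finsetSum _ (hrect k₀)
  rw [Metric.tendsto_nhds]
  intro ε hε
  set B := (μ (α.sep k₀)).toReal with hB
  have hB0 : 0 ≤ B := ENNReal.toReal_nonneg
  -- The masses of `α.sep k₀` are eventually below `B + 1`, so this tolerance costs at most `ε / 4`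
  -- for `ν i` and for `μ` alike; the step functions account for another `ε / 4`.
  obtain ⟨k, c, hkc⟩ := α.exists_step_approx (u := u) hconn (map_continuous u) hsupp
    (show 0 < ε / (4 * (B + 1)) by positivity)
  have hsum : Tendsto (fun i => ∑ w ∈ wordPairs E k, (ν i (α.rect k w.1 w.2)).toReal * c w) l
      (𝓝 (∑ w ∈ wordPairs E k, (μ (α.rect k w.1 w.2)).toReal * c w)) :=
    tendsto_finsetSum _ fun w hw => (hrect k w hw).mul_const _
  filter_upwards [Metric.tendsto_nhds.1 hsum (ε / 4) (by positivity),
    hsep.eventually_lt_const (show B < B + 1 by linarith)] with i h1 h2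
  have h3 := hkc (ν i) u.integrable
  have h4 := hkc μ u.integrable
  rw [← hB] at h4
  have h5 : ε / (4 * (B + 1)) * (ν i (α.sep k₀)).toReal ≤ ε / 4 := by
    have : ε / (4 * (B + 1)) * (ν i (α.sep k₀)).toReal ≤ ε / (4 * (B + 1)) * (B + 1) := by
      gcongr
    refine this.trans (le_of_eq ?_)
    field_simp
  have h6 : ε / (4 * (B + 1)) * B ≤ ε / 4 := by
    have : ε / (4 * (B + 1)) * B ≤ ε / (4 * (B + 1)) * (B + 1) := by
      gcongr
      linarith
    refine this.trans (le_of_eq ?_)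
    field_simp
  rw [Real.dist_eq, abs_lt] at h1 ⊢
  rw [abs_le] at h3 h4
  constructor <;> linarith

end Marking

end WeakConvergence

/-! ### Periodic lines -/

section PeriodicLines

open FreeGroup

variable {E : Type*} {L : ℕ}

/-- The periodic word `b` read backwards. -/
def revWord (b : ZMod L → E × Bool) : ZMod L → E × Bool := fun i => invLetter (b (-1 - i))

@[simp] lemma revWord_revWord (b : ZMod L → E × Bool) : revWord (revWord b) = b := by
  funext i
  simp [revWord]

lemma seg_concat (b : ZMod L → E × Bool) (i : ZMod L) (n : ℕ) :
    seg b i (n + 1) = seg b i n ++ [b (i + n)] := by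
  rw [seg_add]
  rfl

lemma invRev_seg (b : ZMod L → E × Bool) (i : ZMod L) (n : ℕ) :
    invRev (seg b i n) = seg (revWord b) (-(i + n)) n := by
  induction n generalizing i with
  | zero => rfl
  | succ n ih =>
    rw [seg, invRev_cons_eq, ih, seg_concat]
    congr 2
    · congr 1
      push_cast
      ring
    · simp only [revWord]
      congr 2
      push_cast
      ring

/-- The periodic bi-infinite word is reduced. -/
def CycReduced (b : ZMod L → E × Bool) : Prop := ∀ i, b (i + 1) ≠ invLetter (b i)

lemma CycReduced.rev {b : ZMod L → E × Bool} (hb : CycReduced b) : CycReduced (revWord b) := by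
  intro i h
  simp only [revWord, invLetter_invLetter] at h
  have h1 := hb (-1 - (i + 1))
  rw [h] at h1
  apply h1
  congr 1
  ring

/-- The ray of the periodic line that starts at the vertex `i`. -/
def fwdRay {b : ZMod L → E × Bool} (hb : CycReduced b) (i : ZMod L) : Boundary E :=
  ⟨fun n => b (i + n), fun n => by
    rw [pair_reduced_iff]
    have := hb (i + n)
    push_cast
    rwa [← add_assoc]⟩

/-- The ray of the periodic line that ends at the vertex `i`, read backwards. -/
def bwdRay {b : ZMod L → E × Bool} (hb : CycReduced b) (i : ZMod L) : Boundary E :=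
  fwdRay hb.rev (-i)

variable {b : ZMod L → E × Bool} (hb : CycReduced b)

lemma word_fwdRay (i : ZMod L) (n : ℕ) : (fwdRay hb i).word n = seg b i n := by
  induction n with
  | zero => rfl
  | succ n ih => rw [Boundary.word_succ, ih, seg_concat]; rfl

lemma isReduced_seg (hb : CycReduced b) (i : ZMod L) (n : ℕ) : FreeGroup.IsReduced (seg b i n) :=
  word_fwdRay hb i n ▸ Boundary.isReduced_word _ _

lemma bwdRay_zero (i : ZMod L) : (bwdRay hb i).1 0 = invLetter (b (i - 1)) := by
  simp only [bwdRay, fwdRay, revWord, Nat.cast_zero, add_zero]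
  congr 2
  ring

lemma fwdRay_shift (i : ZMod L) : (fwdRay hb i).shift 1 = fwdRay hb (i + 1) := by
  refine Subtype.ext (funext fun n => ?_)
  simp only [Boundary.shift, fwdRay]
  congr 1
  push_cast
  ring

lemma fwdRay_ne_bwdRay (i : ZMod L) : (fwdRay hb i).1 0 ≠ (bwdRay hb i).1 0 := by
  rw [bwdRay_zero]
  simp only [fwdRay, Nat.cast_zero, add_zero]
  simpa using hb (i - 1)

lemma inv_mk_seg : (mk (seg b 0 L))⁻¹ = mk (seg (revWord b) 0 L) := by
  rw [inv_mk, invRev_seg]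
  simp

section

variable [DecidableEq E]

lemma lmul_inv_fwdRay (i : ZMod L) : lmul (mk [b i])⁻¹ (fwdRay hb i) = fwdRay hb (i + 1) := by
  have h1 := lmul_inv_prefix (fwdRay hb i) 1
  rw [fwdRay_shift, Boundary.prefix, word_fwdRay] at h1
  exact h1

lemma lmul_inv_bwdRay (i : ZMod L) : lmul (mk [b i])⁻¹ (bwdRay hb i) = bwdRay hb (i + 1) := by
  have h1 := lmul_inv_fwdRay hb.rev (-(i + 1))
  rw [show -(i + 1) + 1 = -i by ring] at h1
  have h2 : mk [revWord b (-(i + 1))] = (mk [b i])⁻¹ := by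
    rw [inv_mk, invRev_singleton, revWord]
    congr 4
    ring
  rw [h2] at h1
  rw [bwdRay, ← h1, ← lmul_mul, mul_inv_cancel, lmul_one]
  rfl

lemma lmul_inv_seg (i : ZMod L) (n : ℕ) :
    lmul (mk (seg b i n))⁻¹ (fwdRay hb i) = fwdRay hb (i + n) ∧
      lmul (mk (seg b i n))⁻¹ (bwdRay hb i) = bwdRay hb (i + n) := by
  induction n with
  | zero => simp [seg, ← one_eq_mk]
  | succ n ih =>
    rw [seg_concat, mk_append, mul_inv_rev, lmul_mul, lmul_mul, ih.1, ih.2, lmul_inv_fwdRay,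
      lmul_inv_bwdRay]
    push_cast
    rw [add_assoc]
    exact ⟨rfl, rfl⟩

/-- A translate of a periodic line whose ends leave the base point in different directions passes
through the base point. -/
lemma exists_eq_rays (z : FreeGroup E) (j : ZMod L)
    (h : (lmul z (fwdRay hb j)).1 0 ≠ (lmul z (bwdRay hb j)).1 0) :
    ∃ i, lmul z (fwdRay hb j) = fwdRay hb i ∧ lmul z (bwdRay hb j) = bwdRay hb i := by
  induction hn : z.toWord.length generalizing z j with
  | zero =>
    obtain rfl : z = 1 := toWord_eq_nil_iff.1 (List.length_eq_zero_iff.1 hn)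
    exact ⟨j, by simp, by simp⟩
  | succ n ih =>
    obtain ⟨w, a, hw⟩ : ∃ w a, z.toWord = w ++ [a] := by
      rcases List.eq_nil_or_concat z.toWord with h0 | ⟨w, a, h0⟩
      · simp [h0] at hn
      · exact ⟨w, a, by simpa using h0⟩
    have hwr : FreeGroup.IsReduced w := isReduced_left (hw ▸ isReduced_toWord)
    have hz : z = mk w * mk [a] := by rw [← mk_append, ← hw, mk_toWord]
    have hlen : (mk w : FreeGroup E).toWord.length = n := by
      rw [toWord_mk_of_isReduced hwr]
      simpa [hw] using hn
    -- If the last letter of `z` cancels against one of the two rays, the base vertex slides one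
    -- step along the line and `z` gets shorter. If it cancels against neither, both translated rays
    -- start with the word of `z`, hence with the same letter.
    by_cases h1 : (fwdRay hb j).1 0 = invLetter a
    · have ha : mk [a] = (mk [b j])⁻¹ := by
        rw [inv_mk, invRev_singleton, show b j = invLetter a by simpa [fwdRay] using h1,
          invLetter_invLetter]
      rw [hz, lmul_mul, lmul_mul, ha, lmul_inv_fwdRay, lmul_inv_bwdRay] at h ⊢
      exact ih _ _ h hlen
    · by_cases h2 : (bwdRay hb j).1 0 = invLetter a
      · rw [bwdRay_zero] at h2
        have ha : b (j - 1) = a := invLetter_injective h2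
        have e1 := lmul_inv_fwdRay hb (j - 1)
        have e2 := lmul_inv_bwdRay hb (j - 1)
        rw [sub_add_cancel] at e1 e2
        rw [hz, lmul_mul, lmul_mul, ← e1, ← e2, ← ha, ← lmul_mul (mk [b (j - 1)]),
          ← lmul_mul (mk [b (j - 1)]), mul_inv_cancel, lmul_one, lmul_one] at h ⊢
        exact ih _ _ h hlen
      · exfalso
        apply h
        have e : ∀ x : Boundary E, x.1 0 ≠ invLetter a →
            (lmul z x).word z.toWord.length = z.toWord := by
          intro x hx
          have := word_lmul (g := z) (x := x) (by simpa [hw] using hx) 0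
          simpa [Boundary.word] using this
        exact Boundary.word_eq_iff.1 ((e _ h1).trans (e _ h2).symm) 0 (by omega)

lemma convergesTo_pow_mk [NeZero L] :
    ConvergesTo (fun n => mk (seg b 0 L) ^ n) (fwdRay hb 0) := by
  intro k
  filter_upwards [eventually_ge_atTop k] with n hn
  rw [pow_mk, ← seg_mul, toWord_mk_of_isReduced (isReduced_seg hb _ _), ← word_fwdRay hb]
  exact Boundary.word_isPrefix _ (hn.trans (Nat.le_mul_of_pos_right _ (Nat.pos_of_neZero L)))

end

/-- Translations by which the periodic word `b` is invariant. -/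
def periods (b : ZMod L → E × Bool) : Set (ZMod L) := {t | ∀ i, b (i + t) = b i}

lemma ncard_periods_pos [NeZero L] : 0 < (periods b).ncard :=
  (Set.ncard_pos (Set.toFinite _)).2 ⟨0, fun i => by simp⟩

lemma periods_revWord (b : ZMod L → E × Bool) : (periods (revWord b)).ncard = (periods b).ncard := by
  refine Set.ncard_congr (fun t _ => -t) ?_ (fun _ _ _ _ h => neg_injective h) ?_
  · intro t ht i
    have h1 := invLetter_injective (ht (-1 - i))
    rw [show -1 - (-1 - i + t) = i + -t by ring, show -1 - (-1 - i) = i by ring] at h1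
    exact h1
  · intro t ht
    refine ⟨-t, fun i => ?_, neg_neg t⟩
    have h1 := ht (-1 - i)
    rw [show -1 - i + t = -1 - (i + -t) by ring] at h1
    exact congrArg invLetter h1

/-- The chosen period `L` need not be minimal. Two positions then see the same pair of rays when
they differ by a period, and this multiplicity must be divided out when lines are counted. -/
lemma rays_eq_iff [NeZero L] (i j : ZMod L) :
    (bwdRay hb i, fwdRay hb i) = (bwdRay hb j, fwdRay hb j) ↔ i - j ∈ periods b := by
  constructor
  · intro h x
    have h1 : fwdRay hb i = fwdRay hb j := (Prod.ext_iff.1 h).2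
    have h2 := congrFun (congrArg Subtype.val h1) (x - j).val
    simp only [fwdRay, ZMod.natCast_zmod_val] at h2
    rw [show i + (x - j) = x + (i - j) by ring, show j + (x - j) = x by ring] at h2
    exact h2
  · intro h
    refine Prod.ext ?_ ?_
    · refine Subtype.ext (funext fun n => ?_)
      simp only [bwdRay, fwdRay, revWord]
      congr 1
      rw [← h (-1 - (-j + n))]
      congr 1
      ring
    · refine Subtype.ext (funext fun n => ?_)
      simp only [fwdRay]
      rw [← h (j + n)]
      congr 1
      ring

/-- A periodic line does not coincide with a reversed copy of itself. -/
lemma fwdRay_ne_rev [NeZero L] (i j : ZMod L) : fwdRay hb i ≠ fwdRay hb.rev j := by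
  intro h
  have h1 : ∀ x, b x = invLetter (b (i - 1 - j - x)) := by
    intro x
    have h2 := congrFun (congrArg Subtype.val h) (x - i).val
    simp only [fwdRay, ZMod.natCast_zmod_val, revWord] at h2
    rw [show i + (x - i) = x by ring] at h2
    rw [h2]
    congr 2
    ring
  generalize i - 1 - j = s at h1
  obtain ⟨m, rfl⟩ : ∃ m : ℕ, (m : ZMod L) = s := ⟨s.val, by simp⟩
  -- The reflection `x ↦ m - x` fixes a position if `m` is even, making a letter its own inverse. If
  -- `m` is odd it swaps two adjacent positions, making the line backtrack.
  rcases Nat.even_or_odd' m with ⟨k, rfl | rfl⟩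
  · have h2 := h1 k
    rw [show ((2 * k : ℕ) : ZMod L) - k = k by push_cast; ring] at h2
    exact invLetter_ne _ h2.symm
  · have h2 := h1 (k + 1)
    rw [show ((2 * k + 1 : ℕ) : ZMod L) - (k + 1) = k by push_cast; ring] at h2
    exact hb k h2

variable [DecidableEq E]

lemma mem_cycPositions [NeZero L] {v : List (E × Bool)} {i : ZMod L} :
    i ∈ cycPositions b v ↔ (fwdRay hb i).word v.length = v := by
  rw [word_fwdRay]
  simp [cycPositions]

/-- The number of positions of `v` in a period counts each line as often as it has periods. -/
lemma card_cycPositions [NeZero L] (v : List (E × Bool)) :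
    (cycPositions b v).card = (periods b).ncard *
      ((fun i => (bwdRay hb i, fwdRay hb i)) '' (cycPositions b v : Set (ZMod L))).ncard := by
  classical
  rw [← Finset.coe_image, Set.ncard_coe_finset, mul_comm, ← smul_eq_mul, ← Finset.sum_const,
    Finset.card_eq_sum_card_image (fun i => (bwdRay hb i, fwdRay hb i))]
  -- Each fibre of the map from positions to lines is a translate of the set of periods.
  refine Finset.sum_congr rfl fun r hr => ?_
  obtain ⟨i, hi, rfl⟩ := Finset.mem_image.1 hr
  rw [← Set.ncard_coe_finset]
  refine Set.ncard_congr (fun j _ => j - i) ?_ (fun _ _ _ _ h => sub_left_injective h) ?_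
  · intro j hj
    simp only [Finset.coe_filter, Set.mem_ofPred_eq] at hj
    exact (rays_eq_iff hb j i).1 hj.2
  · intro t ht
    have h1 := (rays_eq_iff hb (t + i) i).2 (by rwa [add_sub_cancel_right])
    refine ⟨t + i, ?_, by simp⟩
    simp only [Finset.coe_filter, Set.mem_ofPred_eq]
    refine ⟨?_, h1⟩
    rw [mem_cycPositions hb] at hi ⊢
    rwa [show fwdRay hb (t + i) = fwdRay hb i from (Prod.ext_iff.1 h1).2]

lemma card_cycPositions_rev [NeZero L] (v : List (E × Bool)) :
    (cycPositions (revWord b) v).card = (cycPositions b (invRev v)).card := by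
  refine Finset.card_bij (fun i _ => -(i + v.length)) ?_ ?_ ?_
  · intro i hi
    simp only [cycPositions, Finset.mem_filter, Finset.mem_univ, true_and] at hi ⊢
    rw [length_invRev', ← hi, length_seg, invRev_seg, revWord_revWord]
  · intro i _ j _ h
    simpa using h
  · intro j hj
    simp only [cycPositions, Finset.mem_filter, Finset.mem_univ, true_and, length_invRev'] at hj
    refine ⟨-(j + v.length), ?_, by ring⟩
    simp only [cycPositions, Finset.mem_filter, Finset.mem_univ, true_and]
    rw [← invRev_seg, hj, invRev_invRev]

end PeriodicLines

/-! ### Axes -/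

section Axes

open FreeGroup

/-- Right multiplication by `k` moves each vertex of the tree by a bounded distance, which does not
affect limits at infinity. -/
lemma ConvergesTo.mul_right {A : Type*} [DecidableEq A] {g : ℕ → FreeGroup A} {x : Boundary A}
    (hg : ConvergesTo g x) (k : FreeGroup A) : ConvergesTo (fun n => g n * k) x := by
  intro m
  filter_upwards [hg m, hg (m + k.toWord.length)] with n h1 h2
  refine (agree_of_dist (K := k.toWord.length) ?_ ?_).prefix_right (R := m) (by simp) h1
  · simpa using h2.length_le
  · rw [inv_mul_cancel_left]

lemma cycReduced_of_isCyclicallyReduced {E : Type*} {L : ℕ} [NeZero L] {b : ZMod L → E × Bool}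
    (h : IsCyclicallyReduced (seg b 0 L)) : CycReduced b := by
  -- Two copies of the period are used so that the turn from the last letter back to the first is
  -- visible.
  have hr := (h.flatten_replicate 2).isReduced
  rw [← seg_mul] at hr
  intro i
  unfold FreeGroup.IsReduced at hr
  rw [List.isChain_iff_getElem] at hr
  have hi := ZMod.val_lt i
  have h1 := hr i.val (by rw [length_seg]; omega)
  have h2 : ∀ (k : ℕ) (hk : k < (seg b 0 (2 * L)).length), (seg b 0 (2 * L))[k] = b k := by
    intro k hk
    have h3 := getElem?_seg b 0 (2 * L) k (by simpa using hk)
    rw [List.getElem?_eq_getElem hk, Option.some.injEq, zero_add] at h3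
    exact h3
  rw [h2, h2] at h1
  have h3 := pair_reduced_iff.1 h1
  push_cast at h3
  rwa [ZMod.natCast_zmod_val] at h3

variable {V E : Type*} [DecidableEq E] {Γ : OrGraph V E} {N : ℕ}

/-- A periodic line in the graph that lifts to the axis of `w` in the universal cover. -/
structure Axis (α : Marking Γ N) (w : FreeGroup (Fin N)) where
  L : ℕ
  neZero : NeZero L
  b : ZMod L → E × Bool
  cycReduced : CycReduced b
  κ : FreeGroup E
  x₀ : V
  isPath_κ : Γ.IsPath α.p κ.toWord x₀
  isPath_seg : Γ.IsPath x₀ (seg b 0 L) x₀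
  hom_eq : α.hom w = κ * FreeGroup.mk (seg b 0 L) * κ⁻¹

attribute [instance] Axis.neZero

namespace Axis

variable {α : Marking Γ N} {w : FreeGroup (Fin N)}

/-- The reduced word of `α.hom w` is a conjugate of its cyclically reduced core, and repeating the
core gives the line. The core is not required to be primitive: for a proper power the period is
simply not minimal. -/
lemma exists_axis (α : Marking Γ N) (hw : w ≠ 1) :
    ∃ A : Axis α w, seg A.b 0 A.L = α.circuit w := by
  have h1 := reduceCyclically.conj_conjugator_reduceCyclically (α.hom w).toWord
  have h2 := reduceCyclically.isCyclicallyReduced (isReduced_toWord (x := α.hom w))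
  change _ ++ α.circuit w ++ _ = _ at h1
  change IsCyclicallyReduced (α.circuit w) at h2
  set κ := reduceCyclically.conjugator (α.hom w).toWord with hκ
  have hc : α.circuit w ≠ [] := by
    intro h0
    rw [h0, List.append_nil] at h1
    apply hw
    apply α.injective
    rw [_root_.map_one, ← mk_toWord (x := α.hom w), ← h1, mk_append, ← inv_mk, mul_inv_cancel]
  have : NeZero (α.circuit w).length := ⟨by simpa using hc⟩
  obtain ⟨b, hb⟩ := exists_seg_eq hc
  have hp := α.isPath_hom w
  rw [← h1, List.append_assoc] at hp
  obtain ⟨x, hx1, hx2⟩ := OrGraph.isPath_append.1 hp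
  obtain ⟨y, hy1, hy2⟩ := OrGraph.isPath_append.1 hx2
  have hκr : FreeGroup.IsReduced κ := by
    have h3 : FreeGroup.IsReduced (α.hom w).toWord := isReduced_toWord
    rw [← h1, List.append_assoc] at h3
    exact isReduced_left h3
  have hy3 := hy2.invRev
  rw [invRev_invRev] at hy3
  obtain rfl := hx1.end_unique hy3
  refine ⟨⟨(α.circuit w).length, inferInstance, b,
    cycReduced_of_isCyclicallyReduced (hb.symm ▸ h2), FreeGroup.mk κ, x, ?_, ?_, ?_⟩, hb⟩
  · rwa [toWord_mk_of_isReduced hκr]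
  · rwa [hb]
  · rw [hb, inv_mk, ← mk_append, ← mk_append, h1, mk_toWord]

lemma isPath_seg_mul (A : Axis α w) (m : ℕ) : Γ.IsPath A.x₀ (seg A.b 0 (m * A.L)) A.x₀ := by
  induction m with
  | zero => simp [seg, OrGraph.isPath_nil]
  | succ m ih =>
    rw [Nat.succ_mul, seg_add, OrGraph.isPath_append]
    refine ⟨A.x₀, ih, ?_⟩
    simpa using A.isPath_seg

lemma exists_isPath_seg (A : Axis α w) (n : ℕ) : ∃ y, Γ.IsPath A.x₀ (seg A.b 0 n) y := by
  have h := A.isPath_seg_mul (n + 1)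
  obtain ⟨t, ht⟩ : ∃ t, (n + 1) * A.L = n + t := Nat.exists_eq_add_of_le
    ((Nat.le_succ n).trans (Nat.le_mul_of_pos_right _ (Nat.pos_of_neZero _)))
  rw [ht, seg_add, OrGraph.isPath_append] at h
  obtain ⟨y, hy, -⟩ := h
  exact ⟨y, hy⟩

/-- The axis with the opposite direction. -/
def inv (A : Axis α w) : Axis α w⁻¹ where
  L := A.L
  neZero := A.neZero
  b := revWord A.b
  cycReduced := A.cycReduced.rev
  κ := A.κ
  x₀ := A.x₀
  isPath_κ := A.isPath_κ
  isPath_seg := by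
    have h := A.isPath_seg.invRev
    rw [invRev_seg] at h
    simpa using h
  hom_eq := by
    rw [_root_.map_inv, A.hom_eq, ← inv_mk_seg]
    group

variable (A : Axis α w)

lemma hom_mul_pow (h : FreeGroup (Fin N)) (n : ℕ) :
    α.hom (h * w ^ n) = α.hom h * A.κ * FreeGroup.mk (seg A.b 0 A.L) ^ n * A.κ⁻¹ := by
  rw [_root_.map_mul, map_pow, A.hom_eq, conj_pow]
  group

lemma convergesTo_hom (h : FreeGroup (Fin N)) :
    ConvergesTo (fun n => α.hom (h * w ^ n))
      (lmul (α.hom h * A.κ) (fwdRay A.cycReduced 0)) := by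
  simp only [A.hom_mul_pow]
  exact (convergesTo_lmul _ (convergesTo_pow_mk A.cycReduced)).mul_right _

variable [Finite V] [Finite E]

/-- Convergence is visible in the graph, where powers of a cyclically reduced word form a ray; the
tame quasi-inverse of the marking carries it back to `F_N`. -/
lemma exists_convergesTo (A : Axis α w) (hconn : Γ.IsConnected) (h : FreeGroup (Fin N)) : ∃ x, ConvergesTo (fun n => h * w ^ n) x := by
  obtain ⟨π, h1, h2⟩ := α.exists_quasiInverse hconn
  obtain ⟨x, hx⟩ := h2.exists_convergesTo (fun n => ⟨_, α.isPath_hom _⟩) (A.convergesTo_hom h)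
  simp only [h1] at hx
  exact ⟨x, hx⟩

lemma convergesTo_iff (hconn : Γ.IsConnected) (h : FreeGroup (Fin N)) (x : Boundary (Fin N)) :
    ConvergesTo (fun n => h * w ^ n) x ↔
      α.bd x = lmul (α.hom h * A.κ) (fwdRay A.cycReduced 0) := by
  constructor
  · intro hx
    exact (Marking.convergesTo_bd hx).unique (A.convergesTo_hom h)
  · intro hx
    obtain ⟨y, hy⟩ := A.exists_convergesTo hconn h
    have h1 := (Marking.convergesTo_bd hy).unique (A.convergesTo_hom h)
    rwa [α.bd_injective hconn (hx.trans h1.symm)]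

lemma convergesTo_inv_iff (hconn : Γ.IsConnected) (h : FreeGroup (Fin N)) (x : Boundary (Fin N)) :
    ConvergesTo (fun n => h * w⁻¹ ^ n) x ↔
      α.bd x = lmul (α.hom h * A.κ) (bwdRay A.cycReduced 0) := by
  rw [A.inv.convergesTo_iff hconn, bwdRay, neg_zero]
  rfl

end Axis

/-- The translates of the oriented axis of `w`. -/
def orientedAxes (w : FreeGroup (Fin N)) : Set (DoubleBoundary N) :=
  {q | ∃ h : FreeGroup (Fin N), ConvergesTo (fun n => h * w⁻¹ ^ n) q.1.1 ∧
    ConvergesTo (fun n => h * w ^ n) q.1.2}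

lemma axisOrbit_eq (w : FreeGroup (Fin N)) :
    axisOrbit w = orientedAxes w ∪ orientedAxes w⁻¹ := by
  ext q
  simp only [axisOrbit, orientedAxes, Set.mem_union, Set.mem_ofPred_eq, inv_inv, ← exists_or]

namespace Axis

variable {α : Marking Γ N} {w : FreeGroup (Fin N)} (A : Axis α w)
  [Finite V] [Finite E]

lemma mem_orientedAxes_iff (hconn : Γ.IsConnected) (q : DoubleBoundary N) : q ∈ orientedAxes w ↔
    ∃ h, α.bd q.1.1 = lmul (α.hom h * A.κ) (bwdRay A.cycReduced 0) ∧
      α.bd q.1.2 = lmul (α.hom h * A.κ) (fwdRay A.cycReduced 0) :=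
  exists_congr fun h => and_congr (A.convergesTo_inv_iff hconn h _) (A.convergesTo_iff hconn h _)

/-- The endpoints in the universal cover of a line, seen from the vertex `g`. -/
def lookFrom (α : Marking Γ N) (g : FreeGroup E) (q : DoubleBoundary N) :
    Boundary E × Boundary E := (lmul g⁻¹ (α.bd q.1.1), lmul g⁻¹ (α.bd q.1.2))

/-- A line in the cylinder leaves `g` in two different directions, so it passes through `g`. As a
translate of the axis it looks from there like the periodic line at some position `i`, and `v` is
read at `i`. -/
lemma exists_rays_of_mem_cyl (hconn : Γ.IsConnected) {g : FreeGroup E} {v : List (E × Bool)} (hv : v ≠ [])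
    (hr : FreeGroup.IsReduced v) {q : DoubleBoundary N} (hq : q ∈ orientedAxes w)
    (hqc : q ∈ α.cyl g v) :
    ∃ i ∈ cycPositions A.b v,
      (bwdRay A.cycReduced i, fwdRay A.cycReduced i) = lookFrom α g q := by
  obtain ⟨h, h1, h2⟩ := (A.mem_orientedAxes_iff hconn q).1 hq
  obtain ⟨h3, h4⟩ := (α.mem_cyl_iff hv hr q).1 hqc
  obtain ⟨c, v', rfl⟩ := List.exists_cons_of_ne_nil hv
  have h5 : (lmul g⁻¹ (α.bd q.1.2)).1 0 = c := by
    have := Boundary.getElem?_word (lmul g⁻¹ (α.bd q.1.2)) (k := 0) (n := (c :: v').length) (by simp)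
    rw [h3] at this
    simpa using this.symm
  have h6 : (lmul g⁻¹ (α.bd q.1.2)).1 0 ≠ (lmul g⁻¹ (α.bd q.1.1)).1 0 := by
    rw [h5]
    intro h7
    exact h4 (by rw [← h7]; rfl)
  rw [h1, h2, ← lmul_mul, ← lmul_mul] at h6
  obtain ⟨i, h7, h8⟩ := exists_eq_rays A.cycReduced _ _ h6
  rw [lmul_mul, ← h2] at h7
  rw [lmul_mul, ← h1] at h8
  refine ⟨i, ?_, Prod.ext h8.symm h7.symm⟩
  rwa [mem_cycPositions A.cycReduced, ← h7]

lemma exists_mem_cyl_of_mem_cycPositions (hconn : Γ.IsConnected) {g : FreeGroup E} {v : List (E × Bool)} {u u' : V}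
    (hv : v ≠ []) (hr : FreeGroup.IsReduced v) (hvu : Γ.IsPath u v u')
    (hg : Γ.IsPath α.p g.toWord u) {i : ZMod A.L} (hi : i ∈ cycPositions A.b v) :
    ∃ q ∈ orientedAxes w ∩ α.cyl g v,
      lookFrom α g q = (bwdRay A.cycReduced i, fwdRay A.cycReduced i) := by
  have hiv : seg A.b i v.length = v := by simpa [cycPositions] using hi
  obtain ⟨y', hy'⟩ := A.exists_isPath_seg (i.val + v.length)
  rw [seg_add, zero_add, ZMod.natCast_zmod_val, hiv, OrGraph.isPath_append] at hy'
  obtain ⟨y, hy, hyv⟩ := hy'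
  obtain rfl : y = u := by
    obtain ⟨d, v', rfl⟩ := List.exists_cons_of_ne_nil hv
    exact hyv.1.symm.trans hvu.1
  -- The translate sought has its vertex number `i` at `g`. Since `v` is read at `i`, that vertex
  -- and `g` lie over the same vertex of the graph, so going to `g`, back along `c` and along the
  -- inverse of `κ` is a closed path, hence comes from some `h` in `F_N`.
  set c := FreeGroup.mk (seg A.b 0 i.val) with hc
  have hpath : Γ.IsPath α.p (g * (c⁻¹ * A.κ⁻¹)).toWord α.p :=
    hg.mul ((OrGraph.IsPath.toWord_mk hy).inv.mul A.isPath_κ.inv)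
  obtain ⟨h, hh⟩ := (α.mem_range_iff _).2 hpath
  have hhκ : α.hom h * A.κ = g * c⁻¹ := by rw [hh]; group
  obtain ⟨x, hx⟩ := A.inv.exists_convergesTo hconn h
  obtain ⟨z, hz⟩ := A.exists_convergesTo hconn h
  have hx' := (A.convergesTo_inv_iff hconn h x).1 hx
  have hz' := (A.convergesTo_iff hconn h z).1 hz
  obtain ⟨r1, r2⟩ := lmul_inv_seg A.cycReduced 0 i.val
  rw [zero_add, ZMod.natCast_zmod_val, ← hc] at r1 r2
  rw [hhκ, lmul_mul, r2] at hx'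
  rw [hhκ, lmul_mul, r1] at hz'
  have hne : x ≠ z := by
    rintro rfl
    rw [hx'] at hz'
    exact fwdRay_ne_bwdRay A.cycReduced i (by rw [lmul_injective g hz'])
  refine ⟨⟨(x, z), hne⟩, ⟨⟨h, hx, hz⟩, ?_⟩, ?_⟩
  · refine (α.mem_cyl_iff hv hr _).2 ?_
    change (lmul g⁻¹ (α.bd z)).word v.length = v ∧ some ((lmul g⁻¹ (α.bd x)).1 0) ≠ v.head?
    rw [hx', hz', ← lmul_mul, ← lmul_mul, inv_mul_cancel, lmul_one, lmul_one]
    have h1 := (mem_cycPositions A.cycReduced).1 hi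
    refine ⟨h1, ?_⟩
    obtain ⟨d, v', rfl⟩ := List.exists_cons_of_ne_nil hv
    have h2 := Boundary.getElem?_word (fwdRay A.cycReduced i) (k := 0) (n := (d :: v').length)
      (by simp)
    rw [h1] at h2
    rw [List.head?_eq_getElem?, h2]
    intro h3
    exact fwdRay_ne_bwdRay A.cycReduced i (Option.some.inj h3).symm
  · change (lmul g⁻¹ (α.bd x), lmul g⁻¹ (α.bd z)) = _
    rw [hx', hz', ← lmul_mul, ← lmul_mul, inv_mul_cancel, lmul_one, lmul_one]

lemma lookFrom_injective (hconn : Γ.IsConnected) (g : FreeGroup E) :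
    Function.Injective (lookFrom α g) := by
  intro q r h
  have h1 := α.bd_injective hconn (lmul_injective _ (Prod.ext_iff.1 h).1)
  have h2 := α.bd_injective hconn (lmul_injective _ (Prod.ext_iff.1 h).2)
  exact Subtype.ext (Prod.ext h1 h2)

section Count

variable {g : FreeGroup E} {v : List (E × Bool)} {u u' : V}

lemma image_lookFrom (hconn : Γ.IsConnected) (hv : v ≠ [])
    (hr : FreeGroup.IsReduced v) (hvu : Γ.IsPath u v u') (hg : Γ.IsPath α.p g.toWord u) :
    lookFrom α g '' (orientedAxes w ∩ α.cyl g v) =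
      (fun i => (bwdRay A.cycReduced i, fwdRay A.cycReduced i)) '' (cycPositions A.b v : Set _) := by
  ext r
  constructor
  · rintro ⟨q, ⟨h1, h2⟩, rfl⟩
    obtain ⟨i, hi, h3⟩ := A.exists_rays_of_mem_cyl hconn hv hr h1 h2
    exact ⟨i, hi, h3⟩
  · rintro ⟨i, hi, rfl⟩
    exact A.exists_mem_cyl_of_mem_cycPositions hconn hv hr hvu hg hi

lemma finite_orientedAxes_inter (A : Axis α w) (hconn : Γ.IsConnected) (hv : v ≠ [])
    (hr : FreeGroup.IsReduced v) (hvu : Γ.IsPath u v u') (hg : Γ.IsPath α.p g.toWord u) : (orientedAxes w ∩ α.cyl g v).Finite := by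
  refine Set.Finite.of_finite_image (f := lookFrom α g) ?_ (lookFrom_injective hconn g).injOn
  rw [A.image_lookFrom hconn hv hr hvu hg]
  exact (Finset.finite_toSet _).image _

lemma ncard_orientedAxes_inter (hconn : Γ.IsConnected) (hv : v ≠ [])
    (hr : FreeGroup.IsReduced v) (hvu : Γ.IsPath u v u') (hg : Γ.IsPath α.p g.toWord u) :
    (periods A.b).ncard * (orientedAxes w ∩ α.cyl g v).ncard = (cycPositions A.b v).card := by
  rw [← Set.ncard_image_of_injective _ (lookFrom_injective hconn g (α := α)),
    A.image_lookFrom hconn hv hr hvu hg, ← card_cycPositions]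

/-- A common line would make the axis coincide with a reversed copy of itself. Disjointness is what
lets the occurrences of `v` and of its inverse simply be added. -/
lemma disjoint_orientedAxes (A : Axis α w) (hconn : Γ.IsConnected) (hv : v ≠ []) (hr : FreeGroup.IsReduced v) :
    Disjoint (orientedAxes w ∩ α.cyl g v) (orientedAxes w⁻¹ ∩ α.cyl g v) := by
  rw [Set.disjoint_left]
  rintro q ⟨h1, h2⟩ ⟨h3, -⟩
  obtain ⟨i, -, hi⟩ := A.exists_rays_of_mem_cyl hconn hv hr h1 h2
  obtain ⟨j, -, hj⟩ := A.inv.exists_rays_of_mem_cyl hconn hv hr h3 h2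
  exact fwdRay_ne_rev A.cycReduced i j (Prod.ext_iff.1 (hi.trans hj.symm)).2

lemma finite_axisOrbit_inter (A : Axis α w) (hconn : Γ.IsConnected) (hv : v ≠ [])
    (hr : FreeGroup.IsReduced v) (hvu : Γ.IsPath u v u') (hg : Γ.IsPath α.p g.toWord u) : (axisOrbit w ∩ α.cyl g v).Finite := by
  rw [axisOrbit_eq, Set.union_inter_distrib_right]
  exact (A.finite_orientedAxes_inter hconn hv hr hvu hg).union
    (A.inv.finite_orientedAxes_inter hconn hv hr hvu hg)

lemma ncard_axisOrbit_inter (hconn : Γ.IsConnected) (hv : v ≠ [])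
    (hr : FreeGroup.IsReduced v) (hvu : Γ.IsPath u v u') (hg : Γ.IsPath α.p g.toWord u) :
    (periods A.b).ncard * (axisOrbit w ∩ α.cyl g v).ncard = cycOcc A.b v := by
  rw [axisOrbit_eq, Set.union_inter_distrib_right,
    Set.ncard_union_eq (A.disjoint_orientedAxes hconn hv hr)
      (A.finite_orientedAxes_inter hconn hv hr hvu hg)
      (A.inv.finite_orientedAxes_inter hconn hv hr hvu hg), mul_add,
    A.ncard_orientedAxes_inter hconn hv hr hvu hg, cycOcc]
  congr 1
  have h := A.inv.ncard_orientedAxes_inter hconn hv hr hvu hg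
  rw [← card_cycPositions_rev, ← periods_revWord]
  exact h

end Count

end Axis

end Axes

/-! ### Counting currents -/

section Counting

open FreeGroup

variable {N : ℕ}

/-- The reduced word of `g ^ k` contains `k` copies of the nonempty cyclically reduced core of `g`.
This makes the supremum in `exponent` a genuine one. -/
lemma bddAbove_exponents {w : FreeGroup (Fin N)} (hw : w ≠ 1) : BddAbove {k : ℕ | ∃ g, g ^ k = w} := by
  refine ⟨w.toWord.length, ?_⟩
  rintro k ⟨g, rfl⟩
  rcases Nat.eq_zero_or_pos k with rfl | hk
  · simp
  rw [toWord_pow, reduceCyclically.reduce_flatten_replicate isReduced_toWord, if_neg hk.ne']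
  have hc : reduceCyclically g.toWord ≠ [] := by
    intro h0
    have h1 := reduceCyclically.conj_conjugator_reduceCyclically g.toWord
    rw [h0, List.append_nil] at h1
    apply hw
    have : g = 1 := by
      rw [← mk_toWord (x := g), ← h1, mk_append, ← inv_mk, mul_inv_cancel]
    rw [this, one_pow]
  have h2 := List.length_pos_iff.2 hc
  simp only [List.length_append, List.length_flatten, List.map_replicate, List.sum_replicate,
    smul_eq_mul]
  have := Nat.le_mul_of_pos_right k h2
  omega

lemma exponent_pos {w : FreeGroup (Fin N)} (hw : w ≠ 1) : 0 < exponent w :=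
  Nat.one_pos.trans_le (le_csSup (bddAbove_exponents hw) ⟨w, pow_one w⟩)

lemma exponent_mulAut (Φ : MulAut (FreeGroup (Fin N))) (w : FreeGroup (Fin N)) :
    exponent (Φ w) = exponent w := by
  unfold exponent
  congr 1
  ext k
  constructor
  · rintro ⟨g, hg⟩
    exact ⟨Φ.symm g, Φ.injective (by simp [hg])⟩
  · rintro ⟨g, hg⟩
    exact ⟨Φ g, by rw [← map_pow, hg]⟩

lemma map_count_restrict {X : Type*} [MeasurableSpace X] [MeasurableSingletonClass X] {T T' : X → X}
    (hT : Measurable T) (h1 : Function.LeftInverse T' T) (h2 : Function.RightInverse T' T)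
    {O O' : Set X} (hO : Set.MapsTo T O O') (hO' : Set.MapsTo T' O' O) :
    (Measure.count.restrict O).map T = Measure.count.restrict O' := by
  ext s hs
  rw [Measure.map_apply hT hs, Measure.restrict_apply (hT hs), Measure.restrict_apply hs,
    ← Measure.count_injective_image h1.injective]
  congr 1
  ext x
  constructor
  · rintro ⟨y, ⟨hy1, hy2⟩, rfl⟩
    exact ⟨hy1, hO hy2⟩
  · rintro ⟨hx1, hx2⟩
    exact ⟨T' x, ⟨by rwa [Set.mem_preimage, h2 x], hO' hx2⟩, h2 x⟩

lemma dblMap_leftInverse {ψ χ : FreeGroup (Fin N) → FreeGroup (Fin N)} (hψ : TameOn Set.univ ψ)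
    (hχ : TameOn Set.univ χ) (h : Function.LeftInverse χ ψ) (h' : Function.LeftInverse ψ χ) :
    Function.LeftInverse (dblMap χ) (dblMap ψ) := by
  have h1 := bdryMap_leftInverse hψ hχ h
  have h2 := bdryMap_leftInverse hχ hψ h'
  intro p
  refine Subtype.ext ?_
  rw [dblMap_val h2.injective, dblMap_val h1.injective]
  exact Prod.ext (h1 _) (h1 _)

lemma mapsTo_axisOrbit {ψ : FreeGroup (Fin N) → FreeGroup (Fin N)} (hψ : TameOn Set.univ ψ)
    (hi : Function.Injective (bdryMap ψ)) {w w' : FreeGroup (Fin N)}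
    (h : ∀ k, ∃ k', ∀ n, ψ (k * w ^ n) = k' * w' ^ n ∧ ψ (k * w⁻¹ ^ n) = k' * w'⁻¹ ^ n) :
    Set.MapsTo (dblMap ψ) (axisOrbit w) (axisOrbit w') := by
  rintro p ⟨k, hk⟩
  obtain ⟨k', hk'⟩ := h k
  refine ⟨k', ?_⟩
  rw [dblMap_val hi]
  simp only [← (hk' _).1, ← (hk' _).2]
  exact hk.imp (fun hk => ⟨convergesTo_bdryMap hψ hk.1, convergesTo_bdryMap hψ hk.2⟩)
    (fun hk => ⟨convergesTo_bdryMap hψ hk.1, convergesTo_bdryMap hψ hk.2⟩)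

lemma mapsTo_axisOrbit_mul (k w : FreeGroup (Fin N)) :
    Set.MapsTo (dblMap fun g => k * g) (axisOrbit w) (axisOrbit w) :=
  mapsTo_axisOrbit (tameOn_mul_left k) (bdryMap_mul_left_injective k) fun h => ⟨k * h, fun n => by
    simp [mul_assoc]⟩

lemma mapsTo_axisOrbit_mulAut (Φ : MulAut (FreeGroup (Fin N))) (w : FreeGroup (Fin N)) :
    Set.MapsTo (dblMap Φ) (axisOrbit w) (axisOrbit (Φ w)) :=
  mapsTo_axisOrbit (tameOn_mulAut Φ) (bdryMap_mulAut_injective Φ) fun h => ⟨Φ h, fun n => by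
    simp⟩

lemma mapsTo_axisOrbit_flip (w : FreeGroup (Fin N)) :
    Set.MapsTo flipMap (axisOrbit w) (axisOrbit w) := by
  rintro p ⟨k, hk⟩
  exact ⟨k, hk.symm.imp (fun h => h.symm) (fun h => h.symm)⟩

lemma measurable_dblMap_mul (k : FreeGroup (Fin N)) : Measurable (dblMap fun g => k * g) :=
  (continuous_dblMap (tameOn_mul_left k) (bdryMap_mul_left_injective k)).measurable

lemma measurable_dblMap_mulAut (Φ : MulAut (FreeGroup (Fin N))) : Measurable (dblMap Φ) :=
  (continuous_dblMap (tameOn_mulAut Φ) (bdryMap_mulAut_injective Φ)).measurable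

lemma measurable_flipMap : Measurable (flipMap (N := N)) := continuous_flipMap.measurable

/-- Automorphisms permute the counting currents. -/
lemma autMap_countingCurrent (Φ : MulAut (FreeGroup (Fin N))) (w : FreeGroup (Fin N)) :
    autMap Φ (countingCurrent w) = countingCurrent (Φ w) := by
  rw [autMap, countingCurrent, Measure.map_smul, countingCurrent, exponent_mulAut]
  congr 1
  refine map_count_restrict (T' := dblMap Φ.symm) (measurable_dblMap_mulAut Φ)
    (dblMap_leftInverse (tameOn_mulAut Φ) (tameOn_mulAut Φ.symm) Φ.symm_apply_apply
      Φ.apply_symm_apply)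
    (dblMap_leftInverse (tameOn_mulAut Φ.symm) (tameOn_mulAut Φ) Φ.apply_symm_apply
      Φ.symm_apply_apply) (mapsTo_axisOrbit_mulAut Φ w) ?_
  have h := mapsTo_axisOrbit_mulAut Φ.symm (Φ w)
  rwa [Φ.symm_apply_apply] at h

lemma map_mul_countingCurrent (k w : FreeGroup (Fin N)) :
    (countingCurrent w).map (dblMap fun g => k * g) = countingCurrent w := by
  rw [countingCurrent, Measure.map_smul]
  congr 1
  exact map_count_restrict (T' := dblMap fun g => k⁻¹ * g) (measurable_dblMap_mul k)
    (dblMap_leftInverse (tameOn_mul_left k) (tameOn_mul_left k⁻¹) (inv_mul_cancel_left k)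
      (mul_inv_cancel_left k))
    (dblMap_leftInverse (tameOn_mul_left k⁻¹) (tameOn_mul_left k) (mul_inv_cancel_left k)
      (inv_mul_cancel_left k)) (mapsTo_axisOrbit_mul k w) (mapsTo_axisOrbit_mul k⁻¹ w)

lemma map_flip_countingCurrent (w : FreeGroup (Fin N)) :
    (countingCurrent w).map flipMap = countingCurrent w := by
  rw [countingCurrent, Measure.map_smul]
  congr 1
  exact map_count_restrict (T' := flipMap) measurable_flipMap (fun _ => rfl) (fun _ => rfl)
    (mapsTo_axisOrbit_flip w) (mapsTo_axisOrbit_flip w)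

lemma IsCurrent.smul {μ : Measure (DoubleBoundary N)} (h : IsCurrent μ) (r : ℝ≥0) :
    IsCurrent (r • μ) where
  finite_on_compacts K hK := by
    rw [Measure.smul_apply]
    exact ENNReal.mul_lt_top ENNReal.coe_lt_top (h.finite_on_compacts K hK)
  invariant k := by rw [Measure.map_smul, h.invariant]
  flip_invariant := by rw [Measure.map_smul, h.flip_invariant]

variable {V E : Type*} [DecidableEq E] [Finite V] [Finite E] {Γ : OrGraph V E}

/-- A measure that is finite on cylinders is finite on compact sets. -/
lemma Marking.measure_lt_top_of_cyl (α : Marking Γ N) (hconn : Γ.IsConnected)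
    {ν : Measure (DoubleBoundary N)}
    (h : ∀ (g : FreeGroup E) (v : List (E × Bool)) (u u' : V), v ≠ [] → FreeGroup.IsReduced v →
      Γ.IsPath u v u' → Γ.IsPath α.p g.toWord u → ν (α.cyl g v) < ∞)
    {K : Set (DoubleBoundary N)} (hK : IsCompact K) : ν K < ∞ := by
  obtain ⟨k, hk⟩ := α.exists_subset_sep hconn hK
  have h1 : K ⊆ ⋃ w ∈ wordPairs E k, α.rect k w.1 w.2 := by
    intro q hq
    refine Set.mem_biUnion (x := ((α.bd q.1.1).word k, (α.bd q.1.2).word k)) ?_ ⟨rfl, rfl⟩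
    refine mem_wordPairs.2 ⟨⟨Boundary.length_word _ _, Boundary.length_word _ _⟩, hk hq⟩
  refine (measure_mono h1).trans_lt (measure_biUnion_lt_top (Finset.finite_toSet _) ?_)
  rintro ⟨P, Q⟩ hw
  rcases Set.eq_empty_or_nonempty (α.rect k P Q) with h0 | ⟨q, hq⟩
  · simp [h0]
  · have hq' : q ∈ α.sep k := α.rect_subset_sep hw hq
    obtain ⟨g, v, x, x', h1, h2, h3, h4, h5⟩ := α.exists_rect_eq_cyl q hq'
    rw [hq.1, hq.2] at h5
    simp only [h5]
    exact h g v x x' h1 h2 h3 h4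

namespace Axis

variable {α : Marking Γ N} {w : FreeGroup (Fin N)}

lemma countingCurrent_cyl (A : Axis α w) (hconn : Γ.IsConnected) {g : FreeGroup E} {v : List (E × Bool)}
    {u u' : V} (hv : v ≠ []) (hr : FreeGroup.IsReduced v) (hvu : Γ.IsPath u v u')
    (hg : Γ.IsPath α.p g.toWord u) :
    countingCurrent w (α.cyl g v) = exponent w * (axisOrbit w ∩ α.cyl g v).ncard := by
  have hfin := A.finite_axisOrbit_inter hconn hv hr hvu hg
  rw [countingCurrent, Measure.smul_apply, Measure.restrict_apply (α.isOpen_cyl hv hr).measurableSet,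
    Set.inter_comm, Measure.count_apply_finite _ hfin, smul_eq_mul,
    Set.ncard_eq_toFinset_card _ hfin]

/-- The measures of cylinders count, up to a common factor, occurrences in the period. -/
lemma toReal_countingCurrent_cyl (A : Axis α w) (hconn : Γ.IsConnected) {g : FreeGroup E}
    {v : List (E × Bool)} {u u' : V} (hv : v ≠ []) (hr : FreeGroup.IsReduced v)
    (hvu : Γ.IsPath u v u') (hg : Γ.IsPath α.p g.toWord u) :
    (countingCurrent w (α.cyl g v)).toReal =
      (exponent w / (periods A.b).ncard : ℝ≥0) * cycOcc A.b v := by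
  -- The exponent and the number of periods need not be compared: their quotient does not depend on
  -- `v` and vanishes from the projective class.
  have h1 := A.ncard_axisOrbit_inter hconn hv hr hvu hg
  have h2 : ((periods A.b).ncard : ℝ) ≠ 0 := by
    exact_mod_cast (ncard_periods_pos (b := A.b)).ne'
  rw [A.countingCurrent_cyl hconn hv hr hvu hg, ← h1]
  simp only [ENNReal.toReal_mul, ENNReal.toReal_natCast]
  push_cast
  field_simp

lemma isCurrent_countingCurrent (A : Axis α w) (hconn : Γ.IsConnected) :
    IsCurrent (countingCurrent w) where
  finite_on_compacts K hK := by
    refine α.measure_lt_top_of_cyl hconn (fun g v u u' hv hr hvu hg => ?_) hK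
    rw [A.countingCurrent_cyl hconn hv hr hvu hg]
    exact ENNReal.mul_lt_top (ENNReal.natCast_lt_top _) (ENNReal.natCast_lt_top _)
  invariant k := map_mul_countingCurrent k w
  flip_invariant := map_flip_countingCurrent w

lemma countingCurrent_ne_zero (A : Axis α w) (hconn : Γ.IsConnected) (hw : w ≠ 1) :
    countingCurrent w ≠ 0 := by
  obtain ⟨x, hx⟩ := A.inv.exists_convergesTo hconn 1
  obtain ⟨z, hz⟩ := A.exists_convergesTo hconn 1
  have hne : x ≠ z := by
    rintro rfl
    have h1 := (A.convergesTo_inv_iff hconn 1 x).1 hx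
    have h2 := (A.convergesTo_iff hconn 1 x).1 hz
    have h3 := lmul_injective _ (h1.symm.trans h2)
    exact fwdRay_ne_bwdRay A.cycReduced 0 (by rw [h3])
  have hq : (axisOrbit w).Nonempty := ⟨⟨(x, z), hne⟩, 1, Or.inl ⟨hx, hz⟩⟩
  intro h0
  have h1 := congrArg (fun μ : Measure (DoubleBoundary N) => μ Set.univ) h0
  simp only [countingCurrent, Measure.smul_apply, Measure.restrict_apply_univ, smul_eq_mul,
    Measure.coe_zero, Pi.zero_apply, mul_eq_zero, Nat.cast_eq_zero] at h1
  rcases h1 with h1 | h1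
  · exact (exponent_pos hw).ne' h1
  · exact Measure.count_ne_zero hq h1

end Axis

end Counting

/-! ### Iterating the automorphism on good conjugacy classes -/

section Iteration

open FreeGroup

variable {N : ℕ} {V E : Type*} [DecidableEq E] {Γ : OrGraph V E} {α : Marking Γ N}
  {f : GraphMap Γ} {Φ : MulAut (FreeGroup (Fin N))}

/-- The changes of base point made at the successive iterations multiply up to a single conjugator.
-/
lemma GraphMap.Determines.pow (hf : f.Determines α Φ) (n : ℕ) :
    ∃ ρ : FreeGroup E, ∀ x, α.hom ((Φ ^ n) x) = ρ * f.hom^[n] (α.hom x) * ρ⁻¹ := by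
  obtain ⟨ρ, -, hρ⟩ := hf
  induction n with
  | zero => exact ⟨1, fun x => by simp⟩
  | succ n ih =>
    obtain ⟨σ, hσ⟩ := ih
    refine ⟨ρ * f.hom σ, fun x => ?_⟩
    rw [pow_succ', MulAut.mul_apply, hρ, hσ, Function.iterate_succ_apply', _root_.map_mul,
      _root_.map_mul, _root_.map_inv]
    group

namespace Axis

variable {w : FreeGroup (Fin N)}

/-- The scale factor that turns the counting current into frequencies. -/
def scale (A : Axis α w) : ℝ≥0 := (exponent w / (periods A.b).ncard * A.L)⁻¹

lemma scale_pos (A : Axis α w) (hw : w ≠ 1) : 0 < A.scale := by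
  have h1 : (0 : ℝ≥0) < exponent w := by exact_mod_cast exponent_pos hw
  have h2 : (0 : ℝ≥0) < (periods A.b).ncard := by exact_mod_cast ncard_periods_pos
  have h3 : (0 : ℝ≥0) < A.L := by exact_mod_cast Nat.pos_of_neZero A.L
  unfold scale
  positivity

lemma toReal_scale_smul_cyl [Finite V] [Finite E] (A : Axis α w) (hw : w ≠ 1)
    (hconn : Γ.IsConnected) {g : FreeGroup E} {v : List (E × Bool)} {u u' : V} (hv : v ≠ [])
    (hr : FreeGroup.IsReduced v) (hvu : Γ.IsPath u v u') (hg : Γ.IsPath α.p g.toWord u) :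
    ((A.scale • countingCurrent w) (α.cyl g v)).toReal = cycOcc A.b v / A.L := by
  have h1 : (0 : ℝ) < exponent w := by exact_mod_cast exponent_pos hw
  have h2 : (0 : ℝ) < (periods A.b).ncard := by exact_mod_cast ncard_periods_pos
  have h3 : (0 : ℝ) < A.L := by exact_mod_cast Nat.pos_of_neZero A.L
  rw [Measure.smul_apply, ENNReal.smul_def, smul_eq_mul, ENNReal.toReal_mul,
    A.toReal_countingCurrent_cyl hconn hv hr hvu hg, ENNReal.coe_toReal, scale]
  push_cast
  field_simp

/-- The iterates of conjugacy classes of definite goodness have almost the right frequencies. -/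
lemma exists_uniform_cycOcc [Finite E] (hf : f.Determines α Φ) (htt : f.IsTrainTrack) {L C : ℝ}
    (hL : 1 < L) (hexp : f.ExpandsLegal L) (hC : f.IsBoundedCancellation C)
    {v : List (E × Bool)} (hv : v ≠ []) {a : ℝ} (ha : 0 ≤ a)
    (hfreq : ∀ e : E × Bool, Tendsto (fun n : ℕ =>
      (occSymm v (f.map^[n] [e]) : ℝ) / (f.map^[n] [e]).length) atTop (𝓝 a))
    {δ ε : ℝ} (hδ : 0 < δ) (hε : 0 < ε) :
    ∃ M : ℕ, ∀ (w : FreeGroup (Fin N)) (A : Axis α w),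
      δ * A.L ≤ {i : ℕ | i < A.L ∧ f.GoodEdge (C / (L - 1)) (seg A.b 0 A.L) i}.ncard →
        ∀ n, M ≤ n → ∀ A' : Axis α ((Φ ^ n) w), |(cycOcc A'.b v : ℝ) - a * A'.L| ≤ ε * A'.L := by
  have : Nonempty V := ⟨α.p⟩
  obtain ⟨M, hM⟩ := GraphMap.exists_uniform_frequency htt hL hexp hC hv ha hfreq hδ hε
  refine ⟨M, fun w A hA n hn A' => ?_⟩
  obtain ⟨ρ, hρ⟩ := hf.pow n
  set σ := ρ * f.hom^[n] A.κ with hσ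
  -- The circuit of the iterate is conjugate to the image of the original circuit under `f^n`. The
  -- conjugator may depend on `n` and on the class, since it drops out on passing to high powers.
  have key : σ⁻¹ * A'.κ * FreeGroup.mk (seg A'.b 0 A'.L) * (σ⁻¹ * A'.κ)⁻¹ =
      f.hom^[n] (FreeGroup.mk (seg A.b 0 A.L)) := by
    have h1 := hρ w
    rw [A'.hom_eq, A.hom_eq, iterate_map_mul f.hom, iterate_map_mul f.hom, iterate_map_inv f.hom] at h1
    have h2 : σ⁻¹ * A'.κ * FreeGroup.mk (seg A'.b 0 A'.L) * (σ⁻¹ * A'.κ)⁻¹ =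
        σ⁻¹ * (A'.κ * FreeGroup.mk (seg A'.b 0 A'.L) * A'.κ⁻¹) * σ := by group
    rw [h2, h1, hσ]
    group
  refine abs_cycOcc_sub_le A'.b hv ha hε.le (fun m => isReduced_seg A'.cycReduced _ _)
    (σ⁻¹ * A'.κ) fun m => ?_
  -- The `m`-th power is the tightened image of the `m`-fold unrolled circuit, to which the uniform
  -- estimate for paths applies with an `M` independent of `m`.
  have h3 : ((σ⁻¹ * A'.κ * FreeGroup.mk (seg A'.b 0 A'.L) * (σ⁻¹ * A'.κ)⁻¹) ^ m).toWord =
      f.tight n (seg A.b 0 (m * A.L)) := by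
    rw [key, GraphMap.tight_eq, seg_mul, ← pow_mk, iterate_map_pow f.hom]
  rw [h3]
  have hp : Γ.IsEdgePath (seg A.b 0 (m * A.L)) := ⟨_, _, A.isPath_seg_mul m⟩
  refine hM _ hp (isReduced_seg A.cycReduced _ _) ?_ n hn
  have h4 := GraphMap.card_goodEdges_ge (f := f) (C := C / (L - 1)) A.b m hp
  have h5 : (m : ℝ) * {i : ℕ | i < A.L ∧ f.GoodEdge (C / (L - 1)) (seg A.b 0 A.L) i}.ncard ≤
      (f.goodEdges ⌈C / (L - 1)⌉₊ (seg A.b 0 (m * A.L))).card := by exact_mod_cast h4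
  refine le_trans ?_ h5
  rw [length_seg]
  push_cast
  have h6 := mul_le_mul_of_nonneg_left hA (Nat.cast_nonneg (α := ℝ) m)
  linarith

lemma goodness_mul (A : Axis α w) (hA : seg A.b 0 A.L = α.circuit w) (C L : ℝ) :
    goodness α f C L w * A.L =
      {i : ℕ | i < A.L ∧ f.GoodEdge (C / (L - 1)) (seg A.b 0 A.L) i}.ncard := by
  have h3 : (A.L : ℝ) ≠ 0 := by exact_mod_cast (NeZero.ne A.L)
  rw [goodness, ← hA, GraphMap.circuitGoodness, length_seg, div_mul_cancel₀ _ h3]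

/-- The measures of a cylinder converge, uniformly over classes of definite goodness. -/
lemma tendsto_scale_smul_cyl [Finite V] [Finite E] (hconn : Γ.IsConnected)
    (hf : f.Determines α Φ) (htt : f.IsTrainTrack) {L C : ℝ}
    (hL : 1 < L) (hexp : f.ExpandsLegal L) (hC : f.IsBoundedCancellation C) {δ : ℝ} (hδ : 0 < δ)
    {ι : Type*} {w : ι → FreeGroup (Fin N)} (hw : ∀ i, w i ≠ 1) (A : ∀ i, Axis α (w i))
    (hA : ∀ i, δ * (A i).L ≤
      {k : ℕ | k < (A i).L ∧ f.GoodEdge (C / (L - 1)) (seg (A i).b 0 (A i).L) k}.ncard)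
    (B : ∀ p : ι × ℕ, Axis α ((Φ ^ p.2) (w p.1)))
    {g : FreeGroup E} {v : List (E × Bool)} {u u' : V} (hv : v ≠ [])
    (hr : FreeGroup.IsReduced v) (hvu : Γ.IsPath u v u') (hg : Γ.IsPath α.p g.toWord u) {a : ℝ}
    (ha : 0 ≤ a) (hfreq : ∀ e : E × Bool, Tendsto (fun n : ℕ =>
      (occSymm v (f.map^[n] [e]) : ℝ) / (f.map^[n] [e]).length) atTop (𝓝 a)) :
    Tendsto (fun p : ι × ℕ =>
      (((B p).scale • countingCurrent ((Φ ^ p.2) (w p.1))) (α.cyl g v)).toReal)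
      (comap Prod.snd atTop) (𝓝 a) := by
  rw [Metric.tendsto_nhds]
  intro ε hε
  obtain ⟨M, hM⟩ := exists_uniform_cycOcc hf htt hL hexp hC hv ha hfreq hδ (half_pos hε)
  -- The filter sees only the exponent `p.2`, so convergence along it is convergence uniform in the
  -- class `p.1`.
  filter_upwards [preimage_mem_comap (eventually_ge_atTop M)] with p hp
  have h1 := hM (w p.1) (A p.1) (hA p.1) p.2 hp (B p)
  have hne : (Φ ^ p.2) (w p.1) ≠ 1 := by simpa using hw p.1
  rw [(B p).toReal_scale_smul_cyl hne hconn hv hr hvu hg, Real.dist_eq]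
  have h3 : (0 : ℝ) < (B p).L := by exact_mod_cast Nat.pos_of_neZero (B p).L
  have h4 : (cycOcc (B p).b v : ℝ) / (B p).L - a =
      (cycOcc (B p).b v - a * (B p).L) / (B p).L := by field_simp
  rw [h4, abs_div, abs_of_pos h3, div_lt_iff₀ h3]
  nlinarith

end Axis

lemma NonzeroCurrent.tendsto_iff {ι : Type*} {l : Filter ι} {ν : ι → NonzeroCurrent N}
    {μ : NonzeroCurrent N} : Tendsto ν l (𝓝 μ) ↔
      ∀ u : C_c(DoubleBoundary N, ℝ), Tendsto (fun i => ∫ p, u p ∂(ν i).1) l (𝓝 (∫ p, u p ∂μ.1)) := by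
  rw [nhds_induced, tendsto_comap_iff, tendsto_pi_nhds]
  rfl

lemma IsCurrent.isFiniteMeasureOnCompacts {μ : Measure (DoubleBoundary N)} (h : IsCurrent μ) :
    IsFiniteMeasureOnCompacts μ := ⟨fun {K} hK => h.finite_on_compacts K hK⟩

lemma smul_measure_ne_zero {μ : Measure (DoubleBoundary N)} (h : μ ≠ 0) {r : ℝ≥0} (hr : 0 < r) :
    r • μ ≠ 0 := fun h0 => h (by
  rw [← one_smul ℝ≥0 μ, ← inv_mul_cancel₀ hr.ne', mul_smul, h0, smul_zero])

lemma classMem_of_smul {μ : Measure (DoubleBoundary N)} (h : IsCurrent μ) (h0 : μ ≠ 0) {r : ℝ≥0}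
    (hr : 0 < r) {U : Set (PCurr N)}
    (hU : PCurr.mk ⟨r • μ, h.smul r, smul_measure_ne_zero h0 hr⟩ ∈ U) : ClassMem μ U := by
  refine ⟨⟨h, h0⟩, ?_⟩
  convert hU using 1
  refine Quotient.sound ⟨r⁻¹, inv_pos.2 hr, ?_⟩
  simp only [smul_smul, inv_mul_cancel₀ hr.ne', one_smul]

/-- Classes of definite goodness converge uniformly to the stable current. -/
theorem exists_forall_classMem [Finite V] [Finite E] (hconn : Γ.IsConnected)
    (hf : f.Determines α Φ) (htt : f.IsTrainTrack) {L C : ℝ}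
    (hL : 1 < L) (hexp : f.ExpandsLegal L) (hC : f.IsBoundedCancellation C)
    {μ : NonzeroCurrent N} (hμ : IsStableCurrent α f μ) {δ : ℝ} (hδ : 0 < δ)
    {U : Set (PCurr N)} (hU : U ∈ 𝓝 (PCurr.mk μ)) :
    ∃ M : ℕ, ∀ w : FreeGroup (Fin N), w ≠ 1 → δ ≤ goodness α f C L w →
      ∀ n : ℕ, M ≤ n → ClassMem (autMap (Φ ^ n) (countingCurrent w)) U := by
  -- All admissible elements together index one net of currents; a neighbourhood of its limit then
  -- yields a single `M` for all of them.
  let ι := {w : FreeGroup (Fin N) // w ≠ 1 ∧ δ ≤ goodness α f C L w}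
  choose A hA using fun i : ι => Axis.exists_axis α i.2.1
  have hne : ∀ p : ι × ℕ, (Φ ^ p.2) p.1.1 ≠ 1 := fun p => by simpa using p.1.2.1
  choose B hB using fun p : ι × ℕ => Axis.exists_axis α (hne p)
  have hcur := fun p : ι × ℕ => (B p).isCurrent_countingCurrent hconn
  have hcur0 := fun p : ι × ℕ => (B p).countingCurrent_ne_zero hconn (hne p)
  let ν : ι × ℕ → NonzeroCurrent N := fun p =>
    ⟨(B p).scale • countingCurrent ((Φ ^ p.2) p.1.1), (hcur p).smul _,
      smul_measure_ne_zero (hcur0 p) ((B p).scale_pos (hne p))⟩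
  have hν : ∀ p, IsFiniteMeasureOnCompacts (ν p).1 := fun p => (ν p).2.1.isFiniteMeasureOnCompacts
  have hμ' := μ.2.1.isFiniteMeasureOnCompacts
  have hlim : Tendsto ν (comap Prod.snd atTop) (𝓝 μ) := by
    rw [NonzeroCurrent.tendsto_iff]
    refine α.tendsto_integral_of_tendsto_cyl hconn (fun p => (ν p).1) μ.1 ?_
    intro g v u u' hv hr hvu hg
    refine Axis.tendsto_scale_smul_cyl hconn hf htt hL hexp hC hδ (fun i : ι => i.2.1) A
      (fun i => ?_) B hv hr hvu hg ENNReal.toReal_nonneg (hμ v hv hr u u' g hvu hg)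
    rw [← (A i).goodness_mul (hA i) C L]
    exact mul_le_mul_of_nonneg_right i.2.2 (Nat.cast_nonneg _)
  have hmk : Continuous (PCurr.mk (N := N)) := continuous_quotient_mk'
  have hev := ((hmk.tendsto μ).comp hlim) hU
  rw [mem_map, mem_comap] at hev
  obtain ⟨t, ht, hsub⟩ := hev
  obtain ⟨M, hM⟩ := mem_atTop_sets.1 ht
  refine ⟨M, fun w hw hδw n hn => ?_⟩
  rw [autMap_countingCurrent]
  let p : ι × ℕ := (⟨w, hw, hδw⟩, n)
  exact classMem_of_smul (hcur p) (hcur0 p) ((B p).scale_pos (hne p)) (hsub (hM n hn : p.2 ∈ t))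

end Iteration

/-! ### Limits of measures that converge on cylinders -/

section Limits

open FreeGroup

variable {N : ℕ} {V E : Type*} [DecidableEq E] [Finite E] {Γ : OrGraph V E}

namespace Marking

variable (α : Marking Γ N)

/-- A sequence of measures that converges on cylinders has a weak limit (along an ultrafilter). -/
theorem exists_weak_limit [Finite V] (hconn : Γ.IsConnected) (ν : ℕ → Measure (DoubleBoundary N))
    [∀ n, IsFiniteMeasureOnCompacts (ν n)]
    (h : ∀ (g : FreeGroup E) (v : List (E × Bool)) (u u' : V), v ≠ [] → FreeGroup.IsReduced v →
      Γ.IsPath u v u' → Γ.IsPath α.p g.toWord u →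
      ∃ a, Tendsto (fun n => (ν n (α.cyl g v)).toReal) atTop (𝓝 a)) :
    ∃ μ : Measure (DoubleBoundary N), IsFiniteMeasureOnCompacts μ ∧
      ∀ u : C_c(DoubleBoundary N, ℝ),
        Tendsto (fun n => ∫ q, u q ∂(ν n)) (hyperfilter ℕ) (𝓝 (∫ q, u q ∂μ)) := by
  have hrect : ∀ k, ∀ w ∈ wordPairs E k, ∃ a,
      Tendsto (fun n => (ν n (α.rect k w.1 w.2)).toReal) atTop (𝓝 a) := by
    rintro k ⟨P, Q⟩ hw
    rcases Set.eq_empty_or_nonempty (α.rect k P Q) with h0 | ⟨q, hq⟩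
    · exact ⟨0, by simp [h0]⟩
    · have hq' : q ∈ α.sep k := α.rect_subset_sep hw hq
      obtain ⟨g, v, x, x', h1, h2, h3, h4, h5⟩ := α.exists_rect_eq_cyl q hq'
      rw [hq.1, hq.2] at h5
      simp only [h5]
      exact h g v x x' h1 h2 h3 h4
  have hsep : ∀ k, ∃ a, Tendsto (fun n => (ν n (α.sep k)).toReal) atTop (𝓝 a) := by
    intro k
    have h1 := hrect k
    choose! a ha using h1
    simp only [measure_sep_eq]
    exact ⟨_, tendsto_finsetSum _ ha⟩
  -- The support lies in some `α.sep k`, a finite union of rectangles whose masses converge.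
  have hbound : ∀ u : C_c(DoubleBoundary N, ℝ), ∃ B, ∀ᶠ n in atTop, |∫ q, u q ∂(ν n)| ≤ B := by
    intro u
    obtain ⟨k, hk⟩ := α.exists_subset_sep hconn u.hasCompactSupport
    obtain ⟨a, ha⟩ := hsep k
    obtain ⟨C, hC⟩ := u.hasCompactSupport.exists_bound_of_continuous (map_continuous u)
    have hle : ∀ q, ‖u q‖ ≤ (α.sep k).indicator (fun _ => |C|) q := by
      intro q
      by_cases hq : q ∈ α.sep k
      · rw [Set.indicator_of_mem hq]
        exact (hC q).trans (le_abs_self C)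
      · rw [Set.indicator_of_notMem hq,
          image_eq_zero_of_notMem_tsupport (fun h' => hq (hk h')), norm_zero]
    refine ⟨(a + 1) * |C|, ?_⟩
    filter_upwards [ha.eventually_lt_const (show a < a + 1 by linarith)] with n hn
    have hi : Integrable ((α.sep k).indicator fun _ => |C|) (ν n) := by
      rw [integrable_indicator_iff (α.isOpen_sep k).measurableSet]
      exact integrableOn_const (α.isCompact_sep k).measure_lt_top.ne
    have h1 := norm_integral_le_of_norm_le hi (Eventually.of_forall hle)
    rw [integral_indicator_const _ (α.isOpen_sep k).measurableSet, smul_eq_mul] at h1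
    exact h1.trans (mul_le_mul_of_nonneg_right hn.le (abs_nonneg C))
  -- Along an ultrafilter every bounded sequence of integrals converges, simultaneously for all test
  -- functions.
  have hle : (hyperfilter ℕ : Filter ℕ) ≤ atTop := Nat.cofinite_eq_atTop ▸ hyperfilter_le_cofinite
  have hlim : ∀ u : C_c(DoubleBoundary N, ℝ), ∃ c,
      Tendsto (fun n => ∫ q, u q ∂(ν n)) (hyperfilter ℕ) (𝓝 c) := by
    intro u
    obtain ⟨B, hB⟩ := hbound u
    obtain ⟨c, -, hc⟩ := (isCompact_Icc (a := -B) (b := B)).ultrafilter_le_nhds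
      ((hyperfilter ℕ).map fun n => ∫ q, u q ∂(ν n)) (by
        rw [le_principal_iff]
        exact (hB.filter_mono hle).mono fun n hn => abs_le.1 hn)
    exact ⟨c, hc⟩
  choose Λ hΛ using hlim
  let Λ' : C_c(DoubleBoundary N, ℝ) →ₗ[ℝ] ℝ :=
    { toFun := Λ
      map_add' := fun u v => by
        refine tendsto_nhds_unique (hΛ (u + v)) (((hΛ u).add (hΛ v)).congr fun n => ?_)
        exact (integral_add u.integrable v.integrable).symm
      map_smul' := fun c u => by
        refine tendsto_nhds_unique (hΛ (c • u)) (((hΛ u).const_mul c).congr fun n => ?_)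
        exact (integral_const_mul c _).symm }
  -- The limit functional is positive, so the Riesz representation theorem provides the limit
  -- measure.
  let Λp : C_c(DoubleBoundary N, ℝ) →ₚ[ℝ] ℝ := PositiveLinearMap.mk₀ Λ' fun u hu =>
    ge_of_tendsto' (hΛ u) fun n => integral_nonneg hu
  refine ⟨RealRMK.rieszMeasure Λp, inferInstance, fun u => ?_⟩
  rw [RealRMK.integral_rieszMeasure]
  exact hΛ u

/-- The indicator function of a cylinder. -/
lemma exists_indicator_cyl {g : FreeGroup E} {v : List (E × Bool)} (hv : v ≠ [])
    (hr : FreeGroup.IsReduced v) : ∃ u : C_c(DoubleBoundary N, ℝ),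
      ∀ ν : Measure (DoubleBoundary N), ∫ q, u q ∂ν = (ν (α.cyl g v)).toReal := by
  have hc := α.isCompact_cyl (g := g) hv hr
  have ho := α.isOpen_cyl (g := g) hv hr
  have hcont : Continuous ((α.cyl g v).indicator fun _ => (1 : ℝ)) :=
    IsClopen.continuous_indicator ⟨hc.isClosed, ho⟩ continuous_const
  refine ⟨⟨⟨_, hcont⟩, HasCompactSupport.intro hc fun q hq => ?_⟩, fun ν => ?_⟩
  · exact Set.indicator_of_notMem hq (fun _ => (1 : ℝ))
  change ∫ q, (α.cyl g v).indicator (fun _ => (1 : ℝ)) q ∂ν = _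
  rw [integral_indicator_const _ ho.measurableSet]
  simp [Measure.real]

end Marking

/-- Weak limits of measures that are invariant under a homeomorphism are invariant. -/
lemma map_eq_of_weak_limit {ν : ℕ → Measure (DoubleBoundary N)} {μ : Measure (DoubleBoundary N)}
    [IsFiniteMeasureOnCompacts μ]
    (hlim : ∀ u : C_c(DoubleBoundary N, ℝ),
        Tendsto (fun n => ∫ q, u q ∂(ν n)) (hyperfilter ℕ) (𝓝 (∫ q, u q ∂μ)))
    (T : DoubleBoundary N ≃ₜ DoubleBoundary N) (hT : ∀ n, (ν n).map T = ν n) : μ.map T = μ := by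
  have : IsFiniteMeasureOnCompacts (μ.map T) := Measure.IsFiniteMeasureOnCompacts.map μ T
  refine Measure.ext_of_integral_eq_on_compactlySupported fun u => ?_
  let u' : C_c(DoubleBoundary N, ℝ) :=
    ⟨⟨fun q => u (T q), (map_continuous u).comp T.continuous⟩,
      u.hasCompactSupport.comp_homeomorph T⟩
  have h1 : ∀ ρ : Measure (DoubleBoundary N), ∫ q, u q ∂(ρ.map T) = ∫ q, u' q ∂ρ := fun ρ =>
    integral_map_equiv T.toMeasurableEquiv u
  rw [h1]
  refine tendsto_nhds_unique ((hlim u').congr fun n => ?_) (hlim u)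
  rw [← h1, hT]

/-- Left translations as homeomorphisms of the double boundary. -/
def mulHomeomorph (k : FreeGroup (Fin N)) : DoubleBoundary N ≃ₜ DoubleBoundary N where
  toFun := dblMap fun g => k * g
  invFun := dblMap fun g => k⁻¹ * g
  left_inv := dblMap_leftInverse (tameOn_mul_left k) (tameOn_mul_left k⁻¹) (inv_mul_cancel_left k)
      (mul_inv_cancel_left k)
  right_inv := dblMap_leftInverse (tameOn_mul_left k⁻¹) (tameOn_mul_left k) (mul_inv_cancel_left k)
      (inv_mul_cancel_left k)
  continuous_toFun := continuous_dblMap (tameOn_mul_left k) (bdryMap_mul_left_injective k)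
  continuous_invFun := continuous_dblMap (tameOn_mul_left k⁻¹) (bdryMap_mul_left_injective k⁻¹)

/-- The flip as a homeomorphism of the double boundary. -/
def flipHomeomorph : DoubleBoundary N ≃ₜ DoubleBoundary N where
  toFun := flipMap
  invFun := flipMap
  left_inv _ := rfl
  right_inv _ := rfl
  continuous_toFun := continuous_flipMap
  continuous_invFun := continuous_flipMap

end Limits

/-! ### Legal loops -/

section LegalLoops

open FreeGroup

lemma exists_eq_append_of_duplicate {A : Type*} {l : List A} {a : A} (h : List.Duplicate a l) :
    ∃ p r q, l = p ++ a :: (r ++ a :: q) := by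
  induction h with
  | cons_mem h =>
    obtain ⟨r, q, rfl⟩ := List.append_of_mem h
    exact ⟨[], r, q, rfl⟩
  | cons_duplicate h ih =>
    obtain ⟨p, r, q, rfl⟩ := ih
    exact ⟨_ :: p, r, q, rfl⟩

variable {V E : Type*} [Finite E] {Γ : OrGraph V E} {N : ℕ} {f : GraphMap Γ}

/-- Once `f^n(e)` is longer than the number of oriented edges, it crosses some oriented edge twice
in the same direction. The stretch from one crossing to the next closes up to a legal loop. -/
lemma exists_legal_loop [Nonempty E] (htt : f.IsTrainTrack) {K : ℝ} (hK : 1 < K)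
    (hexp : f.ExpandsLegal K) : ∃ (L : ℕ) (_ : NeZero L) (b : ZMod L → E × Bool) (x : V),
      Γ.IsPath x (seg b 0 L) x ∧ ∀ i, f.LegalTurn (invLetter (b i)) (b (i + 1)) := by
  cases nonempty_fintype E
  obtain ⟨e⟩ := ‹Nonempty E›
  obtain ⟨n, hn⟩ := ((tendsto_pow_atTop_atTop_of_one_lt hK).eventually_gt_atTop
    (Fintype.card (E × Bool) : ℝ)).exists
  have hleg := (f.legalPath_singleton (e, true)).iterate htt n
  have hlen := (f.legalPath_singleton (e, true)).length_iterate htt hK hexp n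
  set l := f.map^[n] [(e, true)] with hl
  have hnd : ¬ l.Nodup := by
    intro h
    have h1 := h.length_le_card
    have h2 : (l.length : ℝ) ≤ Fintype.card (E × Bool) := by exact_mod_cast h1
    simp at hlen
    linarith
  obtain ⟨a, ha⟩ := List.exists_duplicate_iff_not_nodup.2 hnd
  obtain ⟨p, r, q, hprq⟩ := exists_eq_append_of_duplicate ha
  have hL : NeZero (a :: r).length := ⟨by simp⟩
  obtain ⟨b, hb⟩ := exists_seg_eq (List.cons_ne_nil a r)
  have hb0 : b 0 = a := by
    have h1 := getElem?_seg b 0 (a :: r).length 0 (by simp)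
    rw [hb] at h1
    simpa using h1.symm
  -- The extra letter is the repeated edge: it makes the closing turn of the loop a turn of the
  -- legal path.
  have hseg : seg b 0 ((a :: r).length + 1) = a :: r ++ [a] := by
    rw [seg_concat, hb, zero_add, ZMod.natCast_self, hb0]
  have hl' : l = p ++ (seg b 0 ((a :: r).length + 1) ++ q) := by
    rw [hseg, hprq]
    simp
  rw [hl'] at hleg
  have hleg' := hleg.right.left
  obtain ⟨⟨x, y, hxy⟩, hchain⟩ := hleg'
  refine ⟨_, hL, b, x, ?_, fun i => ?_⟩
  · rw [hseg, OrGraph.isPath_append] at hxy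
    obtain ⟨z, hz, hz'⟩ := hxy
    have h1 : Γ.o a = x := hz.1
    have h2 : Γ.o a = z := hz'.1
    rw [hb]
    rwa [← h2, h1] at hz
  · rw [List.isChain_iff_getElem] at hchain
    have hi := ZMod.val_lt i
    have h1 := hchain i.val (by rw [length_seg]; omega)
    have h2 : ∀ (k : ℕ) (hk : k < (seg b 0 ((a :: r).length + 1)).length),
        (seg b 0 ((a :: r).length + 1))[k] = b k := by
      intro k hk
      have h3 := getElem?_seg b 0 ((a :: r).length + 1) k (by simpa using hk)
      rw [List.getElem?_eq_getElem hk, Option.some.injEq, zero_add] at h3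
      exact h3
    rw [h2, h2] at h1
    push_cast at h1
    rwa [ZMod.natCast_zmod_val] at h1

/-- There is a conjugacy class whose circuit has only legal turns. -/
lemma exists_legal_axis [DecidableEq E] [Nonempty E] (α : Marking Γ N) (hconn : Γ.IsConnected)
    (htt : f.IsTrainTrack) {K : ℝ} (hK : 1 < K) (hexp : f.ExpandsLegal K) :
    ∃ w : FreeGroup (Fin N), w ≠ 1 ∧ ∃ A : Axis α w, ∀ C : ℝ,
      (1 : ℝ) * A.L ≤ {i : ℕ | i < A.L ∧ f.GoodEdge C (seg A.b 0 A.L) i}.ncard := by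
  obtain ⟨L, hL, b, x, hx, hb⟩ := exists_legal_loop htt hK hexp
  have hcyc : CycReduced b := fun i h => hb i 0 (by simp [h])
  obtain ⟨l, hl⟩ := hconn α.p x
  have hl' := hl.toWord_mk
  have hx' : Γ.IsPath x (FreeGroup.mk (seg b 0 L)).toWord x := hx.toWord_mk
  obtain ⟨w, hw⟩ := (α.mem_range_iff (FreeGroup.mk l * FreeGroup.mk (seg b 0 L) *
    (FreeGroup.mk l)⁻¹)).2 ((hl'.mul hx').mul hl'.inv)
  refine ⟨w, ?_, ⟨L, hL, b, hcyc, _, x, hl', hx, hw⟩, fun C => ?_⟩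
  · rintro rfl
    rw [_root_.map_one, eq_comm, conj_eq_one_iff, ← toWord_eq_nil_iff,
      toWord_mk_of_isReduced (isReduced_seg hcyc _ _)] at hw
    have := congrArg List.length hw
    rw [length_seg] at this
    exact NeZero.ne L this
  -- Every edge is good vacuously, whatever `C` is, as the circuit has no illegal turn.
  · have h1 : {i : ℕ | i < L ∧ f.GoodEdge C (seg b 0 L) i} = Set.Iio L := by
      ext i
      simp only [Set.mem_ofPred_eq, Set.mem_Iio, and_iff_left_iff_imp]
      intro _ j hj hj'
      rw [length_seg] at hj
      refine absurd (fun y z hy hz => ?_) hj'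
      have hL0 := Nat.pos_of_neZero L
      rw [length_seg] at hy hz
      rw [getElem?_seg _ _ _ _ (Nat.mod_lt _ hL0), Option.some.injEq, zero_add,
        ZMod.natCast_mod] at hy hz
      rw [← hy, ← hz]
      convert hb ((j + L - 1 : ℕ) : ZMod L) using 2
      rw [Nat.add_sub_assoc (by omega), Nat.cast_add, Nat.cast_sub (by omega)]
      simp
    change (1 : ℝ) * L ≤ ({i : ℕ | i < L ∧ f.GoodEdge C (seg b 0 L) i}.ncard : ℝ)
    rw [h1]
    simp

end LegalLoops

/-! ### Existence of the stable current -/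

section Existence

open FreeGroup

variable {N : ℕ} {V E : Type*} [DecidableEq E] {Γ : OrGraph V E}

/-- Each letter of `l` is crossed by exactly one unoriented edge. In the limit the single-edge
frequencies therefore sum to one, which keeps the stable current from vanishing. -/
lemma sum_occSymm_singleton [Fintype E] (l : List (E × Bool)) :
    ∑ e : E, occSymm [(e, true)] l = l.length := by
  induction l with
  | nil => simp [occSymm, occ]
  | cons a l ih =>
    have h1 : ∀ e : E, occSymm [(e, true)] (a :: l) =
        (if e = a.1 then 1 else 0) + occSymm [(e, true)] l := by
      intro e
      obtain ⟨c, _ | _⟩ := a <;>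
        simp [occSymm, occ_cons, invRev] <;> omega
    simp only [h1, Finset.sum_add_distrib, ih]
    simp [add_comm]

lemma Marking.nonempty_edges (α : Marking Γ N) (hN : 2 ≤ N) : Nonempty E := by
  by_contra h
  rw [not_nonempty_iff] at h
  have h1 : FreeGroup.of (⟨0, by omega⟩ : Fin N) = 1 :=
    α.injective (Subsingleton.elim _ _)
  exact FreeGroup.of_ne_one _ h1

/-- The stable current exists. -/
theorem exists_stableCurrent [Finite V] [Fintype E] (hN : 2 ≤ N) (α : Marking Γ N)
    (hconn : Γ.IsConnected) {f : GraphMap Γ} {Φ : MulAut (FreeGroup (Fin N))}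
    (hf : f.Determines α Φ) (htt : f.IsTrainTrack) (hM : ∀ i j : E, 0 < f.transitionMatrix i j)
    {L C : ℝ} (hL : 1 < L) (hexp : f.ExpandsLegal L) (hC : f.IsBoundedCancellation C) :
    ∃ μ : NonzeroCurrent N, IsStableCurrent α f μ := by
  have := α.nonempty_edges hN
  have hfreq := fun (v : List (E × Bool)) (hv : v ≠ []) => GraphMap.exists_frequency htt hM hv
  choose a ha hlim using hfreq
  -- The iterates of a class of goodness one serve as approximations. Being currents, they pass
  -- invariance under `F_N` and the flip on to the limit.
  obtain ⟨w, hw, A, hA⟩ := exists_legal_axis α hconn htt hL hexp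
  have hne : ∀ n, (Φ ^ n) w ≠ 1 := fun n => by simpa using hw
  choose B hB using fun n => Axis.exists_axis α (hne n)
  have hcur := fun n => ((B n).isCurrent_countingCurrent hconn).smul (B n).scale
  let ν : ℕ → Measure (DoubleBoundary N) := fun n => (B n).scale • countingCurrent ((Φ ^ n) w)
  have hν : ∀ n, IsFiniteMeasureOnCompacts (ν n) := fun n => (hcur n).isFiniteMeasureOnCompacts
  have hcyl : ∀ (g : FreeGroup E) (v : List (E × Bool)) (u u' : V) (hv : v ≠ []),
      FreeGroup.IsReduced v → Γ.IsPath u v u' → Γ.IsPath α.p g.toWord u →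
        Tendsto (fun n => (ν n (α.cyl g v)).toReal) atTop (𝓝 (a v hv)) := by
    intro g v u u' hv hr hvu hg
    have h1 := Axis.tendsto_scale_smul_cyl hconn hf htt hL hexp hC one_pos (ι := Unit)
      (w := fun _ => w) (fun _ => hw) (fun _ => A) (fun _ => hA _) (fun p => B p.2) hv hr hvu hg
      (ha v hv) (hlim v hv)
    have h2 : Tendsto (fun n : ℕ => ((), n)) atTop (comap Prod.snd atTop) :=
      tendsto_comap_iff.2 tendsto_id
    exact Tendsto.comp (f := fun n : ℕ => ((), n)) (y := comap Prod.snd atTop) (g := fun p : Unit × ℕ =>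
      (((B p.2).scale • countingCurrent ((Φ ^ p.2) w)) (α.cyl g v)).toReal) h1 h2
  obtain ⟨μ, hμfin, hμ⟩ := α.exists_weak_limit hconn ν fun g v u u' hv hr hvu hg =>
    ⟨_, hcyl g v u u' hv hr hvu hg⟩
  have hμcyl : ∀ (g : FreeGroup E) (v : List (E × Bool)) (u u' : V) (hv : v ≠ []),
      FreeGroup.IsReduced v → Γ.IsPath u v u' → Γ.IsPath α.p g.toWord u →
        (μ (α.cyl g v)).toReal = a v hv := by
    intro g v u u' hv hr hvu hg
    obtain ⟨φ, hφ⟩ := α.exists_indicator_cyl (g := g) hv hr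
    have h1 := hμ φ
    simp only [hφ] at h1
    exact tendsto_nhds_unique h1 ((hcyl g v u u' hv hr hvu hg).mono_left
      (Nat.cofinite_eq_atTop ▸ hyperfilter_le_cofinite))
  have hμcur : IsCurrent μ :=
    { finite_on_compacts := fun K hK => hK.measure_lt_top
      invariant := fun k => map_eq_of_weak_limit hμ (mulHomeomorph k) fun n =>
        (hcur n).invariant k
      flip_invariant := map_eq_of_weak_limit hμ flipHomeomorph fun n => (hcur n).flip_invariant }
  -- For the zero measure all single-edge frequencies would vanish, although they sum to one in
  -- every `f^n(e₀)`.
  have hμ0 : μ ≠ 0 := by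
    rintro rfl
    have h0 : ∀ e : E, a [(e, true)] (by simp) = 0 := by
      intro e
      obtain ⟨l, hl⟩ := hconn α.p (Γ.o (e, true))
      have h1 := hμcyl (FreeGroup.mk l) [(e, true)] (Γ.o (e, true)) (Γ.t (e, true)) (by simp)
        (by simp) ⟨rfl, rfl⟩ hl.toWord_mk
      simpa using h1.symm
    obtain ⟨e₀⟩ := this
    have h1 : Tendsto (fun n : ℕ => ∑ e : E, (occSymm [(e, true)] (f.map^[n] [(e₀, true)]) : ℝ) /
        (f.map^[n] [(e₀, true)]).length) atTop (𝓝 (∑ e : E, a [(e, true)] (by simp))) :=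
      tendsto_finsetSum _ fun e _ => hlim _ _ _
    simp only [h0, Finset.sum_const_zero, ← Finset.sum_div, ← Nat.cast_sum,
      sum_occSymm_singleton] at h1
    have h2 : ∀ n, ((f.map^[n] [(e₀, true)]).length : ℝ) / (f.map^[n] [(e₀, true)]).length = 1 := by
      intro n
      refine div_self ?_
      have h3 := f.head_iterate_map htt.1 n (e₀, true) []
      intro h4
      rw [Nat.cast_eq_zero, List.length_eq_zero_iff] at h4
      rw [h4] at h3
      simp at h3
    simp only [h2] at h1
    exact one_ne_zero (tendsto_nhds_unique tendsto_const_nhds h1)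
  refine ⟨⟨μ, hμcur, hμ0⟩, fun v hv hr u u' g hvu hg e => ?_⟩
  change Tendsto _ atTop (𝓝 (μ (α.cyl g v)).toReal)
  rw [hμcyl g v u u' hv hr hvu hg]
  exact hlim v hv e

end Existence

end FreeCurrents

end

open FreeCurrents in
theorem lemma3p8 {N : ℕ} (hN : 2 ≤ N)
    (Φ : MulAut (FreeGroup (Fin N))) (hiwip : IsIwip Φ) (hhyp : IsAtoroidal Φ)
    {V E : Type*} [Fintype V] [Fintype E] [DecidableEq E]
    (Γ : OrGraph V E) (hconn : Γ.IsConnected) (hval : Γ.NoValenceOne) (α : Marking Γ N)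
    (f : GraphMap Γ) (hf : f.Determines α Φ) (htt : f.IsTrainTrack)
    (hM : ∀ i j : E, 0 < f.transitionMatrix i j) (hper : f.FixesPeriodicEdges)
    (lam' : ℝ) (hlam' : 1 < lam') (hexp : f.ExpandsLegal lam')
    (Cf : ℝ) (hCf : f.IsBoundedCancellation Cf) :
    (∃ μ : NonzeroCurrent N, IsStableCurrent α f μ) ∧
    ∀ μ : NonzeroCurrent N, IsStableCurrent α f μ →
      ∀ δ : ℝ, 0 < δ → ∀ U ∈ nhds (PCurr.mk μ), ∃ M : ℕ,
        ∀ w : FreeGroup (Fin N), w ≠ 1 → δ ≤ goodness α f Cf lam' w →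
          ∀ n : ℕ, M ≤ n → ClassMem (autMap (Φ ^ n) (countingCurrent w)) U := by
  exact ⟨exists_stableCurrent hN α hconn hf htt hM hlam' hexp hCf, fun μ hμ δ hδ U hU =>
    exists_forall_classMem hconn hf htt hlam' hexp hCf hμ hδ hU⟩
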